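/- **The data structure.** The $k$-LSM priority queue is shared by $T$ threads and offers the operations $\texttt{insert}(key)$ and $\texttt{delete\_min}$, with keys from a linearly ordered set. Memory is garbage collected (every allocated object has a fresh address), every access to it is one atomic step, the steps of the threads interleave arbitrarily, any thread may stop forever, and random choices are arbitrary (adversarial). * An *item* is a key with a Boolean flag; it is *logically deleted* by an atomic test-and-set of the flag, and *active* as long as the flag is not set. A *block* of level $l$ is an array of at most $2^l$ pointers to items in decreasing key order, with a counter `filled`. `copy` and `merge` create new blocks without the items found to be logically deleted. `shrink` decreases `filled` past logically deleted items at the end of the block and, if the remaining items fit into a lower level, copies the block into one of that level, recursively. `consolidate` goes through a list of blocks of decreasing level from the smallest to the largest, shrinks each block and merges it with its smaller neighbour as long as its level is not larger, and finally removes the empty blocks. * The *distributed LSM* (`DistLSM`): every thread owns an array of blocks with strictly decreasing levels below $\lfloor\log_2 k\rfloor$ (for $k=0$: no blocks). `DistLSM::find_min` consolidates the own array and returns the smallest of the last items of its blocks, or null if there is no block. * The *shared $k$-LSM* (`SharedKLSM`): one pointer `shared` to an immutable array of blocks with a pivot index for each block, which separates the keys that are not larger than the $(k+1)$-st smallest key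 from the others. Each thread has thread-local pointers `observed` (the value of `shared` last read) and `snapshot` (a private copy of that array). `BlockArray::find_min` on the snapshot picks a random item between the pivot index and `filled` of some block; if that one is logically deleted it takes the last item of the same block; it returns no item if the range is found to be empty. `SharedKLSM::find_min` repeats: if `shared` $\ne$ `observed`, take a new snapshot; return null if the snapshot is null; search the snapshot; return the item found if it is active; otherwise consolidate the snapshot and recompute its pivots, set it to null if it has become empty, and, if it has become empty or a merge has occurred, try to replace `shared` by it with a compare-and-swap against `observed`. * `insert` creates a block of level $0$ and merges it with the own blocks from the back as long as their levels are not larger. A result of level below $\lfloor\log_2 k\rfloor$ is stored in the own distributed LSM. Otherwise the thread repeatedly takes a new snapshot, inserts the block, consolidates and tries to replace `shared` by compare-and-swap, until it succeeds; then it takes a new snapshot, and cuts the own array. * `delete_min` repeats: call `DistLSM::find_min` and `SharedKLSM::find_min` and take the item with the smaller key. If there is one, try to delete it logically; return it if this test-and-set succeeds, and repeat otherwise. If both are null, *spy*: copy the active items in the blocks of the distributed LSM of a randomly chosen thread into the own one (keeping levels strictly decreasing, and no empty copies); repeat if this has produced a block, and otherwise return null. **Lemma.** Consider any infinite execution in which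 the threads, starting from the empty queue, execute arbitrary sequences of `insert` and `delete_min` operations. 1. `delete_min` is lock-free: if a thread is executing `delete_min` at some time and takes infinitely many steps, then after that time some operation of some thread returns. 2. The search methods on thread-local data, `DistLSM::find_min` and `BlockArray::find_min` on the private snapshot, are wait-free: whenever a thread is executing one of them, there is a number $B$ such that, whatever the other threads do from then on, the thread has left the method after at most $B$ own steps. 3. Repeated failures of `delete_min` are caused only by other threads, or are resolved by cleaning up: if a thread is executing `delete_min` at some time and takes infinitely many steps, and if from that time on no *other* thread logically deletes an item or replaces `shared`, then the call returns. 4. The call ends by finding an active item or an empty queue: a `delete_min` that returns an item has, during the call, itself changed the flag of that item from active to logically deleted; and if `delete_min` returns null, then at some moment during the call the distributed LSM of its thread contained no block and `shared` was null. -/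

import Mathlib

/-!
A step-by-step model of the `k`-LSM concurrent priority queue with `T` threads.

* Shared memory is garbage collected: every allocation receives a fresh address.
* A pointer is represented by its address together with the part of the object that never
  changes after the object has become visible to other threads (the key of an item; the level and
  the item array of a block; a published block array).  What does change, the deletion flag of an
  item and the field `filled` of a block, is kept in the memory, indexed by the address.
* Every access to the memory is one atomic step; steps of different threads interleave
  arbitrarily (sequential consistency), and all random choices are made by an adversary.
-/

namespace KLSM

/-- (Pointer to) an item: its address and its key.  The deletion flag lives in the memory. -/
structure Item (K : Type) where
  addr : ℕ
  key : K
deriving DecidableEq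

/-- (Pointer to) a block: its address, its level, and its item array in decreasing key order.
The field `filled` lives in the memory. -/
structure Block (K : Type) where
  addr : ℕ
  level : ℕ
  items : List (Item K)
deriving DecidableEq

/-- (Pointer to) an array of blocks, by decreasing level, with one pivot index per block. -/
structure BlockArray (K : Type) where
  addr : ℕ
  blocks : List (Block K)
  pivots : List ℕ
deriving DecidableEq

/-- The memory.  `observed` and `snapshot` are the thread-local pointers of the shared `k`-LSM,
`slot t` and `size t` are the block array and its size in the distributed LSM of thread `t`.
`none` is the null pointer, `next` the next free address. -/
structure Mem (K : Type) (T : ℕ) where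
  next : ℕ
  flag : ℕ → Bool
  filled : ℕ → ℕ
  shared : Option (BlockArray K)
  observed : Fin T → Option (BlockArray K)
  snapshot : Fin T → Option (BlockArray K)
  slot : Fin T → ℕ → Option (Block K)
  size : Fin T → ℕ

/-- The empty queue: all pointers are null. -/
def Mem.init (K : Type) (T : ℕ) : Mem K T where
  next := 0
  flag := fun _ => false
  filled := fun _ => 0
  shared := none
  observed := fun _ => none
  snapshot := fun _ => none
  slot := fun _ _ => none
  size := fun _ => 0

/-! ### Atomic operations and programs -/

/-- The atomic operations. -/
inductive Op (K : Type) (T : ℕ) : Type where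
  | newItem (key : K)
  | readFlag (i : Item K)
  | testAndSet (i : Item K)
  | newBlock (level : ℕ) (items : List (Item K))
  | readFilled (b : Block K)
  | writeFilled (b : Block K) (n : ℕ)
  | newBlockArray
  | copyBlockArray (a : BlockArray K)
  | readShared
  | casShared (expected new : Option (BlockArray K))
  | getObserved
  | setObserved (a : Option (BlockArray K))
  | getSnapshot
  | setSnapshot (a : Option (BlockArray K))
  | readSize (v : Fin T)
  | writeSize (n : ℕ)
  | readSlot (v : Fin T) (i : ℕ)
  | writeSlot (i : ℕ) (b : Block K)
  | randInt (n : ℕ)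
  | randThread

/-- The type of the value that an atomic operation returns. -/
def Op.Resp {K : Type} {T : ℕ} : Op K T → Type
  | .newItem _ => Item K
  | .readFlag _ => Bool
  | .testAndSet _ => Bool
  | .newBlock _ _ => Block K
  | .readFilled _ => ℕ
  | .writeFilled _ _ => Unit
  | .newBlockArray => BlockArray K
  | .copyBlockArray _ => BlockArray K
  | .readShared => Option (BlockArray K)
  | .casShared _ _ => Bool
  | .getObserved => Option (BlockArray K)
  | .setObserved _ => Unit
  | .getSnapshot => Option (BlockArray K)
  | .setSnapshot _ => Unit
  | .readSize _ => ℕ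
  | .writeSize _ => Unit
  | .readSlot _ _ => Option (Block K)
  | .writeSlot _ _ => Unit
  | .randInt n => Fin (n + 1)
  | .randThread => Fin T

/-- `o.Exec t m r m'`: executing `o` atomically by thread `t` in memory `m` may return `r` and leave
the memory `m'`.  Only the two random choices are nondeterministic. -/
def Op.Exec {K : Type} [DecidableEq K] {T : ℕ} (t : Fin T) :
    (o : Op K T) → Mem K T → o.Resp → Mem K T → Prop
  | .newItem key, m, r, m' =>
      r = ⟨m.next, key⟩ ∧
        m' = { m with next := m.next + 1, flag := Function.update m.flag m.next false }
  | .readFlag i, m, r, m' => r = m.flag i.addr ∧ m' = m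
  | .testAndSet i, m, r, m' =>
      -- the result says whether this call has set the flag
      r = !m.flag i.addr ∧ m' = { m with flag := Function.update m.flag i.addr true }
  | .newBlock l its, m, r, m' =>
      r = ⟨m.next, l, its⟩ ∧
        m' = { m with
          next := m.next + 1, filled := Function.update m.filled m.next its.length }
  | .readFilled b, m, r, m' => r = m.filled b.addr ∧ m' = m
  | .writeFilled b n, m, _, m' => m' = { m with filled := Function.update m.filled b.addr n }
  | .newBlockArray, m, r, m' => r = ⟨m.next, [], []⟩ ∧ m' = { m with next := m.next + 1 }
  | .copyBlockArray a, m, r, m' =>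
      r = { a with addr := m.next } ∧ m' = { m with next := m.next + 1 }
  | .readShared, m, r, m' => r = m.shared ∧ m' = m
  | .casShared e n, m, r, m' =>
      r = decide (m.shared = e) ∧ m' = if m.shared = e then { m with shared := n } else m
  | .getObserved, m, r, m' => r = m.observed t ∧ m' = m
  | .setObserved a, m, _, m' => m' = { m with observed := Function.update m.observed t a }
  | .getSnapshot, m, r, m' => r = m.snapshot t ∧ m' = m
  | .setSnapshot a, m, _, m' => m' = { m with snapshot := Function.update m.snapshot t a }
  | .readSize v, m, r, m' => r = m.size v ∧ m' = m
  | .writeSize n, m, _, m' => m' = { m with size := Function.update m.size t n }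
  | .readSlot v i, m, r, m' => r = m.slot v i ∧ m' = m
  | .writeSlot i b, m, _, m' =>
      m' = { m with
        slot := Function.update m.slot t (Function.update (m.slot t) i (some b)) }
  | .randInt _, m, _, m' => m' = m
  | .randThread, m, _, m' => m' = m

/-- Loop-free code, and code whose loops are bounded: the next atomic operation and what to do
with its result.  Unbounded loops are not written as programs, but by jumps (see `Loc`). -/
inductive Prog (K : Type) (T : ℕ) (α : Type) : Type where
  | ret (a : α) : Prog K T α
  | op (o : Op K T) (next : o.Resp → Prog K T α) : Prog K T α

/-- Sequential composition. -/
def Prog.bind {K : Type} {T : ℕ} {α β : Type} : Prog K T α → (α → Prog K T β) → Prog K T β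
  | .ret a, f => f a
  | .op o next, f => .op o (fun r => (next r).bind f)

instance (K : Type) (T : ℕ) : Monad (Prog K T) where
  pure := Prog.ret
  bind := Prog.bind

/-- A single atomic operation as a program. -/
def Op.run {K : Type} {T : ℕ} (o : Op K T) : Prog K T o.Resp := .op o Prog.ret

section Code

variable {K : Type} [LinearOrder K] {T : ℕ}

def newItem (key : K) : Prog K T (Item K) := (Op.newItem key).run
def readFlag (i : Item K) : Prog K T Bool := (Op.readFlag i).run
def testAndSet (i : Item K) : Prog K T Bool := (Op.testAndSet i).run
def newBlock (l : ℕ) (its : List (Item K)) : Prog K T (Block K) := (Op.newBlock l its).run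
def readFilled (b : Block K) : Prog K T ℕ := (Op.readFilled b).run
def writeFilled (b : Block K) (n : ℕ) : Prog K T Unit := (Op.writeFilled b n).run
def newBlockArray : Prog K T (BlockArray K) := Op.newBlockArray.run
def copyBlockArray (a : BlockArray K) : Prog K T (BlockArray K) := (Op.copyBlockArray a).run
def readShared : Prog K T (Option (BlockArray K)) := Op.readShared.run
def casShared (e n : Option (BlockArray K)) : Prog K T Bool := (Op.casShared e n).run
def getObserved : Prog K T (Option (BlockArray K)) := Op.getObserved.run
def setObserved (a : Option (BlockArray K)) : Prog K T Unit := (Op.setObserved a).run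
def getSnapshot : Prog K T (Option (BlockArray K)) := Op.getSnapshot.run
def setSnapshot (a : Option (BlockArray K)) : Prog K T Unit := (Op.setSnapshot a).run
def readSize (v : Fin T) : Prog K T ℕ := (Op.readSize v).run
def writeSize (n : ℕ) : Prog K T Unit := (Op.writeSize n).run
def readSlot (v : Fin T) (i : ℕ) : Prog K T (Option (Block K)) := (Op.readSlot v i).run
def writeSlot (i : ℕ) (b : Block K) : Prog K T Unit := (Op.writeSlot i b).run
def randInt (n : ℕ) : Prog K T (Fin (n + 1)) := (Op.randInt n).run
def randThread : Prog K T (Fin T) := Op.randThread.run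

/-! ### Blocks

A new block is private to its creator until it is stored in a slot or in `shared`, so its item
array is collected first (testing the flag of every item at the time it is appended), and the block
is then allocated with `filled` equal to the number of its items. -/

/-- The loop of `copy`: run through the items at the positions `i`, `i + 1`, … below `filled`, and
keep those that are not logically deleted. -/
def copyLoop (b : Block K) : ℕ → List (Item K) → Prog K T (List (Item K))
  | _, [] => pure []
  | i, it :: rest => do
      let f ← readFilled b
      if i < f then do
        let deleted ← readFlag it
        let tl ← copyLoop b (i + 1) rest
        pure (if deleted then tl else it :: tl)
      else pure []

/-- `Block::copy`: a new block of level `l` with the items that are not logically deleted. -/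
def Block.copy (b : Block K) (l : ℕ) : Prog K T (Block K) := do
  let its ← copyLoop b 0 b.items
  newBlock l its

/-- Append the given items one by one, skipping those that are logically deleted. -/
def appendLoop : List (Item K) → Prog K T (List (Item K))
  | [] => pure []
  | it :: rest => do
      let deleted ← readFlag it
      let tl ← appendLoop rest
      pure (if deleted then tl else it :: tl)

/-- `Block::merge_in`: the two-way merge of two blocks into a new block of level `l`. -/
def mergeBlocks (l : ℕ) (b c : Block K) : Prog K T (Block K) := do
  let f ← readFilled b
  let g ← readFilled c
  let its ← appendLoop
    (List.merge (b.items.take f) (c.items.take g) (fun x y => decide (y.key ≤ x.key)))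
  newBlock l its

/-- The number of items that remain when logically deleted items are removed from the end of an
array, which is given in reverse. -/
def tailScan : List (Item K) → Prog K T ℕ
  | [] => pure 0
  | it :: rest => do
      let deleted ← readFlag it
      if deleted then tailScan rest else pure (rest.length + 1)

/-- Decrease the level `l` as long as `f` items still fit into half of the array. -/
def fitLevel (f : ℕ) : ℕ → ℕ
  | 0 => 0
  | l + 1 => if f ≤ 2 ^ l then fitLevel f l else l + 1

/-- `Block::shrink`, where the first argument bounds the depth of the recursion. -/
def shrinkAux : ℕ → Block K → Prog K T (Block K)
  | 0, b => do
      let f₀ ← readFilled b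
      let f ← tailScan (b.items.take f₀).reverse
      writeFilled b f
      pure b
  | n + 1, b => do
      let f₀ ← readFilled b
      let f ← tailScan (b.items.take f₀).reverse
      if fitLevel f b.level < b.level then do
        let c ← b.copy (fitLevel f b.level)
        shrinkAux n c
      else do
        writeFilled b f
        pure b

/-- `Block::shrink`.  Every recursive call is on a block of smaller level, so the depth of the
recursion is at most the level. -/
def Block.shrink (b : Block K) : Prog K T (Block K) := shrinkAux b.level b

/-- The item with the smallest key of a block. -/
def Block.last (b : Block K) : Prog K T (Option (Item K)) := do
  let f ← readFilled b
  match f with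
  | 0 => pure none
  | f + 1 => pure b.items[f]?

/-! ### Consolidation -/

/-- Put the block `b` in front of blocks of strictly decreasing levels, merging as long as its level
is not larger than the next one.  The flag says whether a merge has occurred. -/
def mergeFront : Block K → List (Block K) → Bool → Prog K T (List (Block K) × Bool)
  | b, [], merged => pure ([b], merged)
  | b, c :: rest, merged =>
      if b.level ≤ c.level then do
        let d ← mergeBlocks (c.level + 1) b c
        let d' ← d.shrink
        mergeFront d' rest true
      else pure (b :: c :: rest, merged)

/-- First pass of `consolidate`: from the smallest block to the largest one, shrink and merge. -/
def consolidatePass : List (Block K) → Prog K T (List (Block K) × Bool)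
  | [] => pure ([], false)
  | b :: rest => do
      let r ← consolidatePass rest
      let b' ← b.shrink
      mergeFront b' r.1 r.2

/-- Second pass of `consolidate`: remove the empty blocks. -/
def dropEmpty : List (Block K) → Prog K T (List (Block K))
  | [] => pure []
  | b :: rest => do
      let f ← readFilled b
      let tl ← dropEmpty rest
      pure (if f = 0 then tl else b :: tl)

/-- The filled parts of the given blocks. -/
def readContents : List (Block K) → Prog K T (List (List (Item K)))
  | [] => pure []
  | b :: rest => do
      let f ← readFilled b
      let tl ← readContents rest
      pure (b.items.take f :: tl)

/-- Given the contents of the blocks, the pivot indices: the pivot key is the `(k + 1)`-st smallest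
key (or the largest key, if there are at most `k` items), and the index of a block is the position
of its first key that is at most the pivot key. -/
def pivotsOf (k : ℕ) (cs : List (List (Item K))) : List ℕ :=
  let keys := (cs.flatten.map Item.key).mergeSort (fun x y => decide (x ≤ y))
  match keys[min k (keys.length - 1)]? with
  | none => cs.map (fun _ => 0)
  | some p => cs.map (fun c => c.findIdx (fun i => decide (i.key ≤ p)))

/-- `BlockArray::consolidate`, followed by `BlockArray::calculate_pivots`. -/
def BlockArray.consolidate (k : ℕ) (a : BlockArray K) : Prog K T (BlockArray K × Bool) := do
  let r ← consolidatePass a.blocks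
  let bs ← dropEmpty r.1
  let cs ← readContents bs
  pure ({ a with blocks := bs, pivots := pivotsOf k cs }, r.2)

/-- Insert a block at its position by level. -/
def insertByLevel (b : Block K) : List (Block K) → List (Block K)
  | [] => [b]
  | c :: rest => if b.level ≤ c.level then c :: insertByLevel b rest else b :: c :: rest

/-- `BlockArray::insert`. -/
def BlockArray.insert (k : ℕ) (a : BlockArray K) (b : Block K) : Prog K T (BlockArray K) := do
  let r ← BlockArray.consolidate k { a with blocks := insertByLevel b a.blocks }
  pure r.1

/-! ### Searching a block array -/

/-- First loop of `BlockArray::find_min`: the number of items to choose from. -/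
def countLoop : List (Block K × ℕ) → Prog K T ℤ
  | [] => pure 0
  | (b, p) :: rest => do
      let f ← readFilled b
      let n ← countLoop rest
      pure ((f : ℤ) - (p : ℤ) + n)

/-- Second loop of `BlockArray::find_min`: find the block for `r`; take the selected item, or the
minimal item of the block if the selected one is logically deleted. -/
def selectLoop : List (Block K × ℕ) → ℤ → Prog K T (Option (Item K))
  | [], _ => pure none
  | (b, p) :: rest, r => do
      let f ← readFilled b
      if (f : ℤ) - (p : ℤ) ≤ r then selectLoop rest (r - ((f : ℤ) - (p : ℤ)))
      else if r ≠ (f : ℤ) - (p : ℤ) - 1 then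
        match b.items[p + r.toNat]? with
        | none => b.last
        | some it => do
            let deleted ← readFlag it
            if deleted then b.last else pure (some it)
      else b.last

/-- `BlockArray::find_min`.  As other threads may decrease `filled` of a block at any time, the
range of candidates may turn out to be empty; then no item is returned. -/
def BlockArray.findMin (a : BlockArray K) : Prog K T (Option (Item K)) := do
  let total ← countLoop (a.blocks.zip a.pivots)
  if 0 < total then do
    let r ← randInt (total - 1).toNat
    selectLoop (a.blocks.zip a.pivots) ((r : ℕ) : ℤ)
  else pure none

/-! ### The thread-local snapshot of the shared `k`-LSM -/

/-- `SharedKLSM::refresh_snapshot`. -/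
def refreshSnapshot : Prog K T Unit := do
  let s ← readShared
  setObserved s
  match s with
  | none => setSnapshot none
  | some a => do
      let c ← copyBlockArray a
      setSnapshot (some c)

/-- `SharedKLSM::push_snapshot`. -/
def pushSnapshot : Prog K T Bool := do
  let o ← getObserved
  let s ← getSnapshot
  casShared o s

/-! ### The distributed LSM; `t` is the thread that executes the code -/

/-- The blocks in `n` consecutive slots of thread `t`, starting with slot `i`. -/
def readSlots (t : Fin T) : ℕ → ℕ → Prog K T (List (Block K))
  | 0, _ => pure []
  | n + 1, i => do
      let s ← readSlot t i
      let tl ← readSlots t n (i + 1)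
      match s with
      | none => pure tl
      | some b => pure (b :: tl)

/-- Write blocks to consecutive slots, starting with slot `i`. -/
def writeSlots : List (Block K) → ℕ → Prog K T Unit
  | [], _ => pure ()
  | b :: rest, i => do
      writeSlot i b
      writeSlots rest (i + 1)

/-- `DistLSM::consolidate`.  The old blocks are overwritten in increasing order of the slots, and
the size is decreased last, so that all items stay accessible for other threads.  It returns the
new blocks. -/
def distConsolidate (t : Fin T) : Prog K T (List (Block K)) := do
  let n ← readSize t
  let old ← readSlots t n 0
  let r ← consolidatePass old
  let bs ← dropEmpty r.1
  writeSlots bs 0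
  writeSize bs.length
  pure bs

/-- The item with the smaller key; the first one if the keys agree. -/
def minItem : Option (Item K) → Option (Item K) → Option (Item K)
  | none, y => y
  | some x, none => some x
  | some x, some y => if y.key < x.key then some y else some x

/-- The minimum of the minimal items of the given blocks. -/
def minLoop : List (Block K) → Prog K T (Option (Item K))
  | [] => pure none
  | b :: rest => do
      let x ← b.last
      let y ← minLoop rest
      pure (minItem x y)

/-- `DistLSM::find_min`: clean up, then take the minimum of the minimal items of the blocks. -/
def distFindMin (t : Fin T) : Prog K T (Option (Item K)) := do
  let bs ← distConsolidate t
  minLoop bs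

/-- The loop of `DistLSM::insert`: merge the block with the blocks before slot `i` as long as their
levels are not larger. -/
def mergeBack (t : Fin T) : ℕ → Block K → Prog K T (ℕ × Block K)
  | 0, b => pure (0, b)
  | i + 1, b => do
      let s ← readSlot t i
      match s with
      | none => pure (i + 1, b)
      | some c =>
          if c.level ≤ b.level then do
            let d ← mergeBlocks (b.level + 1) c b
            let d' ← d.shrink
            mergeBack t i d'
          else pure (i + 1, b)

/-- Blocks of this level or higher do not stay in the distributed LSM.  Thus a distributed LSM, with
its strictly decreasing levels, has at most `distLevels k` blocks and, if `0 < k`, fewer than `k`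
items. -/
def distLevels (k : ℕ) : ℕ := Nat.log 2 k

/-- The body of the loop of `DistLSM::spy`: copy the block at slot `i` of thread `v`, if the levels
of the own blocks remain strictly decreasing.  A copy without any item is not kept. -/
def spySlot (t v : Fin T) (i : ℕ) : Prog K T Unit := do
  let s ← readSlot v i
  match s with
  | none => pure ()
  | some b => do
      let n ← readSize t
      let lastBlock ← readSlot t (n - 1)
      let fits : Bool :=
        match n, lastBlock with
        | 0, _ => true
        | _ + 1, none => false
        | _ + 1, some c => decide (b.level < c.level)
      if fits then do
        let c ← b.copy b.level
        if c.items = [] then pure ()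
        else do
          writeSlot n c
          writeSize (n + 1)
      else pure ()

/-- The loop of `DistLSM::spy`; the first argument is the remaining number of slots. -/
def spyLoop (t v : Fin T) : ℕ → ℕ → Prog K T Unit
  | 0, _ => pure ()
  | n + 1, i => do
      let s ← readSize v
      if i < s then do
        spySlot t v i
        spyLoop t v n (i + 1)
      else pure ()

/-- `DistLSM::spy`: was there anything to copy from the victim `v`? -/
def spy (k : ℕ) (t v : Fin T) : Prog K T Bool := do
  spyLoop t v (distLevels k) 0
  let n ← readSize t
  pure (decide (n ≠ 0))

/-! ### The operations `insert` and `delete_min` -/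

/-- The places in the code to which a thread can jump, with the values of the local variables.  For
`delete_min`, the variable `item` is the result of `DistLSM::find_min`. -/
inductive Loc (K : Type) : Type where
  /-- start of the inner loop of `delete_min`: call of `DistLSM::find_min` -/
  | distFind
  /-- start of the loop of `SharedKLSM::find_min` -/
  | sharedFind (item : Option (Item K))
  /-- call of `BlockArray::find_min` on the snapshot -/
  | snapFind (item : Option (Item K)) (snap : BlockArray K)
  /-- `SharedKLSM::find_min` after `BlockArray::find_min` has returned `cand` -/
  | snapCheck (item : Option (Item K)) (snap : BlockArray K) (cand : Option (Item K))
  /-- `delete_min` tries to mark the item -/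
  | mark (item : Item K)
  /-- `delete_min` has found no item, and spies -/
  | spying
  /-- start of `insert` -/
  | insertItem (key : K)
  /-- start of the loop of `SharedKLSM::insert`, called for `block`; afterwards the own distributed
  LSM is cut to size `i` -/
  | publish (block : Block K) (i : ℕ)
  /-- `insert` returns -/
  | inserted
  /-- `delete_min` returns an item or the null pointer -/
  | deleted (result : Option (Item K))

/-- What `delete_min` does next when `DistLSM::find_min` has returned `item` and
`SharedKLSM::find_min` has returned `tmp`. -/
def afterFind (item tmp : Option (Item K)) : Loc K :=
  match minItem item tmp with
  | none => .spying
  | some it => .mark it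

/-- The code at each place, for relaxation parameter `k` and executing thread `t`. -/
def code (k : ℕ) (t : Fin T) : Loc K → Prog K T (Loc K)
  | .distFind => do
      let item ← distFindMin t
      pure (.sharedFind item)
  | .sharedFind item => do
      let s ← readShared
      let o ← getObserved
      if s ≠ o then refreshSnapshot else pure ()
      let snap ← getSnapshot
      match snap with
      | none => pure (afterFind item none)
      | some a => pure (.snapFind item a)
  | .snapFind item a => do
      let cand ← a.findMin
      pure (.snapCheck item a cand)
  | .snapCheck item a cand => do
      let dead ← match cand with
        | none => pure true
        | some it => readFlag it
      if dead then do
        let r ← a.consolidate k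
        if r.1.blocks = [] then do
          setSnapshot none
          let _ ← pushSnapshot
          pure (.sharedFind item)
        else do
          setSnapshot (some r.1)
          if r.2 then do
            let _ ← pushSnapshot
            pure (.sharedFind item)
          else pure (.sharedFind item)
      else pure (afterFind item cand)
  | .mark it => do
      let dead ← readFlag it
      if dead then pure .distFind
      else do
        let success ← testAndSet it
        if success then pure (.deleted (some it)) else pure .distFind
  | .spying => do
      let v ← randThread
      let success ← spy k t v
      if success then pure .distFind else pure (.deleted none)
  | .insertItem key => do
      let it ← newItem key
      let b ← newBlock 0 [it]
      let n ← readSize t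
      let r ← mergeBack t n b
      if r.2.level < distLevels k then do
        writeSlot r.1 r.2
        writeSize (r.1 + 1)
        pure .inserted
      else pure (.publish r.2 r.1)
  | .publish b i => do
      refreshSnapshot
      let snap ← getSnapshot
      let a ← match snap with
        | none => newBlockArray
        | some a => pure a
      let a' ← a.insert k b
      setSnapshot (some a')
      let success ← pushSnapshot
      if success then do
        -- the snapshot has become visible to the other threads: take a new private one
        refreshSnapshot
        writeSize i
        pure .inserted
      else pure (.publish b i)
  | .inserted => pure .inserted
  | .deleted r => pure (.deleted r)

end Code

/-! ### Executions -/

/-- The external operations. -/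
inductive Call (K : Type) : Type where
  | insert (key : K)
  | deleteMin

/-- Where the code of an operation starts. -/
def Call.start {K : Type} : Call K → Loc K
  | .insert key => .insertItem key
  | .deleteMin => .distFind

/-- A thread is idle, or it executes the operation `call`: the last jump was to `loc`, and `rest` is
the remaining code up to the next jump. -/
inductive Status (K : Type) (T : ℕ) : Type where
  | idle
  | busy (call : Call K) (loc : Loc K) (rest : Prog K T (Loc K))

/-- A configuration of the system. -/
structure Config (K : Type) (T : ℕ) where
  mem : Mem K T
  status : Fin T → Status K T

/-- The initial configuration: the queue is empty and all threads are idle. -/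
def Config.init (K : Type) (T : ℕ) : Config K T := ⟨Mem.init K T, fun _ => .idle⟩

/-- What a thread does in one step. -/
inductive Event (K : Type) : Type where
  | invoke (call : Call K)
  | internal
  | respond (call : Call K) (result : Option (Item K))

/-- One step of thread `t`: an idle thread invokes any operation; a busy thread executes its next
atomic operation, jumps, or returns. -/
inductive Step {K : Type} [LinearOrder K] {T : ℕ} (k : ℕ) :
    Config K T → Fin T → Event K → Config K T → Prop where
  | invoke (c : Config K T) (t : Fin T) (call : Call K) (h : c.status t = .idle) :
      Step k c t (.invoke call)
        ⟨c.mem, Function.update c.status t (.busy call call.start (code k t call.start))⟩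
  | atomic (c : Config K T) (t : Fin T) (call : Call K) (l : Loc K) (o : Op K T)
      (next : o.Resp → Prog K T (Loc K)) (h : c.status t = .busy call l (.op o next))
      (r : o.Resp) (m : Mem K T) (hr : o.Exec t c.mem r m) :
      Step k c t .internal ⟨m, Function.update c.status t (.busy call l (next r))⟩
  | jump (c : Config K T) (t : Fin T) (call : Call K) (l l' : Loc K)
      (h : c.status t = .busy call l (.ret l')) (h₁ : l' ≠ .inserted)
      (h₂ : ∀ r, l' ≠ .deleted r) :
      Step k c t .internal ⟨c.mem, Function.update c.status t (.busy call l' (code k t l'))⟩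
  | inserted (c : Config K T) (t : Fin T) (call : Call K) (l : Loc K)
      (h : c.status t = .busy call l (.ret .inserted)) :
      Step k c t (.respond call none) ⟨c.mem, Function.update c.status t .idle⟩
  | deleted (c : Config K T) (t : Fin T) (call : Call K) (l : Loc K) (r : Option (Item K))
      (h : c.status t = .busy call l (.ret (.deleted r))) :
      Step k c t (.respond call r) ⟨c.mem, Function.update c.status t .idle⟩

/-- An infinite run: the configurations, and for each step the thread that takes it and its event.
The order in which the threads take steps is arbitrary; threads may stop forever. -/
structure Run (K : Type) [LinearOrder K] (k T : ℕ) where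
  conf : ℕ → Config K T
  thread : ℕ → Fin T
  event : ℕ → Event K
  step : ∀ n, Step k (conf n) (thread n) (event n) (conf (n + 1))

section Progress

variable {K : Type} [LinearOrder K] {k T : ℕ}

/-- The run starts with the empty queue. -/
def Run.FromInit (e : Run K k T) : Prop := e.conf 0 = Config.init K T

/-- Thread `t` is executing the operation `call`. -/
def Config.Executing (c : Config K T) (t : Fin T) (call : Call K) : Prop :=
  ∃ l p, c.status t = .busy call l p

/-- Thread `t` is executing code of a place satisfying `P`. -/
def Config.Inside (c : Config K T) (t : Fin T) (P : Loc K → Prop) : Prop :=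
  ∃ call l p, c.status t = .busy call l p ∧ P l

/-- Thread `t` takes infinitely many steps. -/
def Run.InfinitelyOften (e : Run K k T) (t : Fin T) : Prop :=
  ∀ n, ∃ m, n ≤ m ∧ e.thread m = t

/-- Some operation returns in step `n`. -/
def Run.RespondsAt (e : Run K k T) (n : ℕ) : Prop :=
  ∃ call r, e.event n = .respond call r

/-- Step `n` logically deletes the item `i`. -/
def Run.MarksAt (e : Run K k T) (n : ℕ) (i : Item K) : Prop :=
  (e.conf n).mem.flag i.addr = false ∧ (e.conf (n + 1)).mem.flag i.addr = true

/-- Step `n` replaces the array of the shared `k`-LSM. -/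
def Run.ReplacesAt (e : Run K k T) (n : ℕ) : Prop :=
  (e.conf (n + 1)).mem.shared ≠ (e.conf n).mem.shared

/-- The number of steps that thread `t` takes among the first `n` steps. -/
def Run.ownSteps (e : Run K k T) (t : Fin T) (n : ℕ) : ℕ :=
  ((Finset.range n).filter (fun i => e.thread i = t)).card

variable (K k T)

/-- The operation `call` is lock-free: whenever a thread that keeps taking steps is executing it,
some operation of some thread returns later on (hence, as long as the call has not returned,
infinitely many operations of other threads do). -/
def LockFree (call : Call K) : Prop :=
  ∀ e : Run K k T, e.FromInit → ∀ (t : Fin T) (n : ℕ),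
    (e.conf n).Executing t call → e.InfinitelyOften t → ∃ m, n ≤ m ∧ e.RespondsAt m

/-- The method whose code is at the places satisfying `P` is wait-free: whenever a thread executes
it, there is a number of own steps after which it has left it, whatever the other threads do. -/
def WaitFree (P : Loc K → Prop) : Prop :=
  ∀ e : Run K k T, e.FromInit → ∀ (t : Fin T) (n : ℕ), (e.conf n).Inside t P →
    ∃ B : ℕ, ∀ e' : Run K k T, e'.conf 0 = e.conf n →
      ∀ m, B ≤ e'.ownSteps t m → ∃ j, j ≤ m ∧ ¬ (e'.conf j).Inside t P

/-- Failures are caused only by other threads: if, from some time on, no other thread logically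
deletes an item or replaces the shared array, then a `delete_min` whose thread keeps taking steps
returns. -/
def FailuresOnlyByOthers : Prop :=
  ∀ e : Run K k T, e.FromInit → ∀ (t : Fin T) (n : ℕ),
    (e.conf n).Executing t .deleteMin → e.InfinitelyOften t →
    (∀ m, n ≤ m → e.thread m ≠ t → (∀ i, ¬ e.MarksAt m i) ∧ ¬ e.ReplacesAt m) →
    ∃ m r, n ≤ m ∧ e.thread m = t ∧ e.event m = .respond .deleteMin r

/-- A `delete_min` returns an item that it has itself logically deleted, or it returns nothing and
at some moment during the call its distributed LSM and the shared `k`-LSM were empty. -/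
def FindsActiveOrEmpty : Prop :=
  ∀ e : Run K k T, e.FromInit → ∀ (t : Fin T) (n : ℕ) (r : Option (Item K)),
    e.thread n = t → e.event n = .respond .deleteMin r →
    ∃ m, m < n ∧ (∀ j, m ≤ j → j ≤ n → (e.conf j).Executing t .deleteMin) ∧
      match r with
      | some i => e.thread m = t ∧ e.MarksAt m i
      | none => (e.conf m).mem.size t = 0 ∧ (e.conf m).mem.shared = none

end Progress

end KLSM

/-! Call a step decisive if it sets a deletion flag or replaces `shared`. During one operation a
thread performs at most one decisive step that does not replace `shared` by a smaller array: an
insertion stops after its successful compare-and-swap, a `delete_min` stops after its successful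
test-and-set, and the replacements made by `delete_min` remove at least one block because they
follow a merge or an emptied snapshot. So the lexicographic pair (number of threads that have not
yet made such a step, size of `shared`) drops with every decisive step until some operation returns,
and a run without returns has only finitely many of them (`XRun.decisive`,
`XRun.eventually_not_decisive`).

After the last decisive step the set `D` of deleted items and `shared` are constant. The obstacle is
that `filled` is not monotone: a thread may still write a value that it computed long ago. But every
thread that keeps running eventually starts a new piece of code, and from then on each of its writes
excludes the dead items at the end of the block (`XRun.eventually_threadInv`). A shrunk block then
stays shrunk, one cleanup makes the snapshot `Clean`, and the next search finds an active item.
Hence `delete_min` passes through places of strictly decreasing `Rank` and must return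
(`XRun.responds`). Counting the decisive steps of all threads gives lock-freedom; counting only
those of the caller, when the others make none, gives the claim on failures.

What is known between the steps comes from rely-guarantee reasoning: `wp` describes a program
interrupted by other threads, `exec_guar` shows that each atomic operation respects what the other
threads rely on, and `wp_code` treats every place of the code. An essential point is that an array
once removed from `shared` never returns, since only an array still owned by the swapping thread is
ever published; so there is no ABA problem.

The results of `delete_min` are read off ghost variables set at the decisive moment
(`XRun.witness`). For a null result, the moment is a read of `shared` that yields null while the own
distributed LSM is empty; a null snapshot forces such a read, and spying that ends with size zero
started with size zero.

Wait-freedom is a count of operations (`Bounded`): the length of both searches depends only on local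
values and on the own distributed LSM, which nobody else writes, and not on the values of `filled`
or of the flags. -/

set_option linter.unusedSectionVars false

/-! ### Ghost state, invariants, and the effect of atomic operations -/

namespace KLSM

/-! ### Ghost state -/

/-- Auxiliary state that records the history of a run: the block allocated at an address, the thread
that has allocated a not yet published block array, whether a thread has already performed the
decisive step of its operation, whether it has seen an empty queue, and the item it has marked. -/
structure Ghost (K : Type) (T : ℕ) where
  blk : ℕ → Option (Block K)
  own : ℕ → Option (Fin T)
  done : Fin T → Prop
  saw : Fin T → Prop
  won : Fin T → Option (Item K)

/-- The ghost state of the empty queue. -/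
def Ghost.init (K : Type) (T : ℕ) : Ghost K T where
  blk := fun _ => none
  own := fun _ => none
  done := fun _ => False
  saw := fun _ => False
  won := fun _ => none

/-- A memory with its ghost state. -/
structure St (K : Type) (T : ℕ) where
  m : Mem K T
  g : Ghost K T

/-- The size of the shared array; it decreases whenever `delete_min` replaces the array. -/
def arraySize {K : Type} : Option (BlockArray K) → ℕ
  | none => 0
  | some a => a.blocks.length + 1

/-- The effect of an atomic operation on the ghost state. -/
def Op.ghost {K : Type} [DecidableEq K] {T : ℕ} (t : Fin T) :
    (o : Op K T) → Mem K T → o.Resp → Ghost K T → Ghost K T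
  | .testAndSet i, m, _, g =>
      if m.flag i.addr = false then
        { g with
          done := Function.update g.done t True
          won := Function.update g.won t (some i) }
      else g
  | .newBlock _ _, m, r, g => { g with blk := Function.update g.blk m.next (some r) }
  | .newBlockArray, m, _, g => { g with own := Function.update g.own m.next (some t) }
  | .copyBlockArray _, m, _, g => { g with own := Function.update g.own m.next (some t) }
  -- A swap that shrinks the array is not charged to `done`: the decrease of the size pays for it in
  -- `XRun.potential`.
  | .casShared e n, m, _, g =>
      if m.shared = e then
        { g with
          own := match n with
            | none => g.own
            | some s => Function.update g.own s.addr none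
          done := Function.update g.done t (g.done t ∨ ¬ arraySize n < arraySize e) }
      else g
  -- The size of the own distributed LSM is inspected in the same state in which `shared` is read,
  -- which makes emptiness of both simultaneous.
  | .readShared, m, _, g =>
      { g with saw := Function.update g.saw t (g.saw t ∨ (m.shared = none ∧ m.size t = 0)) }
  | _, _, _, g => g

/-- Executing an atomic operation, including the ghost state. -/
def Op.XExec {K : Type} [DecidableEq K] {T : ℕ} (t : Fin T) (o : Op K T) (σ : St K T)
    (r : o.Resp) (σ' : St K T) : Prop :=
  o.Exec t σ.m r σ'.m ∧ σ'.g = o.ghost t σ.m r σ.g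

section Logic

variable {K : Type} [LinearOrder K] {T : ℕ}

/-- The block `b` has been allocated. -/
def Known (σ : St K T) (b : Block K) : Prop := σ.g.blk b.addr = some b

/-- The number of items that remain if the items at the end with an address in `D` are removed. -/
noncomputable def liveLen (D : Set ℕ) : List (Item K) → ℕ
  | [] => 0
  | x :: xs =>
      open Classical in
      if liveLen D xs = 0 then (if x.addr ∈ D then 0 else 1) else liveLen D xs + 1

/-- The invariant of the memory. -/
structure Good (σ : St K T) : Prop where
  flag_lt : ∀ a, σ.m.flag a = true → a < σ.m.next
  blk_lt : ∀ b, Known σ b → b.addr < σ.m.next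
  items_lt : ∀ b, Known σ b → ∀ i ∈ b.items, i.addr < σ.m.next
  filled_le : ∀ b, Known σ b → σ.m.filled b.addr ≤ b.items.length
  tail_dead : ∀ b, Known σ b → ∀ i ∈ b.items.drop (σ.m.filled b.addr), σ.m.flag i.addr = true
  own_lt : ∀ x, σ.g.own x ≠ none → x < σ.m.next
  shared_lt : ∀ a, σ.m.shared = some a → a.addr < σ.m.next
  shared_own : ∀ a, σ.m.shared = some a → σ.g.own a.addr = none
  shared_known : ∀ a, σ.m.shared = some a → ∀ b ∈ a.blocks, Known σ b
  slot_known : ∀ u i b, σ.m.slot u i = some b → Known σ b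

/-- What never gets lost, whatever a thread does. -/
structure Mono (σ σ' : St K T) : Prop where
  next_le : σ.m.next ≤ σ'.m.next
  flag : ∀ a, σ.m.flag a = true → σ'.m.flag a = true
  blk : ∀ b, Known σ b → Known σ' b
  own : ∀ x, x < σ.m.next → σ.g.own x = none → σ'.g.own x = none
  -- Excludes ABA: an array without an owner that is not in `shared` can never come back, so a swap
  -- against an outdated `observed` fails forever.
  shared : ∀ o : BlockArray K, o.addr < σ.m.next → σ.g.own o.addr = none →
    σ.m.shared ≠ some o → σ'.m.shared ≠ some o

/-- What a thread `t` alone can change, except for its distributed LSM. -/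
structure Keep (t : Fin T) (σ σ' : St K T) : Prop where
  observed : σ'.m.observed t = σ.m.observed t
  snapshot : σ'.m.snapshot t = σ.m.snapshot t
  done : σ'.g.done t = σ.g.done t
  saw : σ'.g.saw t = σ.g.saw t
  won : σ'.g.won t = σ.g.won t
  own : ∀ x, σ.g.own x = some t ↔ σ'.g.own x = some t

/-- The distributed LSM of `t` is unchanged. -/
structure KeepDist (t : Fin T) (σ σ' : St K T) : Prop where
  size : σ'.m.size t = σ.m.size t
  slot : σ'.m.slot t = σ.m.slot t

/-- The value of `filled` is changed at most to a value that excludes the dead items at the end. -/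
def Tight (D : Set ℕ) (σ : St K T) (b : Block K) : Prop :=
  σ.m.filled b.addr ≤ liveLen D b.items

/-- What a thread `u` guarantees when it executes an atomic operation. -/
structure Guar (D : Set ℕ) (u : Fin T) (σ σ' : St K T) : Prop where
  mono : Mono σ σ'
  filled : ∀ b, Known σ b → σ'.m.filled b.addr = σ.m.filled b.addr ∨ Tight D σ' b
  keep : ∀ t, t ≠ u → Keep t σ σ'
  dist : ∀ t, t ≠ u → KeepDist t σ σ'

/-- `D` is a set of addresses of logically deleted items.  If `st` holds, then there are no others,
nothing is logically deleted any more, and the shared array is not replaced any more. -/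
structure Mode where
  D : Set ℕ
  st : Prop

/-- Without `P.st`, the set `P.D` is only a lower bound for the deleted items; with it, the two
agree. -/
structure Inv (P : Mode) (σ : St K T) : Prop where
  good : Good σ
  dead : ∀ a ∈ P.D, σ.m.flag a = true
  only : P.st → ∀ a, σ.m.flag a = true → a ∈ P.D

/-- What every step respects, including the steps of the thread under consideration. Tightness is
promised only in the stable regime, because before that another thread may write a value of `filled`
computed when fewer items were dead. -/
structure Le (P : Mode) (σ σ' : St K T) : Prop where
  inv : Inv P σ'
  mono : Mono σ σ'
  shared : P.st → σ'.m.shared = σ.m.shared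
  tight : P.st → ∀ b, Known σ b → Tight P.D σ b → Tight P.D σ' b

/-- The interference of the other threads as seen by `t`: they touch neither its local pointers and
ghost variables nor its slots and size. -/
structure Rely (P : Mode) (t : Fin T) (σ σ' : St K T) : Prop where
  le : Le P σ σ'
  keep : Keep t σ σ'
  dist : KeepDist t σ σ'

/-! ### Basic properties of the relations -/

theorem Mono.refl (σ : St K T) : Mono σ σ :=
  ⟨le_rfl, fun _ h => h, fun _ h => h, fun _ _ h => h, fun _ _ _ h => h⟩

theorem Mono.trans {σ σ' σ'' : St K T} (h : Mono σ σ') (h' : Mono σ' σ'') : Mono σ σ'' where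
  next_le := h.next_le.trans h'.next_le
  flag := fun a ha => h'.flag a (h.flag a ha)
  blk := fun b hb => h'.blk b (h.blk b hb)
  own := fun x hx ho => h'.own x (hx.trans_le h.next_le) (h.own x hx ho)
  shared := fun o hx ho hs =>
    h'.shared o (hx.trans_le h.next_le) (h.own _ hx ho) (h.shared o hx ho hs)

theorem Keep.refl (t : Fin T) (σ : St K T) : Keep t σ σ :=
  ⟨rfl, rfl, rfl, rfl, rfl, fun _ => Iff.rfl⟩

theorem Keep.trans {t : Fin T} {σ σ' σ'' : St K T} (h : Keep t σ σ') (h' : Keep t σ' σ'') :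
    Keep t σ σ'' :=
  ⟨h'.observed.trans h.observed, h'.snapshot.trans h.snapshot, h'.done.trans h.done,
    h'.saw.trans h.saw, h'.won.trans h.won, fun x => (h.own x).trans (h'.own x)⟩

theorem KeepDist.refl (t : Fin T) (σ : St K T) : KeepDist t σ σ := ⟨rfl, rfl⟩

theorem KeepDist.trans {t : Fin T} {σ σ' σ'' : St K T} (h : KeepDist t σ σ')
    (h' : KeepDist t σ' σ'') : KeepDist t σ σ'' :=
  ⟨h'.size.trans h.size, h'.slot.trans h.slot⟩

theorem Le.refl {P : Mode} {σ : St K T} (h : Inv P σ) : Le P σ σ :=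
  ⟨h, Mono.refl σ, fun _ => rfl, fun _ _ _ h => h⟩

theorem Le.trans {P : Mode} {σ σ' σ'' : St K T} (h : Le P σ σ') (h' : Le P σ' σ'') :
    Le P σ σ'' where
  inv := h'.inv
  mono := h.mono.trans h'.mono
  shared := fun hs => (h'.shared hs).trans (h.shared hs)
  tight := fun hs b hb ht => h'.tight hs b (h.mono.blk b hb) (h.tight hs b hb ht)

theorem Rely.refl {P : Mode} {σ : St K T} (t : Fin T) (h : Inv P σ) : Rely P t σ σ :=
  ⟨Le.refl h, Keep.refl t σ, KeepDist.refl t σ⟩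

theorem Rely.trans {P : Mode} {t : Fin T} {σ σ' σ'' : St K T} (h : Rely P t σ σ')
    (h' : Rely P t σ' σ'') : Rely P t σ σ'' :=
  ⟨h.le.trans h'.le, h.keep.trans h'.keep, h.dist.trans h'.dist⟩

/-! ### Atomic operations preserve the invariant -/

/-- The precondition of an atomic operation. -/
def Op.Pre (D : Set ℕ) (t : Fin T) : Op K T → St K T → Prop
  | .testAndSet i, σ => i.addr < σ.m.next ∧ ¬ σ.g.done t
  | .newBlock _ its, σ => ∀ i ∈ its, i.addr < σ.m.next
  | .writeFilled b n, σ => Known σ b ∧ n ≤ b.items.length ∧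
      (∀ i ∈ b.items.drop n, σ.m.flag i.addr = true) ∧ n ≤ liveLen D b.items
  | .casShared e n, σ => ¬ σ.g.done t ∧ (σ.m.shared = e → ∀ s, n = some s →
      σ.g.own s.addr = some t ∧ ∀ b ∈ s.blocks, Known σ b)
  | .writeSlot _ b, σ => Known σ b
  | _, _ => True

theorem good_of_eq {σ σ' : St K T} (h : Good σ) (hn : σ'.m.next = σ.m.next)
    (hf : σ'.m.flag = σ.m.flag) (hfi : σ'.m.filled = σ.m.filled) (hs : σ'.m.shared = σ.m.shared)
    (hsl : ∀ u i b, σ'.m.slot u i = some b → Known σ b) (hb : σ'.g.blk = σ.g.blk)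
    (ho : σ'.g.own = σ.g.own) : Good σ' := by
  have hk : ∀ b, Known σ' b ↔ Known σ b := fun b => by simp [Known, hb]
  constructor
  · simpa [hn, hf] using h.flag_lt
  · simpa [hn, hk] using h.blk_lt
  · simpa [hn, hk] using h.items_lt
  · simpa [hfi, hk] using h.filled_le
  · simpa [hfi, hf, hk] using h.tail_dead
  · simpa [hn, ho] using h.own_lt
  · simpa [hn, hs] using h.shared_lt
  · simpa [ho, hs] using h.shared_own
  · simpa [hk, hs] using h.shared_known
  · simpa [hk] using hsl

theorem guar_of_eq {D : Set ℕ} {u : Fin T} {σ σ' : St K T} (hn : σ'.m.next = σ.m.next)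
    (hf : σ'.m.flag = σ.m.flag) (hfi : σ'.m.filled = σ.m.filled) (hs : σ'.m.shared = σ.m.shared)
    (hb : σ'.g.blk = σ.g.blk) (ho : σ'.g.own = σ.g.own)
    (hobs : ∀ t, t ≠ u → σ'.m.observed t = σ.m.observed t)
    (hsnap : ∀ t, t ≠ u → σ'.m.snapshot t = σ.m.snapshot t)
    (hdone : ∀ t, t ≠ u → σ'.g.done t = σ.g.done t)
    (hsaw : ∀ t, t ≠ u → σ'.g.saw t = σ.g.saw t)
    (hwon : ∀ t, t ≠ u → σ'.g.won t = σ.g.won t)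
    (hsize : ∀ t, t ≠ u → σ'.m.size t = σ.m.size t)
    (hslot : ∀ t, t ≠ u → σ'.m.slot t = σ.m.slot t) : Guar D u σ σ' := by
  refine ⟨⟨hn.ge, by simp [hf], by simp [Known, hb], by simp [ho], by simp [hs]⟩,
    fun b _ => Or.inl (by rw [hfi]), fun t ht => ⟨hobs t ht, hsnap t ht, hdone t ht, hsaw t ht,
      hwon t ht, by simp [ho]⟩, fun t ht => ⟨hsize t ht, hslot t ht⟩⟩

theorem good_alloc {σ σ' : St K T} {t : Fin T} (h : Good σ) (hn : σ'.m.next = σ.m.next + 1)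
    (hf : σ'.m.flag = σ.m.flag ∨ σ'.m.flag = Function.update σ.m.flag σ.m.next false)
    (hfi : σ'.m.filled = σ.m.filled) (hs : σ'.m.shared = σ.m.shared)
    (hsl : σ'.m.slot = σ.m.slot) (hb : σ'.g.blk = σ.g.blk)
    (ho : σ'.g.own = σ.g.own ∨ σ'.g.own = Function.update σ.g.own σ.m.next (some t)) :
    Good σ' := by
  have hk : ∀ b, Known σ' b ↔ Known σ b := fun b => by simp [Known, hb]
  -- No flag is set at an unallocated address, so clearing the flag of the fresh item changes
  -- nothing.
  have hf' : ∀ a, σ'.m.flag a = true ↔ σ.m.flag a = true := by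
    intro a
    rcases hf with hf | hf
    · rw [hf]
    · rw [hf]
      by_cases ha : a = σ.m.next
      · subst ha
        have := fun hh => (h.flag_lt _ hh).false
        simpa using this
      · simp [ha]
  have ho' : ∀ x, x < σ.m.next → σ'.g.own x = σ.g.own x := by
    intro x hx
    rcases ho with ho | ho <;> simp [ho, hx.ne]
  have ho'' : ∀ x, σ.m.next < x → σ'.g.own x = σ.g.own x := by
    intro x hx
    rcases ho with ho | ho <;> simp [ho, hx.ne']
  constructor
  · intro a ha
    have := h.flag_lt a ((hf' a).1 ha)
    omega
  · intro b hb
    have := h.blk_lt b ((hk b).1 hb)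
    omega
  · intro b hb i hi
    have := h.items_lt b ((hk b).1 hb) i hi
    omega
  · simpa [hfi, hk] using h.filled_le
  · simpa [hfi, hf', hk] using h.tail_dead
  · intro x hx
    by_contra hlt
    have h1 : σ.m.next < x := by omega
    rw [ho'' x h1] at hx
    have := h.own_lt x hx
    omega
  · intro a ha
    have := h.shared_lt a (hs ▸ ha)
    omega
  · intro a ha
    rw [hs] at ha
    rw [ho' _ (h.shared_lt a ha)]
    exact h.shared_own a ha
  · simpa [hk, hs] using h.shared_known
  · simpa [hk, hsl] using h.slot_known

theorem guar_alloc {D : Set ℕ} {t : Fin T} {σ σ' : St K T} (h : Good σ)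
    (hn : σ'.m.next = σ.m.next + 1)
    (hf : σ'.m.flag = σ.m.flag ∨ σ'.m.flag = Function.update σ.m.flag σ.m.next false)
    (hfi : σ'.m.filled = σ.m.filled) (hs : σ'.m.shared = σ.m.shared)
    (hb : σ'.g.blk = σ.g.blk)
    (ho : σ'.g.own = σ.g.own ∨ σ'.g.own = Function.update σ.g.own σ.m.next (some t))
    (hobs : σ'.m.observed = σ.m.observed) (hsnap : σ'.m.snapshot = σ.m.snapshot)
    (hdone : σ'.g.done = σ.g.done) (hsaw : σ'.g.saw = σ.g.saw) (hwon : σ'.g.won = σ.g.won)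
    (hsize : σ'.m.size = σ.m.size) (hslot : σ'.m.slot = σ.m.slot) : Guar D t σ σ' := by
  have hf' : ∀ a, σ.m.flag a = true → σ'.m.flag a = true := by
    intro a ha
    have := (h.flag_lt a ha).ne
    rcases hf with hf | hf <;> simp [hf, ha, this]
  refine ⟨⟨by omega, hf', by simp [Known, hb], ?_, by simp [hs]⟩, fun b _ => Or.inl (by rw [hfi]),
    fun u hu => ⟨by rw [hobs], by rw [hsnap], by rw [hdone], by rw [hsaw], by rw [hwon], ?_⟩,
    fun u hu => ⟨by rw [hsize], by rw [hslot]⟩⟩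
  · intro x hx hxn
    rcases ho with ho | ho <;> simp [ho, hx.ne, hxn]
  · intro x
    rcases ho with ho | ho
    · rw [ho]
    · rw [ho]
      by_cases hx : x = σ.m.next
      · subst hx
        have : σ.g.own σ.m.next = none := by
          by_contra hne
          exact (h.own_lt _ hne).false
        simp [this, hu.symm]
      · simp [hx]

/-- Soundness of the ghost discipline. Flags are only raised, new objects get unused addresses, a
written `filled` cuts off only deleted items, and the swap publishes an array owned by `t`, giving
up the ownership. -/
theorem exec_guar {D : Set ℕ} {t : Fin T} {o : Op K T} {σ σ' : St K T} {r : o.Resp}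
    (hg : Good σ) (hp : o.Pre D t σ) (he : o.XExec t σ r σ') : Good σ' ∧ Guar D t σ σ' := by
  obtain ⟨m, g⟩ := σ
  obtain ⟨m', g'⟩ := σ'
  obtain ⟨he, hgh⟩ := he
  replace hgh := hgh.symm
  dsimp only at he hgh
  cases o
  case testAndSet i =>
    obtain ⟨-, rfl⟩ := he
    obtain ⟨hi, -⟩ := hp
    simp only [Op.ghost] at hgh
    have hb : g'.blk = g.blk := by rw [← hgh]; split_ifs <;> rfl
    have ho : g'.own = g.own := by rw [← hgh]; split_ifs <;> rfl
    have hsaw : g'.saw = g.saw := by rw [← hgh]; split_ifs <;> rfl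
    have hfl : ∀ a, m.flag a = true → Function.update m.flag i.addr true a = true := by
      intro a ha
      by_cases h : a = i.addr <;> simp [h, ha]
    refine ⟨⟨?_, ?_, ?_, ?_, ?_, ?_, ?_, ?_, ?_, ?_⟩, ⟨⟨le_rfl, hfl, ?_, ?_, ?_⟩, ?_, ?_, ?_⟩⟩
    · intro a ha
      by_cases h : a = i.addr
      · subst h; exact hi
      · simp [h] at ha
        exact hg.flag_lt a ha
    · simpa [Known, hb] using hg.blk_lt
    · simpa [Known, hb] using hg.items_lt
    · simpa [Known, hb] using hg.filled_le
    · intro b hkb j hj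
      exact hfl _ (hg.tail_dead b (by simpa [Known, hb] using hkb) j hj)
    · simpa [ho] using hg.own_lt
    · exact hg.shared_lt
    · simpa [ho] using hg.shared_own
    · simpa [Known, hb] using hg.shared_known
    · simpa [Known, hb] using hg.slot_known
    · simp [Known, hb]
    · simp [ho]
    · simp
    · simp
    · intro u hu
      refine ⟨rfl, rfl, ?_, by simp [hsaw], ?_, by simp [ho]⟩ <;>
      · simp only [← hgh]
        split_ifs <;> simp [hu]
    · exact fun u hu => ⟨rfl, rfl⟩
  case newBlock l its =>
    obtain ⟨rfl, rfl⟩ := he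
    subst hgh
    have hold : ∀ b : Block K, g.blk b.addr = some b → b.addr ≠ m.next :=
      fun b hb => (hg.blk_lt b hb).ne
    have hk : ∀ b : Block K, Function.update g.blk m.next (some ⟨m.next, l, its⟩) b.addr = some b →
        b = ⟨m.next, l, its⟩ ∨ b.addr ≠ m.next ∧ g.blk b.addr = some b := by
      intro b hb
      by_cases h : b.addr = m.next
      · rw [h] at hb; simp at hb; exact Or.inl hb.symm
      · simp [h] at hb; exact Or.inr ⟨h, hb⟩
    have hk' : ∀ b : Block K, g.blk b.addr = some b →
        Function.update g.blk m.next (some ⟨m.next, l, its⟩) b.addr = some b := by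
      intro b hb
      simp [hold b hb, hb]
    refine ⟨⟨?_, ?_, ?_, ?_, ?_, ?_, ?_, ?_, ?_, ?_⟩, ⟨⟨Nat.le_succ _, ?_, hk', ?_, ?_⟩, ?_, ?_, ?_⟩⟩
    · exact fun a ha => Nat.lt_succ_of_lt (hg.flag_lt a ha)
    · intro b hb
      rcases hk b hb with rfl | ⟨-, h⟩
      · exact Nat.lt_succ_self _
      · exact Nat.lt_succ_of_lt (hg.blk_lt b h)
    · intro b hb i hi
      rcases hk b hb with rfl | ⟨-, h⟩
      · exact Nat.lt_succ_of_lt (hp i hi)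
      · exact Nat.lt_succ_of_lt (hg.items_lt b h i hi)
    · intro b hb
      rcases hk b hb with rfl | ⟨hne, h⟩
      · simp
      · simpa [hne] using hg.filled_le b h
    · intro b hb
      rcases hk b hb with rfl | ⟨hne, h⟩
      · simp
      · simpa [hne] using hg.tail_dead b h
    · exact fun x hx => Nat.lt_succ_of_lt (hg.own_lt x hx)
    · exact fun x hx => Nat.lt_succ_of_lt (hg.shared_lt x hx)
    · exact hg.shared_own
    · exact fun a ha b hb => hk' b (hg.shared_known a ha b hb)
    · exact fun u i b hb => hk' b (hg.slot_known u i b hb)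
    · simp
    · exact fun x _ hx => hx
    · simp
    · intro b hb
      left
      simp [hold b hb]
    · exact fun u hu => ⟨rfl, rfl, rfl, rfl, rfl, fun _ => Iff.rfl⟩
    · exact fun u hu => ⟨rfl, rfl⟩
  case writeFilled b n =>
    obtain rfl := he
    dsimp only [Op.ghost] at hgh
    subst hgh
    obtain ⟨hb, hn, hd, hl⟩ := hp
    have hk : ∀ c : Block K, g.blk c.addr = some c → c = b ∨ c.addr ≠ b.addr := by
      intro c hc
      by_cases h : c.addr = b.addr
      · left
        rw [h, show g.blk b.addr = some b from hb] at hc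
        simpa using hc.symm
      · exact Or.inr h
    refine ⟨⟨?_, ?_, ?_, ?_, ?_, ?_, ?_, ?_, ?_, ?_⟩, ⟨⟨le_rfl, ?_, ?_, ?_, ?_⟩, ?_, ?_, ?_⟩⟩
    · exact hg.flag_lt
    · exact hg.blk_lt
    · exact hg.items_lt
    · intro c hc
      rcases hk c hc with rfl | hne
      · simpa using hn
      · simpa [hne] using hg.filled_le c hc
    · intro c hc
      rcases hk c hc with rfl | hne
      · simpa using hd
      · simpa [hne] using hg.tail_dead c hc
    · exact hg.own_lt
    · exact hg.shared_lt
    · exact hg.shared_own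
    · exact hg.shared_known
    · exact hg.slot_known
    · simp
    · exact fun _ h => h
    · exact fun _ _ h => h
    · simp
    · intro c hc
      rcases hk c hc with rfl | hne
      · right
        simpa [Tight] using hl
      · left
        simp [hne]
    · exact fun u hu => ⟨rfl, rfl, rfl, rfl, rfl, fun _ => Iff.rfl⟩
    · exact fun u hu => ⟨rfl, rfl⟩
  case casShared e n =>
    obtain ⟨-, rfl⟩ := he
    dsimp only [Op.ghost] at hgh
    subst hgh
    by_cases hc : m.shared = e
    · simp only [hc, if_true]
      have hs := hp.2 hc
      cases n with
      | none =>
        refine ⟨⟨hg.flag_lt, hg.blk_lt, hg.items_lt, hg.filled_le, hg.tail_dead, hg.own_lt, by simp,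
          by simp, by simp, hg.slot_known⟩, ⟨⟨le_rfl, fun _ h => h, fun _ h => h, fun _ _ h => h,
          by simp⟩, by simp, fun u hu => ⟨rfl, rfl, by simp [hu], rfl, rfl, fun _ => Iff.rfl⟩,
          fun u hu => ⟨rfl, rfl⟩⟩⟩
      | some s =>
        obtain ⟨ho, hb⟩ := hs s rfl
        have hlt : s.addr < m.next := hg.own_lt s.addr (by simp [show g.own s.addr = some t from ho])
        have hown : ∀ x, g.own x = none → Function.update g.own s.addr none x = none := by
          intro x hx
          by_cases h : x = s.addr <;> simp [h, hx]
        refine ⟨⟨hg.flag_lt, hg.blk_lt, hg.items_lt, hg.filled_le, hg.tail_dead, ?_, ?_,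
          ?_, ?_, hg.slot_known⟩, ⟨⟨le_rfl, fun _ h => h, fun _ h => h, fun x _ h => hown x h,
          ?_⟩, by simp, fun u hu => ⟨rfl, rfl, by simp [hu], rfl, rfl, ?_⟩,
          fun u hu => ⟨rfl, rfl⟩⟩⟩
        · intro x hx
          refine hg.own_lt x fun h => hx (hown x h)
        · intro a ha
          obtain rfl : s = a := by simpa using ha
          exact hlt
        · intro a ha
          obtain rfl : s = a := by simpa using ha
          simp
        · intro a ha
          obtain rfl : s = a := by simpa using ha
          exact hb
        -- The array now in `shared` was owned by `t` just before, hence it is not one of the arrays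
        -- without an owner.
        · intro o _ ho' _ h
          obtain rfl : s = o := by simpa using h
          simp only at ho ho'
          rw [ho] at ho'
          cases ho'
        · intro x
          by_cases h : x = s.addr
          · subst h
            simp only at ho
            simp [ho, hu.symm]
          · simp [h]
    · simp only [hc, if_false]
      exact ⟨hg, ⟨Mono.refl _, by simp, fun u _ => Keep.refl u _, fun u _ => KeepDist.refl u _⟩⟩
  case writeSlot i b =>
    obtain rfl := he
    dsimp only [Op.ghost] at hgh
    subst hgh
    refine ⟨good_of_eq hg rfl rfl rfl rfl ?_ rfl rfl,
      guar_of_eq rfl rfl rfl rfl rfl rfl ?_ ?_ ?_ ?_ ?_ ?_ ?_⟩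
    · intro u j c hc
      simp only [Function.update_apply] at hc
      by_cases hu : u = t
      · subst hu
        simp only [if_true] at hc
        by_cases hj : j = i
        · subst hj
          simp at hc
          subst hc
          exact hp
        · simp [hj] at hc
          exact hg.slot_known u j c hc
      · simp [hu] at hc
        exact hg.slot_known u j c hc
    all_goals intro u hu; simp [hu]
  case readFlag | readFilled | readShared | getObserved | getSnapshot | readSize | readSlot =>
    obtain ⟨-, rfl⟩ := he
    dsimp only [Op.ghost] at hgh
    subst hgh
    refine ⟨good_of_eq hg rfl rfl rfl rfl hg.slot_known rfl rfl,
      guar_of_eq rfl rfl rfl rfl rfl rfl ?_ ?_ ?_ ?_ ?_ ?_ ?_⟩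
    all_goals intro u hu; simp [hu]
  case setObserved | setSnapshot | writeSize | randInt | randThread =>
    obtain rfl := he
    dsimp only [Op.ghost] at hgh
    subst hgh
    refine ⟨good_of_eq hg rfl rfl rfl rfl hg.slot_known rfl rfl,
      guar_of_eq rfl rfl rfl rfl rfl rfl ?_ ?_ ?_ ?_ ?_ ?_ ?_⟩
    all_goals intro u hu; simp [hu]
  case newItem =>
    obtain ⟨-, rfl⟩ := he
    dsimp only [Op.ghost] at hgh
    subst hgh
    exact ⟨good_alloc (t := t) hg rfl (Or.inr rfl) rfl rfl rfl rfl (Or.inl rfl),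
      guar_alloc hg rfl (Or.inr rfl) rfl rfl rfl (Or.inl rfl) rfl rfl rfl rfl rfl rfl rfl⟩
  case newBlockArray | copyBlockArray =>
    obtain ⟨-, rfl⟩ := he
    dsimp only [Op.ghost] at hgh
    subst hgh
    exact ⟨good_alloc (t := t) hg rfl (Or.inl rfl) rfl rfl rfl rfl (Or.inr rfl),
      guar_alloc hg rfl (Or.inl rfl) rfl rfl rfl (Or.inr rfl) rfl rfl rfl rfl rfl rfl rfl⟩

end Logic

end KLSM

/-! ### Rely-guarantee calculus; blocks and consolidation -/

namespace KLSM

section Logic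

variable {K : Type} [LinearOrder K] {T : ℕ}

/-! ### Rely-guarantee reasoning -/

/-- If thread `t` executes `p`, starting in the state `σ` and interrupted by steps of other threads,
then all preconditions of its atomic operations hold, and its result satisfies `Q`. -/
def wp (P : Mode) (t : Fin T) {α : Type} : Prog K T α → (α → St K T → Prop) → St K T → Prop
  | .ret a, Q, σ => ∀ σ', Rely P t σ σ' → Q a σ'
  | .op o next, Q, σ => ∀ σ', Rely P t σ σ' → o.Pre P.D t σ' ∧
      ∀ r σ'', o.XExec t σ' r σ'' → Inv P σ'' → (P.st → σ''.m.shared = σ'.m.shared) →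
        wp P t (next r) Q σ''

variable {P : Mode} {t : Fin T} {α β : Type} {σ : St K T}

/-- Interference is built into both clauses of `wp`, and it is transitive; so assertions of this
form are stable automatically. -/
theorem wp_of_rely {p : Prog K T α} {Q : α → St K T → Prop} {σ' : St K T}
    (h : wp P t p Q σ) (hR : Rely P t σ σ') : wp P t p Q σ' := by
  cases p with
  | ret a => exact fun σ'' h' => h σ'' (hR.trans h')
  | op o next => exact fun σ'' h' => h σ'' (hR.trans h')

theorem wp_stable {p : Prog K T α} {Q : α → St K T → Prop}
    (h : ∀ σ', Rely P t σ σ' → wp P t p Q σ') : wp P t p Q σ := by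
  cases p with
  | ret a => exact fun σ' h' => h σ' h' σ' (Rely.refl t h'.le.inv)
  | op o next => exact fun σ' h' => h σ' h' σ' (Rely.refl t h'.le.inv)

theorem wp_bind {p : Prog K T α} {f : α → Prog K T β} {Q : β → St K T → Prop}
    (h : wp P t p (fun a σ' => wp P t (f a) Q σ') σ) : wp P t (p >>= f) Q σ := by
  change wp P t (p.bind f) Q σ
  induction p generalizing σ with
  | ret a => exact wp_stable h
  | op o next ih =>
    intro σ' hR
    obtain ⟨h1, h2⟩ := h σ' hR
    exact ⟨h1, fun r σ'' he hi hs => ih r (h2 r σ'' he hi hs)⟩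

theorem wp_pure {a : α} {Q : α → St K T → Prop} (h : ∀ σ', Rely P t σ σ' → Q a σ') :
    wp P t (pure a) Q σ := h

/-- An atomic operation, with `f` as the rest of the program. -/
theorem wp_run {o : Op K T} {f : o.Resp → Prog K T β} {Q : β → St K T → Prop}
    (hp : ∀ σ', Rely P t σ σ' → o.Pre P.D t σ')
    (h : ∀ σ' r σ'', Rely P t σ σ' → o.XExec t σ' r σ'' → Le P σ' σ'' → wp P t (f r) Q σ'') :
    wp P t (o.run >>= f) Q σ := by
  intro σ' hR
  refine ⟨hp σ' hR, fun r σ'' he hi hs => h σ' r σ'' hR he ?_⟩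
  obtain ⟨-, hG⟩ := exec_guar hR.le.inv.good (hp σ' hR) he
  refine ⟨hi, hG.mono, hs, fun _ b hb ht => ?_⟩
  rcases hG.filled b hb with h | h
  · simpa [Tight, h] using ht
  · exact h

/-- Gives a final atomic operation a trivial continuation, so that the rules below apply to it. -/
theorem bind_pure' (p : Prog K T α) : p >>= pure = p := by
  change p.bind Prog.ret = p
  induction p with
  | ret a => rfl
  | op o next ih => simp [Prog.bind, ih]

theorem Rely.known {σ' : St K T} (h : Rely P t σ σ') {b : Block K} (hb : Known σ b) :
    Known σ' b := h.le.mono.blk b hb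

theorem Rely.known_all {σ' : St K T} (h : Rely P t σ σ') {bs : List (Block K)}
    (hb : ∀ b ∈ bs, Known σ b) : ∀ b ∈ bs, Known σ' b := fun b hm => h.known (hb b hm)

theorem Rely.lt {σ' : St K T} (h : Rely P t σ σ') {n : ℕ} (hb : n < σ.m.next) :
    n < σ'.m.next := hb.trans_le h.le.mono.next_le

theorem Rely.flag {σ' : St K T} (h : Rely P t σ σ') {a : ℕ} (hb : σ.m.flag a = true) :
    σ'.m.flag a = true := h.le.mono.flag a hb

theorem Rely.inv {σ' : St K T} (h : Rely P t σ σ') : Inv P σ' := h.le.inv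

theorem rely_of_eq {σ' : St K T} (h : Le P σ σ') (hm : σ'.m.observed t = σ.m.observed t)
    (hsn : σ'.m.snapshot t = σ.m.snapshot t) (hsi : σ'.m.size t = σ.m.size t)
    (hsl : σ'.m.slot t = σ.m.slot t) (hd : σ'.g.done t = σ.g.done t)
    (hs : σ'.g.saw t = σ.g.saw t) (hw : σ'.g.won t = σ.g.won t)
    (ho : σ'.g.own = σ.g.own) : Rely P t σ σ' :=
  ⟨h, ⟨hm, hsn, hd, hs, hw, by simp [ho]⟩, ⟨hsi, hsl⟩⟩

/-! ### Rules for the atomic operations -/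

theorem Op.XExec.eq_of_read {σ σ' : St K T} (hm : σ'.m = σ.m) (hg : σ'.g = σ.g) : σ' = σ := by
  cases σ; cases σ'; simp_all

theorem wp_readFilled {b : Block K} {f : ℕ → Prog K T β} {Q : β → St K T → Prop}
    (h : ∀ σ', Rely P t σ σ' → wp P t (f (σ'.m.filled b.addr)) Q σ') :
    wp P t (readFilled b >>= f) Q σ := by
  refine wp_run (o := .readFilled b) (fun _ _ => trivial) fun σ' r σ'' hR he _ => ?_
  obtain ⟨⟨rfl, hm⟩, hg⟩ := he
  obtain rfl := Op.XExec.eq_of_read hm hg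
  exact h _ hR

theorem wp_readFlag {i : Item K} {f : Bool → Prog K T β} {Q : β → St K T → Prop}
    (h : ∀ σ', Rely P t σ σ' → wp P t (f (σ'.m.flag i.addr)) Q σ') :
    wp P t (readFlag i >>= f) Q σ := by
  refine wp_run (o := .readFlag i) (fun _ _ => trivial) fun σ' r σ'' hR he _ => ?_
  obtain ⟨⟨rfl, hm⟩, hg⟩ := he
  obtain rfl := Op.XExec.eq_of_read hm hg
  exact h _ hR

/-- For a thread-local pointer the value read is the one in the initial state `σ`; for shared data
it is only the one at the moment of reading. -/
theorem wp_getObserved {f : Option (BlockArray K) → Prog K T β} {Q : β → St K T → Prop}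
    (h : ∀ σ', Rely P t σ σ' → wp P t (f (σ.m.observed t)) Q σ') :
    wp P t (getObserved >>= f) Q σ := by
  refine wp_run (o := .getObserved) (fun _ _ => trivial) fun σ' r σ'' hR he _ => ?_
  obtain ⟨⟨rfl, hm⟩, hg⟩ := he
  obtain rfl := Op.XExec.eq_of_read hm hg
  rw [hR.keep.observed]
  exact h _ hR

theorem wp_getSnapshot {f : Option (BlockArray K) → Prog K T β} {Q : β → St K T → Prop}
    (h : ∀ σ', Rely P t σ σ' → wp P t (f (σ.m.snapshot t)) Q σ') :
    wp P t (getSnapshot >>= f) Q σ := by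
  refine wp_run (o := .getSnapshot) (fun _ _ => trivial) fun σ' r σ'' hR he _ => ?_
  obtain ⟨⟨rfl, hm⟩, hg⟩ := he
  obtain rfl := Op.XExec.eq_of_read hm hg
  rw [hR.keep.snapshot]
  exact h _ hR

theorem wp_readSize {v : Fin T} {f : ℕ → Prog K T β} {Q : β → St K T → Prop}
    (h : ∀ σ', Rely P t σ σ' → wp P t (f (σ'.m.size v)) Q σ') :
    wp P t (readSize v >>= f) Q σ := by
  refine wp_run (o := .readSize v) (fun _ _ => trivial) fun σ' r σ'' hR he _ => ?_
  obtain ⟨⟨rfl, hm⟩, hg⟩ := he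
  obtain rfl := Op.XExec.eq_of_read hm hg
  exact h _ hR

theorem wp_readSlot {v : Fin T} {i : ℕ} {f : Option (Block K) → Prog K T β}
    {Q : β → St K T → Prop} (h : ∀ σ', Rely P t σ σ' → wp P t (f (σ'.m.slot v i)) Q σ') :
    wp P t (readSlot v i >>= f) Q σ := by
  refine wp_run (o := .readSlot v i) (fun _ _ => trivial) fun σ' r σ'' hR he _ => ?_
  obtain ⟨⟨rfl, hm⟩, hg⟩ := he
  obtain rfl := Op.XExec.eq_of_read hm hg
  exact h _ hR

theorem wp_randInt {n : ℕ} {f : Fin (n + 1) → Prog K T β} {Q : β → St K T → Prop}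
    (h : ∀ σ' r, Rely P t σ σ' → wp P t (f r) Q σ') : wp P t (randInt n >>= f) Q σ := by
  refine wp_run (o := .randInt n) (fun _ _ => trivial) fun σ' r σ'' hR he _ => ?_
  obtain ⟨hm, hg⟩ := he
  obtain rfl := Op.XExec.eq_of_read hm hg
  exact h _ _ hR

theorem wp_randThread {f : Fin T → Prog K T β} {Q : β → St K T → Prop}
    (h : ∀ σ' r, Rely P t σ σ' → wp P t (f r) Q σ') : wp P t (randThread >>= f) Q σ := by
  refine wp_run (o := .randThread) (fun _ _ => trivial) fun σ' r σ'' hR he _ => ?_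
  obtain ⟨hm, hg⟩ := he
  obtain rfl := Op.XExec.eq_of_read hm hg
  exact h _ _ hR

theorem wp_newItem {key : K} {f : Item K → Prog K T β} {Q : β → St K T → Prop}
    (h : ∀ σ' i, Rely P t σ σ' → i.addr < σ'.m.next → wp P t (f i) Q σ') :
    wp P t (newItem key >>= f) Q σ := by
  refine wp_run (o := .newItem key) (fun _ _ => trivial) fun σ' r σ'' hR he hL => ?_
  obtain ⟨⟨rfl, hm⟩, hg⟩ := he
  refine h _ _ (hR.trans (rely_of_eq hL ?_ ?_ ?_ ?_ ?_ ?_ ?_ ?_)) ?_ <;> simp [hm, hg, Op.ghost]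

theorem wp_newBlock {l : ℕ} {its : List (Item K)} {f : Block K → Prog K T β}
    {Q : β → St K T → Prop} (hp : ∀ i ∈ its, i.addr < σ.m.next)
    (h : ∀ σ' b, Rely P t σ σ' → Known σ' b → b.items = its → wp P t (f b) Q σ') :
    wp P t (newBlock l its >>= f) Q σ := by
  refine wp_run (o := .newBlock l its) (fun σ' hR i hi => hR.lt (hp i hi))
    fun σ' r σ'' hR he hL => ?_
  obtain ⟨⟨rfl, hm⟩, hg⟩ := he
  refine h _ _ (hR.trans (rely_of_eq hL ?_ ?_ ?_ ?_ ?_ ?_ ?_ ?_)) ?_ ?_ <;>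
    simp [hm, hg, Op.ghost, Known]

theorem wp_writeFilled {b : Block K} {n : ℕ} {f : Unit → Prog K T β}
    {Q : β → St K T → Prop} (hb : Known σ b) (hn : n ≤ b.items.length)
    (hd : ∀ i ∈ b.items.drop n, σ.m.flag i.addr = true) (hl : n ≤ liveLen P.D b.items)
    (h : ∀ σ', Rely P t σ σ' → Tight P.D σ' b → wp P t (f ()) Q σ') :
    wp P t (writeFilled b n >>= f) Q σ := by
  refine wp_run (o := .writeFilled b n)
    (fun σ' hR => ⟨hR.known hb, hn, fun i hi => hR.flag (hd i hi), hl⟩)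
    fun σ' r σ'' hR he hL => ?_
  obtain ⟨hm, hg⟩ := he
  dsimp only [Op.Exec] at hm
  refine h _ (hR.trans (rely_of_eq hL ?_ ?_ ?_ ?_ ?_ ?_ ?_ ?_)) ?_ <;>
    simp [hm, hg, hl, Op.ghost, Tight]

theorem wp_newBlock' {l : ℕ} {its : List (Item K)} {Q : Block K → St K T → Prop}
    (hp : ∀ i ∈ its, i.addr < σ.m.next)
    (h : ∀ σ' b, Rely P t σ σ' → Known σ' b → b.items = its → Q b σ') :
    wp P t (newBlock l its) Q σ := by
  rw [← bind_pure' (newBlock l its)]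
  exact wp_newBlock hp fun σ' b hR hb hi => wp_pure fun σ'' hR' =>
    h σ'' b (hR.trans hR') (hR'.known hb) hi

/-! ### The part of an item array that is not deleted -/

/-- Some item is not in `D`. -/
def Act (D : Set ℕ) (its : List (Item K)) : Prop := ∃ x ∈ its, x.addr ∉ D

theorem liveLen_pos {D : Set ℕ} {its : List (Item K)} : 0 < liveLen D its ↔ Act D its := by
  induction its with
  | nil => simp [liveLen, Act]
  | cons x xs ih =>
    simp only [liveLen]
    split_ifs with h h'
    · have : ¬ Act D xs := fun hx => by have := ih.2 hx; omega
      simp only [Act, not_exists, not_and] at this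
      simp [Act, h']
      exact fun y hy => not_not.1 (this y hy)
    · simp [Act, h']
    · have := ih.1 (by omega)
      obtain ⟨y, hy, hd⟩ := this
      simp only [Nat.succ_pos, true_iff]
      exact ⟨y, List.mem_cons_of_mem _ hy, hd⟩

theorem liveLen_le_length {D : Set ℕ} {its : List (Item K)} : liveLen D its ≤ its.length := by
  induction its with
  | nil => simp [liveLen]
  | cons x xs ih =>
    simp only [liveLen]
    split_ifs <;> simp
    exact ih

theorem lt_liveLen {D : Set ℕ} {l₁ l₂ : List (Item K)} {x : Item K} (hx : x.addr ∉ D) :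
    l₁.length < liveLen D (l₁ ++ x :: l₂) := by
  induction l₁ with
  | nil => exact liveLen_pos.2 ⟨x, by simp, hx⟩
  | cons y ys ih =>
    simp only [List.cons_append, liveLen, List.length_cons]
    rw [if_neg (by omega)]
    omega

theorem liveLen_le {D : Set ℕ} {its : List (Item K)} {n : ℕ}
    (h : ∀ x ∈ its.drop n, x.addr ∈ D) : liveLen D its ≤ n := by
  induction its generalizing n with
  | nil => simp [liveLen]
  | cons x xs ih =>
    simp only [liveLen]
    cases n with
    | zero =>
      simp at h
      have := ih (n := 0) (by simpa using h.2)
      simp [h.1, Nat.le_zero.1 this]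
    | succ n =>
      have := ih (n := n) (by simpa using h)
      split_ifs <;> omega

theorem getElem?_liveLen {D : Set ℕ} {its : List (Item K)} {n : ℕ} (h : liveLen D its = n + 1) :
    ∃ x, its[n]? = some x ∧ x.addr ∉ D := by
  induction its generalizing n with
  | nil => simp [liveLen] at h
  | cons x xs ih =>
    simp only [liveLen] at h
    split_ifs at h with h1 h2
    · obtain rfl : n = 0 := by omega
      exact ⟨x, by simp, h2⟩
    · cases n with
      | zero => omega
      | succ n =>
        obtain ⟨y, hy, hd⟩ := ih (n := n) (by omega)
        exact ⟨y, by simpa using hy, hd⟩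

/-- In the stable regime, `filled` has its final value. -/
theorem Tight.filled_eq {b : Block K} (h : Tight P.D σ b) (hI : Inv P σ) (hb : Known σ b)
    (hs : P.st) : σ.m.filled b.addr = liveLen P.D b.items :=
  le_antisymm h (liveLen_le fun x hx => hI.only hs _ (hI.good.tail_dead b hb x hx))

/-- Items beyond `filled` are deleted, and in the stable regime all deleted items are in `P.D`. -/
theorem Inv.mem_take {b : Block K} (hI : Inv P σ) (hb : Known σ b) (hs : P.st) {x : Item K}
    (hx : x ∈ b.items) (hd : x.addr ∉ P.D) : x ∈ b.items.take (σ.m.filled b.addr) := by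
  rw [← List.take_append_drop (σ.m.filled b.addr) b.items, List.mem_append] at hx
  rcases hx with h | h
  · exact h
  · exact absurd (hI.only hs _ (hI.good.tail_dead b hb x h)) hd

theorem Inv.not_mem {i : Item K} (hI : Inv P σ) (h : ¬ σ.m.flag i.addr = true) :
    i.addr ∉ P.D := fun hd => h (hI.dead _ hd)

theorem Inv.mem {i : Item K} (hI : Inv P σ) (hs : P.st) (h : σ.m.flag i.addr = true) :
    i.addr ∈ P.D := hI.only hs _ h

/-! ### Blocks -/

/-- Each flag is read after the items of `P.D` have died, so they are skipped in every regime; in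
the stable regime nothing else is skipped. -/
theorem wp_copyLoop {b : Block K} {i : ℕ} {rest : List (Item K)}
    {Q : List (Item K) → St K T → Prop} (hb : Known σ b) (hi : b.items.drop i = rest)
    (hQ : ∀ σ' its, Rely P t σ σ' → (∀ x ∈ its, x ∈ rest ∧ x.addr ∉ P.D) →
      (P.st → ∀ x ∈ rest, x.addr ∉ P.D → x ∈ its) → Q its σ') :
    wp P t (copyLoop b i rest) Q σ := by
  induction rest generalizing i σ Q with
  | nil => exact wp_pure fun σ' h => hQ σ' [] h (by simp) (by simp)
  | cons it rest ih =>
    refine wp_readFilled fun σ₁ h₁ => ?_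
    split_ifs with hlt
    · refine wp_readFlag fun σ₂ h₂ => ?_
      have h₁₂ := h₁.trans h₂
      refine wp_bind (ih (i := i + 1) (h₁₂.known hb) ?_ fun σ₃ tl h₃ hin hall => ?_)
      · rw [← List.tail_drop, hi, List.tail_cons]
      refine wp_pure fun σ₄ h₄ => hQ σ₄ _ (h₁₂.trans (h₃.trans h₄)) ?_ ?_
      · intro x hx
        split_ifs at hx with hdel
        · exact ⟨List.mem_cons_of_mem _ (hin x hx).1, (hin x hx).2⟩
        · rcases List.mem_cons.1 hx with rfl | hx
          · exact ⟨List.mem_cons_self, h₂.inv.not_mem hdel⟩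
          · exact ⟨List.mem_cons_of_mem _ (hin x hx).1, (hin x hx).2⟩
      · intro hs x hx hd
        split_ifs with hdel
        · rcases List.mem_cons.1 hx with rfl | hx
          · exact absurd (h₂.inv.mem hs hdel) hd
          · exact hall hs x hx hd
        · rcases List.mem_cons.1 hx with rfl | hx
          · exact List.mem_cons_self
          · exact List.mem_cons_of_mem _ (hall hs x hx hd)
    -- When the loop stops early, `filled` is at most `i`, so all remaining items lie in the dead
    -- tail.
    · refine wp_pure fun σ₂ h₂ => hQ σ₂ [] (h₁.trans h₂) (by simp) fun hs x hx hd => ?_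
      refine absurd (h₁.inv.only hs _ (h₁.inv.good.tail_dead b (h₁.known hb) x ?_)) hd
      rw [← hi] at hx
      exact (List.drop_sublist_drop_left _ (not_lt.1 hlt)).subset hx

theorem wp_copy {b : Block K} {l : ℕ} {Q : Block K → St K T → Prop} (hI : Inv P σ)
    (hb : Known σ b)
    (hQ : ∀ σ' c, Rely P t σ σ' → Known σ' c → (∀ x ∈ c.items, x.addr ∉ P.D) →
      (P.st → Act P.D b.items → Act P.D c.items) → Q c σ') :
    wp P t (b.copy l) Q σ := by
  refine wp_bind (wp_copyLoop hb List.drop_zero fun σ₁ its h₁ hin hall => ?_)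
  refine wp_newBlock' (fun i hi => h₁.lt (hI.good.items_lt b hb i (hin i hi).1))
    fun σ₂ c h₂ hc hci => hQ σ₂ c (h₁.trans h₂) hc ?_ ?_
  · rw [hci]
    exact fun x hx => (hin x hx).2
  · rintro hs ⟨x, hx, hd⟩
    exact ⟨x, hci ▸ hall hs x hx hd, hd⟩

theorem wp_appendLoop {l : List (Item K)} {Q : List (Item K) → St K T → Prop}
    (hQ : ∀ σ' its, Rely P t σ σ' → (∀ x ∈ its, x ∈ l) →
      (P.st → ∀ x ∈ l, x.addr ∉ P.D → x ∈ its) → Q its σ') :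
    wp P t (appendLoop l) Q σ := by
  induction l generalizing σ Q with
  | nil => exact wp_pure fun σ' h => hQ σ' [] h (by simp) (by simp)
  | cons it rest ih =>
    refine wp_readFlag fun σ₂ h₂ => ?_
    refine wp_bind (ih fun σ₃ tl h₃ hin hall => ?_)
    refine wp_pure fun σ₄ h₄ => hQ σ₄ _ (h₂.trans (h₃.trans h₄)) ?_ ?_
    · intro x hx
      split_ifs at hx with hdel
      · exact List.mem_cons_of_mem _ (hin x hx)
      · rcases List.mem_cons.1 hx with rfl | hx
        · exact List.mem_cons_self
        · exact List.mem_cons_of_mem _ (hin x hx)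
    · intro hs x hx hd
      split_ifs with hdel
      · rcases List.mem_cons.1 hx with rfl | hx
        · exact absurd (h₂.inv.mem hs hdel) hd
        · exact hall hs x hx hd
      · rcases List.mem_cons.1 hx with rfl | hx
        · exact List.mem_cons_self
        · exact List.mem_cons_of_mem _ (hall hs x hx hd)

theorem wp_mergeBlocks {b c : Block K} {l : ℕ} {Q : Block K → St K T → Prop} (hI : Inv P σ)
    (hb : Known σ b) (hc : Known σ c)
    (hQ : ∀ σ' d, Rely P t σ σ' → Known σ' d →
      (P.st → Act P.D b.items ∨ Act P.D c.items → Act P.D d.items) → Q d σ') :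
    wp P t (mergeBlocks l b c) Q σ := by
  refine wp_readFilled fun σ₁ h₁ => wp_readFilled fun σ₂ h₂ => ?_
  refine wp_bind (wp_appendLoop fun σ₃ its h₃ hin hall => ?_)
  have h₁₂ := h₁.trans h₂
  have h₁₃ := h₁₂.trans h₃
  refine wp_newBlock' (fun i hi => h₁₃.lt ?_) fun σ₄ d h₄ hd hdi => hQ σ₄ d (h₁₃.trans h₄) hd ?_
  · rcases List.mem_merge.1 (hin i hi) with h | h
    · exact hI.good.items_lt b hb i (List.mem_of_mem_take h)
    · exact hI.good.items_lt c hc i (List.mem_of_mem_take h)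
  · rw [hdi]
    rintro hs (⟨x, hx, hxd⟩ | ⟨x, hx, hxd⟩)
    · exact ⟨x, hall hs x (List.mem_merge.2 (Or.inl (h₁.inv.mem_take (h₁.known hb) hs hx hxd))) hxd,
        hxd⟩
    · exact ⟨x, hall hs x (List.mem_merge.2 (Or.inr (h₂.inv.mem_take (h₁₂.known hc) hs hx hxd))) hxd,
        hxd⟩

/-- As the list is reversed, the head of `kept` is the last item that remains. It was seen active,
hence is not in `P.D`; the dropped items were seen dead, and remain so. -/
theorem wp_tailScan {l : List (Item K)} {Q : ℕ → St K T → Prop}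
    (hQ : ∀ σ' dropped kept, Rely P t σ σ' → l = dropped ++ kept →
      (∀ x ∈ dropped, σ'.m.flag x.addr = true) →
      (∀ x xs, kept = x :: xs → x.addr ∉ P.D) → Q kept.length σ') :
    wp P t (tailScan l) Q σ := by
  induction l generalizing σ Q with
  | nil => exact wp_pure fun σ' h => hQ σ' [] [] h (by simp) (by simp) (by simp)
  | cons it rest ih =>
    refine wp_readFlag fun σ₁ h₁ => ?_
    split_ifs with hdel
    · refine ih fun σ₂ dropped kept h₂ hl hd hk =>
        hQ σ₂ (it :: dropped) kept (h₁.trans h₂) (by simp [hl]) ?_ hk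
      intro x hx
      rcases List.mem_cons.1 hx with rfl | hx
      · exact h₂.flag hdel
      · exact hd x hx
    · refine wp_pure fun σ₂ h₂ => hQ σ₂ [] (it :: rest) (h₁.trans h₂) (by simp) (by simp) ?_
      rintro x xs ⟨⟩
      exact h₁.inv.not_mem hdel

/-- Provides exactly the precondition of `writeFilled`. The value `f` may be outdated when the write
happens; this does no harm, because the items cut off stay dead. -/
theorem wp_scan {b : Block K} {f : ℕ} {Q : ℕ → St K T → Prop}
    (hd : ∀ i ∈ b.items.drop f, σ.m.flag i.addr = true)
    (hQ : ∀ σ' n, Rely P t σ σ' → n ≤ b.items.length →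
      (∀ i ∈ b.items.drop n, σ'.m.flag i.addr = true) → n ≤ liveLen P.D b.items → Q n σ') :
    wp P t (tailScan (b.items.take f).reverse) Q σ := by
  refine wp_tailScan fun σ' dropped kept h hl hdr hk => ?_
  have hit : b.items = kept.reverse ++ (dropped.reverse ++ b.items.drop f) := by
    have := congrArg List.reverse hl
    rw [List.reverse_reverse, List.reverse_append] at this
    rw [← List.append_assoc, ← this, List.take_append_drop]
  have hlen : kept.length = kept.reverse.length := by simp
  refine hQ σ' kept.length h ?_ ?_ ?_
  · rw [hit]; simp
  · rw [hit, hlen, List.drop_left]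
    intro i hi
    rcases List.mem_append.1 hi with hi | hi
    · exact hdr i (by simpa using hi)
    · exact h.flag (hd i hi)
  · cases kept with
    | nil => simp
    | cons x xs =>
      have := lt_liveLen (D := P.D) (l₁ := xs.reverse) (l₂ := dropped.reverse ++ b.items.drop f)
        (hk x xs rfl)
      rw [hit]
      simpa using this

/-- Every branch without a copy ends by writing the scanned value, which makes the block tight, and
in the stable regime it stays tight. The other branch passes to a copy that keeps some active item
if there was one. -/
theorem wp_shrinkAux {n : ℕ} {b : Block K} {Q : Block K → St K T → Prop} (hb : Known σ b)
    (hQ : ∀ σ' c, Rely P t σ σ' → Known σ' c → (P.st → Tight P.D σ' c) →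
      (P.st → Act P.D b.items → Act P.D c.items) → Q c σ') :
    wp P t (shrinkAux n b) Q σ := by
  induction n generalizing σ b Q with
  | zero =>
    refine wp_readFilled fun σ₁ h₁ => ?_
    refine wp_bind (wp_scan (h₁.inv.good.tail_dead b (h₁.known hb)) fun σ₂ n h₂ hn hd hl => ?_)
    have h₁₂ := h₁.trans h₂
    refine wp_writeFilled (h₁₂.known hb) hn hd hl fun σ₃ h₃ ht => wp_pure fun σ₄ h₄ => ?_
    have h₁₃ := h₁₂.trans h₃
    exact hQ σ₄ b (h₁₃.trans h₄) ((h₁₃.trans h₄).known hb)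
      (fun hs => h₄.le.tight hs b (h₁₃.known hb) ht) (fun _ h => h)
  | succ n ih =>
    refine wp_readFilled fun σ₁ h₁ => ?_
    refine wp_bind (wp_scan (h₁.inv.good.tail_dead b (h₁.known hb)) fun σ₂ n h₂ hn hd hl => ?_)
    have h₁₂ := h₁.trans h₂
    split_ifs
    · refine wp_bind (wp_copy h₂.inv (h₁₂.known hb) fun σ₃ c h₃ hc _ hact => ?_)
      exact ih hc fun σ₄ c' h₄ hc' ht hact' =>
        hQ σ₄ c' (h₁₂.trans (h₃.trans h₄)) hc' ht fun hs h => hact' hs (hact hs h)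
    · refine wp_writeFilled (h₁₂.known hb) hn hd hl fun σ₃ h₃ ht => wp_pure fun σ₄ h₄ => ?_
      have h₁₃ := h₁₂.trans h₃
      exact hQ σ₄ b (h₁₃.trans h₄) ((h₁₃.trans h₄).known hb)
        (fun hs => h₄.le.tight hs b (h₁₃.known hb) ht) (fun _ h => h)

theorem wp_shrink {b : Block K} {Q : Block K → St K T → Prop} (hb : Known σ b)
    (hQ : ∀ σ' c, Rely P t σ σ' → Known σ' c → (P.st → Tight P.D σ' c) →
      (P.st → Act P.D b.items → Act P.D c.items) → Q c σ') :
    wp P t b.shrink Q σ := wp_shrinkAux hb hQ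

/-- For a tight block in the stable regime `filled` equals `liveLen`, and the item at the last
counted position is not in `P.D`. -/
theorem wp_last {b : Block K} {Q : Option (Item K) → St K T → Prop} (hb : Known σ b)
    (hQ : ∀ σ' x, Rely P t σ σ' → (∀ i, x = some i → i.addr < σ'.m.next) →
      (P.st → Tight P.D σ b → Act P.D b.items → ∃ i, x = some i ∧ i.addr ∉ P.D) → Q x σ') :
    wp P t b.last Q σ := by
  refine wp_readFilled fun σ₁ h₁ => ?_
  have key : P.st → Tight P.D σ b → Act P.D b.items →
      ∃ n, σ₁.m.filled b.addr = n + 1 ∧ ∃ i, b.items[n]? = some i ∧ i.addr ∉ P.D := by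
    intro hs ht ha
    have := (h₁.le.tight hs b hb ht).filled_eq h₁.inv (h₁.known hb) hs
    have hpos := liveLen_pos.2 ha
    obtain ⟨n, hn⟩ := Nat.exists_eq_succ_of_ne_zero hpos.ne'
    exact ⟨n, by omega, getElem?_liveLen hn⟩
  split
  · rename_i hf
    refine wp_pure fun σ₂ h₂ => hQ σ₂ none (h₁.trans h₂) (by simp) fun hs ht ha => ?_
    obtain ⟨n, hn, -⟩ := key hs ht ha
    omega
  · rename_i f hf
    refine wp_pure fun σ₂ h₂ => hQ σ₂ _ (h₁.trans h₂) ?_ fun hs ht ha => ?_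
    · intro i hi
      exact h₂.lt (h₁.inv.good.items_lt b (h₁.known hb) i (List.mem_of_getElem? hi))
    · obtain ⟨n, hn, i, hi, hd⟩ := key hs ht ha
      obtain rfl : n = f := by omega
      exact ⟨i, hi, hd⟩

/-! ### Consolidation -/

theorem Rely.tight_all {σ' : St K T} (h : Rely P t σ σ') {bs : List (Block K)}
    (hk : ∀ b ∈ bs, Known σ b) (ht : P.st → ∀ b ∈ bs, Tight P.D σ b) :
    P.st → ∀ b ∈ bs, Tight P.D σ' b :=
  fun hs b hb => h.le.tight hs b (hk b hb) (ht hs b hb)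

/-- Each merge turns two blocks into one. This is why a set flag witnesses a strictly shorter list,
on which the potential argument rests. -/
theorem wp_mergeFront {b : Block K} {rest : List (Block K)} {merged : Bool}
    {Q : List (Block K) × Bool → St K T → Prop}
    (hb : ∀ c ∈ b :: rest, Known σ c) (ht : P.st → ∀ c ∈ b :: rest, Tight P.D σ c)
    (hQ : ∀ σ' r, Rely P t σ σ' → (∀ c ∈ r.1, Known σ' c) → (P.st → ∀ c ∈ r.1, Tight P.D σ' c) →
      r.1.length ≤ rest.length + 1 → (r.2 = true → merged = true ∨ r.1.length ≤ rest.length) →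
      (P.st → (∃ c ∈ b :: rest, Act P.D c.items) → ∃ c ∈ r.1, Act P.D c.items) → Q r σ') :
    wp P t (mergeFront b rest merged) Q σ := by
  -- The postcondition refers to the fixed state `σ`, while the induction moves only `σ₀`, linked to
  -- `σ` by `h₀`.
  refine wp_stable fun σ₀ h₀ => ?_
  replace ht := h₀.tight_all hb ht
  replace hb := h₀.known_all hb
  induction rest generalizing b σ₀ merged with
  | nil =>
    exact wp_pure fun σ₁ h₁ => hQ σ₁ _ (h₀.trans h₁) (h₁.known_all hb) (h₁.tight_all hb ht)
      (by simp) (fun h => Or.inl h) (fun _ h => h)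
  | cons c rest ih =>
    simp only [List.mem_cons, forall_eq_or_imp] at hb
    rw [mergeFront]
    split_ifs with hlev
    · refine wp_bind (wp_mergeBlocks h₀.inv hb.1 hb.2.1 fun σ₁ d h₁ hd hda => ?_)
      refine wp_bind (wp_shrink hd fun σ₂ d' h₂ hd' ht' hda' => ?_)
      have h₁₂ := h₁.trans h₂
      refine ih ?_ σ₂ (h₀.trans h₁₂) ?_ ?_
      · intro σ₃ r h₃ hr hrt hlen hmer hact
        refine hQ σ₃ r h₃ hr hrt (by simp; omega) (fun _ => Or.inr (by simpa using hlen)) ?_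
        intro hs
        simp only [List.mem_cons, exists_eq_or_imp]
        intro h
        refine hact hs ?_
        simp only [List.mem_cons, exists_eq_or_imp]
        rcases h with h | h | h
        · exact Or.inl (hda' hs (hda hs (Or.inl h)))
        · exact Or.inl (hda' hs (hda hs (Or.inr h)))
        · exact Or.inr h
      · intro hs
        simp only [List.mem_cons, forall_eq_or_imp]
        refine ⟨ht' hs, h₁₂.tight_all hb.2.2 (fun hs e he => ?_) hs⟩
        exact ht hs e (by simp [he])
      · simp only [List.mem_cons, forall_eq_or_imp]
        exact ⟨hd', h₁₂.known_all hb.2.2⟩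
    · have hb' : ∀ e ∈ b :: c :: rest, Known σ₀ e := by simpa using hb
      exact wp_pure fun σ₁ h₁ => hQ σ₁ _ (h₀.trans h₁) (h₁.known_all hb') (h₁.tight_all hb' ht)
        (by simp) (fun h => Or.inl h) (fun _ h => h)

theorem wp_consolidatePass {bs : List (Block K)} {Q : List (Block K) × Bool → St K T → Prop}
    (hb : ∀ c ∈ bs, Known σ c)
    (hQ : ∀ σ' r, Rely P t σ σ' → (∀ c ∈ r.1, Known σ' c) → (P.st → ∀ c ∈ r.1, Tight P.D σ' c) →
      r.1.length ≤ bs.length → (r.2 = true → r.1.length < bs.length) →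
      (P.st → (∃ c ∈ bs, Act P.D c.items) → ∃ c ∈ r.1, Act P.D c.items) → Q r σ') :
    wp P t (consolidatePass bs) Q σ := by
  induction bs generalizing σ Q with
  | nil => exact wp_pure fun σ₁ h₁ => hQ σ₁ _ h₁ (by simp) (by simp) (by simp) (by simp) (by simp)
  | cons b rest ih =>
    simp only [List.mem_cons, forall_eq_or_imp] at hb
    refine wp_bind (ih hb.2 fun σ₁ r h₁ hr ht hlen hmer hact => ?_)
    refine wp_bind (wp_shrink (h₁.known hb.1) fun σ₂ b' h₂ hb' ht' hact' => ?_)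
    refine wp_mergeFront ?_ ?_ fun σ₃ r' h₃ hr' hrt' hlen' hmer' hact'' =>
      hQ σ₃ r' (h₁.trans (h₂.trans h₃)) hr' hrt' (by simp; omega) ?_ ?_
    · simp only [List.mem_cons, forall_eq_or_imp]
      exact ⟨hb', h₂.known_all hr⟩
    · intro hs
      simp only [List.mem_cons, forall_eq_or_imp]
      exact ⟨ht' hs, h₂.tight_all hr ht hs⟩
    · intro hm
      simp only [List.length_cons]
      rcases hmer' hm with h | h
      · have := hmer h
        omega
      · omega
    · intro hs
      simp only [List.mem_cons, exists_eq_or_imp] at hact'' ⊢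
      rintro (h | h)
      · exact hact'' hs (Or.inl (hact' hs h))
      · exact hact'' hs (Or.inr (hact hs h))

/-- In the stable regime the blocks are tight, so `filled` is zero exactly for the blocks without an
active item. -/
theorem wp_dropEmpty {bs : List (Block K)} {Q : List (Block K) → St K T → Prop}
    (hb : ∀ c ∈ bs, Known σ c) (ht : P.st → ∀ c ∈ bs, Tight P.D σ c)
    (hQ : ∀ σ' r, Rely P t σ σ' → (∀ c ∈ r, c ∈ bs) → (P.st → ∀ c ∈ r, Act P.D c.items) →
      r.length ≤ bs.length → (P.st → (∃ c ∈ bs, Act P.D c.items) → r ≠ []) → Q r σ') :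
    wp P t (dropEmpty bs) Q σ := by
  induction bs generalizing σ Q with
  | nil => exact wp_pure fun σ₁ h₁ => hQ σ₁ _ h₁ (by simp) (by simp) (by simp) (by simp)
  | cons b rest ih =>
    refine wp_readFilled fun σ₁ h₁ => ?_
    have hb₁ := h₁.known_all hb
    have ht₁ := h₁.tight_all hb ht
    refine wp_bind (ih (fun c hc => hb₁ c (List.mem_cons_of_mem _ hc))
      (fun hs c hc => ht₁ hs c (List.mem_cons_of_mem _ hc)) fun σ₂ r h₂ hr ha hlen hne => ?_)
    have hf : P.st → σ₁.m.filled b.addr = liveLen P.D b.items := fun hs =>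
      (ht₁ hs b List.mem_cons_self).filled_eq h₁.inv (hb₁ b List.mem_cons_self) hs
    refine wp_pure fun σ₃ h₃ => hQ σ₃ _ (h₁.trans (h₂.trans h₃)) ?_ ?_ ?_ ?_
    · intro c hc
      split_ifs at hc
      · exact List.mem_cons_of_mem _ (hr c hc)
      · rcases List.mem_cons.1 hc with rfl | hc
        · exact List.mem_cons_self
        · exact List.mem_cons_of_mem _ (hr c hc)
    · intro hs c hc
      split_ifs at hc with h0
      · exact ha hs c hc
      · rcases List.mem_cons.1 hc with rfl | hc
        · rw [← liveLen_pos, ← hf hs]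
          omega
        · exact ha hs c hc
    · split_ifs <;> simp <;> omega
    · intro hs
      simp only [List.mem_cons, exists_eq_or_imp]
      split_ifs with h0
      · rintro (h | h)
        · rw [← liveLen_pos, ← hf hs] at h
          omega
        · exact hne hs h
      · simp

theorem wp_readContents {bs : List (Block K)} {Q : List (List (Item K)) → St K T → Prop}
    (hb : ∀ c ∈ bs, Known σ c) (ht : P.st → ∀ c ∈ bs, Tight P.D σ c)
    (hQ : ∀ σ' r, Rely P t σ σ' →
      (P.st → r = bs.map fun b => b.items.take (liveLen P.D b.items)) → Q r σ') :
    wp P t (readContents bs) Q σ := by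
  induction bs generalizing σ Q with
  | nil => exact wp_pure fun σ₁ h₁ => hQ σ₁ _ h₁ (by simp)
  | cons b rest ih =>
    refine wp_readFilled fun σ₁ h₁ => ?_
    have hb₁ := h₁.known_all hb
    have ht₁ := h₁.tight_all hb ht
    refine wp_bind (ih (fun c hc => hb₁ c (List.mem_cons_of_mem _ hc))
      (fun hs c hc => ht₁ hs c (List.mem_cons_of_mem _ hc)) fun σ₂ r h₂ hr => ?_)
    refine wp_pure fun σ₃ h₃ => hQ σ₃ _ (h₁.trans (h₂.trans h₃)) fun hs => ?_
    rw [hr hs, (ht₁ hs b List.mem_cons_self).filled_eq h₁.inv (hb₁ b List.mem_cons_self) hs]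
    simp

/-- A block array on which a search finds an item that is not deleted. -/
structure Clean (k : ℕ) (D : Set ℕ) (σ : St K T) (a : BlockArray K) : Prop where
  ne : a.blocks ≠ []
  known : ∀ b ∈ a.blocks, Known σ b
  tight : ∀ b ∈ a.blocks, Tight D σ b
  act : ∀ b ∈ a.blocks, Act D b.items
  pivots : a.pivots = pivotsOf k (a.blocks.map fun b => b.items.take (liveLen D b.items))

theorem Clean.of_le {k : ℕ} {σ' : St K T} {a : BlockArray K} (h : Clean k P.D σ a)
    (hL : Le P σ σ') (hs : P.st) : Clean k P.D σ' a :=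
  ⟨h.ne, fun b hb => hL.mono.blk b (h.known b hb),
    fun b hb => hL.tight hs b (h.known b hb) (h.tight b hb), h.act, h.pivots⟩

/-- Serves both halves of the progress argument: a merge strictly lowers the number of blocks, and
in the stable regime a nonempty result needs no further cleanup. The address, and with it the
ownership, is unchanged. -/
theorem wp_consolidate {k : ℕ} {a : BlockArray K} {Q : BlockArray K × Bool → St K T → Prop}
    (hb : ∀ c ∈ a.blocks, Known σ c)
    (hQ : ∀ σ' r, Rely P t σ σ' → r.1.addr = a.addr → (∀ c ∈ r.1.blocks, Known σ' c) →
      r.1.blocks.length ≤ a.blocks.length →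
      (r.2 = true → r.1.blocks.length < a.blocks.length) →
      (P.st → r.1.blocks ≠ [] → Clean k P.D σ' r.1) → Q r σ') :
    wp P t (a.consolidate k) Q σ := by
  refine wp_bind (wp_consolidatePass hb fun σ₁ r h₁ hr ht hlen hmer _ => ?_)
  refine wp_bind (wp_dropEmpty hr ht fun σ₂ bs h₂ hbs ha hlen' _ => ?_)
  have hk₂ : ∀ c ∈ bs, Known σ₂ c := fun c hc => h₂.known (hr c (hbs c hc))
  have ht₂ : P.st → ∀ c ∈ bs, Tight P.D σ₂ c := fun hs c hc => h₂.tight_all hr ht hs c (hbs c hc)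
  refine wp_bind (wp_readContents hk₂ ht₂ fun σ₃ cs h₃ hcs => wp_pure fun σ₄ h₄ => ?_)
  have h₂₄ := h₃.trans h₄
  refine hQ σ₄ _ (h₁.trans (h₂.trans h₂₄)) rfl (h₂₄.known_all hk₂) (hlen'.trans hlen)
    (fun hm => hlen'.trans_lt (hmer hm)) fun hs hne => ⟨hne, h₂₄.known_all hk₂,
      h₂₄.tight_all hk₂ ht₂ hs, ha hs, ?_⟩
  simp [hcs hs]

end Logic

end KLSM

/-! ### Searching block arrays; the distributed LSM -/

namespace KLSM

section Logic

variable {K : Type} [LinearOrder K] {T : ℕ}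
variable {P : Mode} {t : Fin T} {α β : Type} {σ : St K T}

/-! ### Searching a block array -/

theorem wp_countLoop {l : List (Block K × ℕ)} {Q : ℤ → St K T → Prop}
    (hb : ∀ q ∈ l, Known σ q.1)
    (hQ : ∀ σ' n, Rely P t σ σ' → (P.st → (∀ q ∈ l, Tight P.D σ q.1) →
      n = (l.map fun q => ((liveLen P.D q.1.items : ℕ) : ℤ) - (q.2 : ℤ)).sum) → Q n σ') :
    wp P t (countLoop l) Q σ := by
  induction l generalizing σ Q with
  | nil => exact wp_pure fun σ₁ h₁ => hQ σ₁ _ h₁ (by simp)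
  | cons q rest ih =>
    obtain ⟨b, p⟩ := q
    simp only [List.mem_cons, forall_eq_or_imp] at hb
    refine wp_readFilled fun σ₁ h₁ => ?_
    refine wp_bind (ih (fun q hq => h₁.known (hb.2 q hq)) fun σ₂ n h₂ hn => ?_)
    refine wp_pure fun σ₃ h₃ => hQ σ₃ _ (h₁.trans (h₂.trans h₃)) fun hs ht => ?_
    simp only [List.mem_cons, forall_eq_or_imp] at ht
    rw [hn hs fun q hq => h₁.le.tight hs _ (hb.2 q hq) (ht.2 q hq),
      (h₁.le.tight hs _ hb.1 ht.1).filled_eq h₁.inv (h₁.known hb.1) hs]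
    simp

/-- In the stable case `r` stays in the range of the remaining blocks, so some block is chosen; if
the chosen item is dead, the last item of that block is active. -/
theorem wp_selectLoop {l : List (Block K × ℕ)} {r : ℤ} {Q : Option (Item K) → St K T → Prop}
    (hb : ∀ q ∈ l, Known σ q.1)
    (hQ : ∀ σ' x, Rely P t σ σ' → (∀ i, x = some i → i.addr < σ'.m.next) →
      (P.st → (∀ q ∈ l, Tight P.D σ q.1 ∧ Act P.D q.1.items ∧ q.2 ≤ liveLen P.D q.1.items) →
        0 ≤ r → r < (l.map fun q => ((liveLen P.D q.1.items : ℕ) : ℤ) - (q.2 : ℤ)).sum →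
        ∃ i, x = some i ∧ i.addr ∉ P.D) → Q x σ') :
    wp P t (selectLoop l r) Q σ := by
  induction l generalizing σ Q r with
  | nil =>
    exact wp_pure fun σ₁ h₁ => hQ σ₁ _ h₁ (by simp) (by simp)
  | cons q rest ih =>
    obtain ⟨b, p⟩ := q
    simp only [List.mem_cons, forall_eq_or_imp] at hb
    refine wp_readFilled fun σ₁ h₁ => ?_
    have hlast : wp P t b.last Q σ₁ := wp_last (h₁.known hb.1) fun σ₂ x h₂ hx hact =>
      hQ σ₂ x (h₁.trans h₂) hx fun hs hall _ _ => by
        have := hall (b, p) List.mem_cons_self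
        exact hact hs (h₁.le.tight hs _ hb.1 this.1) this.2.1
    have hf : P.st → Tight P.D σ b → σ₁.m.filled b.addr = liveLen P.D b.items := fun hs ht =>
      (h₁.le.tight hs _ hb.1 ht).filled_eq h₁.inv (h₁.known hb.1) hs
    split_ifs with h1 h2
    · refine ih (fun q hq => h₁.known (hb.2 q hq)) fun σ₂ x h₂ hx hact =>
        hQ σ₂ x (h₁.trans h₂) hx fun hs hall hr hlt => ?_
      simp only [List.mem_cons, forall_eq_or_imp] at hall
      refine hact hs (fun q hq => ⟨h₁.le.tight hs _ (hb.2 q hq) (hall.2 q hq).1,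
        (hall.2 q hq).2⟩) ?_ ?_
      · omega
      · rw [hf hs hall.1.1]
        simp only [List.map_cons, List.sum_cons] at hlt
        omega
    · split
      · exact hlast
      · rename_i it hit
        refine wp_readFlag fun σ₂ h₂ => ?_
        split_ifs with hdel
        · exact wp_of_rely hlast h₂
        · refine wp_pure fun σ₃ h₃ => hQ σ₃ _ (h₁.trans (h₂.trans h₃)) ?_ ?_
          · rintro i ⟨⟩
            exact (h₂.trans h₃).lt
              (h₁.inv.good.items_lt b (h₁.known hb.1) _ (List.mem_of_getElem? hit))
          · exact fun _ _ _ _ => ⟨it, rfl, h₂.inv.not_mem hdel⟩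
    · exact hlast

/-- The pivot key is itself the key of some item, so the block containing this item has a pivot
index before its end. This makes the number of candidates positive. -/
theorem pivotsOf_eq_map (k : ℕ) {cs : List (List (Item K))} (hne : cs ≠ [])
    (hc : ∀ c ∈ cs, c ≠ []) : ∃ g : List (Item K) → ℕ, pivotsOf k cs = cs.map g ∧
      (∀ c, g c ≤ c.length) ∧ ∃ c ∈ cs, g c < c.length := by
  set keys := (cs.flatten.map Item.key).mergeSort (fun x y => decide (x ≤ y)) with hkeys
  have hlen : 0 < keys.length := by
    rw [hkeys, List.length_mergeSort, List.length_map, List.length_pos_iff_exists_mem]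
    obtain ⟨c, hmem⟩ := List.exists_mem_of_ne_nil cs hne
    obtain ⟨i, hi⟩ := List.exists_mem_of_ne_nil c (hc c hmem)
    exact ⟨i, List.mem_flatten.2 ⟨c, hmem, hi⟩⟩
  have hlt : min k (keys.length - 1) < keys.length := by omega
  set p := keys[min k (keys.length - 1)] with hp
  refine ⟨fun c => c.findIdx fun i => decide (i.key ≤ p), ?_, fun c => List.findIdx_le_length, ?_⟩
  · unfold pivotsOf
    simp only [← hkeys, List.getElem?_eq_getElem hlt]
    rfl
  · have hmem : p ∈ keys := List.getElem_mem hlt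
    rw [hkeys, List.mem_mergeSort, List.mem_map] at hmem
    obtain ⟨i, hi, hip⟩ := hmem
    obtain ⟨c, hcm, hic⟩ := List.mem_flatten.1 hi
    exact ⟨c, hcm, List.findIdx_lt_length_of_exists ⟨i, hic, by simp [hip]⟩⟩

theorem sum_map_pos {ι : Type} {l : List ι} {f : ι → ℤ} (h : ∀ x ∈ l, 0 ≤ f x)
    (h' : ∃ x ∈ l, 0 < f x) : 0 < (l.map f).sum := by
  obtain ⟨x, hx, hpos⟩ := h'
  refine hpos.trans_le (List.single_le_sum ?_ _ (List.mem_map_of_mem hx))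
  simpa using h

theorem zip_map_self {ι κ : Type} (l : List ι) (f : ι → κ) :
    l.zip (l.map f) = l.map fun x => (x, f x) := by
  induction l <;> simp_all

/-- On a clean array in the stable regime, both passes see `filled` equal to `liveLen`; the counted
total is thus the true and positive number of candidates, and any choice below it leads to an active
item. -/
theorem wp_findMin {k : ℕ} {a : BlockArray K} {Q : Option (Item K) → St K T → Prop}
    (hb : ∀ c ∈ a.blocks, Known σ c)
    (hQ : ∀ σ' x, Rely P t σ σ' → (∀ i, x = some i → i.addr < σ'.m.next) →
      (P.st → Clean k P.D σ a → ∃ i, x = some i ∧ i.addr ∉ P.D) → Q x σ') :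
    wp P t a.findMin Q σ := by
  have hk : ∀ q ∈ a.blocks.zip a.pivots, Known σ q.1 := fun q hq =>
    hb _ (List.of_mem_zip hq).1
  have hclean : Clean k P.D σ a → (∀ q ∈ a.blocks.zip a.pivots,
      Tight P.D σ q.1 ∧ Act P.D q.1.items ∧ q.2 ≤ liveLen P.D q.1.items) ∧
      0 < ((a.blocks.zip a.pivots).map
        fun q => ((liveLen P.D q.1.items : ℕ) : ℤ) - (q.2 : ℤ)).sum := by
    intro hc
    obtain ⟨g, hg, hle, c, hcm, hclt⟩ := pivotsOf_eq_map k
      (cs := a.blocks.map fun b => b.items.take (liveLen P.D b.items)) (by simpa using hc.ne)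
      (by
        simp only [List.mem_map, forall_exists_index, and_imp, forall_apply_eq_imp_iff₂]
        intro b hbm
        have := liveLen_pos.2 (hc.act b hbm)
        rw [← List.length_pos_iff, List.length_take]
        exact lt_min this (this.trans_le liveLen_le_length))
    have hlen : ∀ b : Block K, (b.items.take (liveLen P.D b.items)).length =
        liveLen P.D b.items := fun b => by simp [liveLen_le_length]
    obtain ⟨b, hbm, rfl⟩ := List.mem_map.1 hcm
    rw [hlen] at hclt
    rw [hc.pivots, hg, List.map_map, zip_map_self]
    have hle' : ∀ b : Block K, g (b.items.take (liveLen P.D b.items)) ≤ liveLen P.D b.items :=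
      fun b => (hle _).trans_eq (hlen b)
    refine ⟨?_, sum_map_pos ?_ ⟨(b, _), List.mem_map_of_mem hbm, ?_⟩⟩
    · simp only [List.mem_map, forall_exists_index, and_imp, forall_apply_eq_imp_iff₂]
      exact fun b hbm => ⟨hc.tight b hbm, hc.act b hbm, hle' b⟩
    · simp only [List.mem_map, forall_exists_index, and_imp, forall_apply_eq_imp_iff₂]
      intro b hbm
      have := hle' b
      simp only [Function.comp]
      omega
    · simp only [Function.comp]
      omega
  refine wp_bind (wp_countLoop hk fun σ₁ n h₁ hn => ?_)
  split_ifs with hpos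
  · refine wp_randInt fun σ₂ r h₂ => ?_
    have h₁₂ := h₁.trans h₂
    refine wp_selectLoop (fun q hq => h₁₂.known (hk q hq)) fun σ₃ x h₃ hx hact =>
      hQ σ₃ x (h₁₂.trans h₃) hx fun hs hc => ?_
    obtain ⟨h1, h2⟩ := hclean hc
    refine hact hs (fun q hq => ⟨h₁₂.le.tight hs _ (hk q hq) (h1 q hq).1, (h1 q hq).2⟩)
      (by positivity) ?_
    rw [← hn hs fun q hq => (h1 q hq).1]
    have := r.2
    omega
  · refine wp_pure fun σ₂ h₂ => hQ σ₂ _ (h₁.trans h₂) (by simp) fun hs hc => ?_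
    obtain ⟨h1, h2⟩ := hclean hc
    rw [← hn hs fun q hq => (h1 q hq).1] at h2
    exact absurd h2 hpos

/-! ### The distributed LSM -/

theorem wp_writeSlot {i : ℕ} {b : Block K} {f : Unit → Prog K T β} {Q : β → St K T → Prop}
    (hb : Known σ b)
    (h : ∀ σ', Le P σ σ' → Keep t σ σ' → σ'.m.size t = σ.m.size t →
      σ'.m.slot t = Function.update (σ.m.slot t) i (some b) → wp P t (f ()) Q σ') :
    wp P t (writeSlot i b >>= f) Q σ := by
  refine wp_run (o := .writeSlot i b) (fun σ' hR => hR.known hb) fun σ' r σ'' hR he hL => ?_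
  obtain ⟨hm, hg⟩ := he
  dsimp only [Op.Exec] at hm
  refine h _ (hR.le.trans hL) (hR.keep.trans ⟨?_, ?_, ?_, ?_, ?_, ?_⟩) ?_ ?_ <;>
    simp [hm, hg, Op.ghost, hR.dist.size, hR.dist.slot]

theorem wp_writeSize {n : ℕ} {f : Unit → Prog K T β} {Q : β → St K T → Prop}
    (h : ∀ σ', Le P σ σ' → Keep t σ σ' → σ'.m.size t = n → σ'.m.slot t = σ.m.slot t →
      wp P t (f ()) Q σ') : wp P t (writeSize n >>= f) Q σ := by
  refine wp_run (o := .writeSize n) (fun _ _ => trivial) fun σ' r σ'' hR he hL => ?_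
  obtain ⟨hm, hg⟩ := he
  dsimp only [Op.Exec] at hm
  refine h _ (hR.le.trans hL) (hR.keep.trans ⟨?_, ?_, ?_, ?_, ?_, ?_⟩) ?_ ?_ <;>
    simp [hm, hg, Op.ghost, hR.dist.slot]

theorem wp_readSlots {n i : ℕ} {Q : List (Block K) → St K T → Prop}
    (hQ : ∀ σ' bs, Rely P t σ σ' → (∀ b ∈ bs, Known σ' b) →
      (∀ j, i ≤ j → j < i + n → ∀ b, σ.m.slot t j = some b → b ∈ bs) → Q bs σ') :
    wp P t (readSlots t n i) Q σ := by
  induction n generalizing σ i Q with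
  | zero => exact wp_pure fun σ₁ h₁ => hQ σ₁ _ h₁ (by simp) (fun j _ _ => by omega)
  | succ n ih =>
    refine wp_readSlot fun σ₁ h₁ => wp_bind (ih fun σ₂ tl h₂ htl hall => ?_)
    have key : ∀ j, i ≤ j → j < i + (n + 1) → ∀ b, σ.m.slot t j = some b →
        σ₁.m.slot t i = some b ∨ b ∈ tl := by
      intro j h1 h2 b hb
      rw [← h₁.dist.slot] at hb
      rcases h1.eq_or_lt with rfl | h1
      · exact Or.inl hb
      · exact Or.inr (hall j (by omega) (by omega) b hb)
    split
    · rename_i hs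
      refine wp_pure fun σ₃ h₃ => hQ σ₃ _ (h₁.trans (h₂.trans h₃)) (h₃.known_all htl) ?_
      intro j h1 h2 b hb
      rcases key j h1 h2 b hb with h | h
      · rw [hs] at h; cases h
      · exact h
    · rename_i c hs
      refine wp_pure fun σ₃ h₃ => hQ σ₃ _ (h₁.trans (h₂.trans h₃)) ?_ ?_
      · simp only [List.mem_cons, forall_eq_or_imp]
        exact ⟨(h₂.trans h₃).known (h₁.inv.good.slot_known t i c hs), h₃.known_all htl⟩
      · intro j h1 h2 b hb
        rcases key j h1 h2 b hb with h | h
        · rw [hs] at h; cases h; exact List.mem_cons_self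
        · exact List.mem_cons_of_mem _ h

theorem wp_writeSlots {bs : List (Block K)} {i : ℕ} {Q : Unit → St K T → Prop}
    (hb : ∀ b ∈ bs, Known σ b)
    (hQ : ∀ σ', Le P σ σ' → Keep t σ σ' → Q () σ') : wp P t (writeSlots bs i) Q σ := by
  induction bs generalizing σ i Q with
  | nil => exact wp_pure fun σ₁ h₁ => hQ σ₁ h₁.le h₁.keep
  | cons b rest ih =>
    simp only [List.mem_cons, forall_eq_or_imp] at hb
    refine wp_writeSlot hb.1 fun σ₁ h₁ hk₁ _ _ => ?_
    exact ih (fun c hc => h₁.mono.blk c (hb.2 c hc)) fun σ₂ h₂ hk₂ =>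
      hQ σ₂ (h₁.trans h₂) (hk₁.trans hk₂)

/-- The first block of the distributed LSM contains an item that is not in `D`. -/
def FirstAct (D : Set ℕ) (t : Fin T) (σ : St K T) : Prop :=
  σ.m.size t ≠ 0 ∧ ∃ c, σ.m.slot t 0 = some c ∧ Act D c.items

/-- The last conclusion is for the round after a successful spying: the active item in slot `0`
survives consolidation, so the own array does not become empty. -/
theorem wp_distConsolidate {Q : List (Block K) → St K T → Prop}
    (hQ : ∀ σ' bs, Le P σ σ' → Keep t σ σ' → (∀ b ∈ bs, Known σ' b) →
      (P.st → ∀ b ∈ bs, Tight P.D σ' b ∧ Act P.D b.items) → σ'.m.size t = bs.length →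
      (P.st → FirstAct P.D t σ → bs ≠ []) → Q bs σ') :
    wp P t (distConsolidate t) Q σ := by
  refine wp_readSize fun σ₁ h₁ => ?_
  rw [h₁.dist.size]
  refine wp_bind (wp_readSlots fun σ₂ old h₂ hold hall => ?_)
  refine wp_bind (wp_consolidatePass hold fun σ₃ r h₃ hr ht _ _ hact => ?_)
  refine wp_bind (wp_dropEmpty hr ht fun σ₄ bs h₄ hbs ha _ hne => ?_)
  have h14 := h₁.trans (h₂.trans (h₃.trans h₄))
  have hk₄ : ∀ b ∈ bs, Known σ₄ b := fun b hb => h₄.known (hr b (hbs b hb))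
  have ht₄ : P.st → ∀ b ∈ bs, Tight P.D σ₄ b := fun hs b hb =>
    h₄.tight_all hr ht hs b (hbs b hb)
  refine wp_bind (wp_writeSlots hk₄ fun σ₅ h₅ hk₅ => ?_)
  refine wp_writeSize fun σ₆ h₆ hk₆ hsz _ => wp_pure fun σ₇ h₇ => ?_
  have h47 := h₅.trans (h₆.trans h₇.le)
  refine hQ σ₇ bs (h14.le.trans h47) (h14.keep.trans (hk₅.trans (hk₆.trans h₇.keep)))
    (fun b hb => h47.mono.blk b (hk₄ b hb))
    (fun hs b hb => ⟨h47.tight hs b (hk₄ b hb) (ht₄ hs b hb), ha hs b hb⟩)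
    (h₇.dist.size.trans hsz) fun hs hf => hne hs (hact hs ?_)
  obtain ⟨h0, c, hc, hca⟩ := hf
  exact ⟨c, hall 0 le_rfl (by omega) c (by rw [h₁.dist.slot]; exact hc), hca⟩

theorem minItem_act {D : Set ℕ} {x y : Option (Item K)} (hx : ∀ i, x = some i → i.addr ∉ D)
    (hy : ∀ i, y = some i → i.addr ∉ D) (h : x ≠ none ∨ y ≠ none) :
    ∃ i, minItem x y = some i ∧ i.addr ∉ D := by
  cases x <;> cases y <;> simp [minItem] at *
  · exact hy
  · exact hx
  · split_ifs
    · exact ⟨_, rfl, hy⟩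
    · exact ⟨_, rfl, hx⟩

theorem minItem_cases (x y : Option (Item K)) : minItem x y = x ∨ minItem x y = y := by
  cases x <;> cases y <;> simp only [minItem, true_or, or_true]
  split_ifs <;> simp

theorem wp_minLoop {bs : List (Block K)} {Q : Option (Item K) → St K T → Prop}
    (hb : ∀ b ∈ bs, Known σ b) (ht : P.st → ∀ b ∈ bs, Tight P.D σ b ∧ Act P.D b.items)
    (hQ : ∀ σ' x, Rely P t σ σ' → (∀ i, x = some i → i.addr < σ'.m.next) →
      (P.st → ∀ i, x = some i → i.addr ∉ P.D) → (P.st → (x = none ↔ bs = [])) → Q x σ') :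
    wp P t (minLoop bs) Q σ := by
  induction bs generalizing σ Q with
  | nil => exact wp_pure fun σ₁ h₁ => hQ σ₁ _ h₁ (by simp) (by simp) (by simp)
  | cons b rest ih =>
    simp only [List.mem_cons, forall_eq_or_imp] at hb ht
    refine wp_bind (wp_last hb.1 fun σ₁ x h₁ hx hxa => ?_)
    refine wp_bind (ih (h₁.known_all hb.2) (fun hs c hc =>
      ⟨h₁.le.tight hs c (hb.2 c hc) ((ht hs).2 c hc).1, ((ht hs).2 c hc).2⟩)
      fun σ₂ y h₂ hy hya _ => wp_pure fun σ₃ h₃ => ?_)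
    have key : P.st → ∃ i, minItem x y = some i ∧ i.addr ∉ P.D := by
      intro hs
      obtain ⟨i, rfl, hi⟩ := hxa hs (ht hs).1.1 (ht hs).1.2
      exact minItem_act (by simpa using hi) (hya hs) (by simp)
    refine hQ σ₃ _ (h₁.trans (h₂.trans h₃)) ?_ ?_ ?_
    · intro i hi
      rcases minItem_cases x y with h | h
      · exact (h₂.trans h₃).lt (hx i (h ▸ hi))
      · exact h₃.lt (hy i (h ▸ hi))
    · intro hs i hi
      obtain ⟨j, hj, hd⟩ := key hs
      rw [hj] at hi
      cases hi
      exact hd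
    · intro hs
      obtain ⟨j, hj, hd⟩ := key hs
      simp [hj]

theorem wp_distFindMin {Q : Option (Item K) → St K T → Prop}
    (hQ : ∀ σ' x, Le P σ σ' → Keep t σ σ' → (∀ i, x = some i → i.addr < σ'.m.next) →
      (P.st → ∀ i, x = some i → i.addr ∉ P.D) → (P.st → x = none → σ'.m.size t = 0) →
      (P.st → FirstAct P.D t σ → x ≠ none) → Q x σ') :
    wp P t (distFindMin t) Q σ := by
  refine wp_bind (wp_distConsolidate fun σ₁ bs h₁ hk₁ hb ht hsz hf => ?_)
  refine wp_minLoop hb ht fun σ₂ x h₂ hx hxa hxn =>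
    hQ σ₂ x (h₁.trans h₂.le) (hk₁.trans h₂.keep) hx hxa ?_ ?_
  · intro hs h
    rw [h₂.dist.size, hsz, (hxn hs).1 h, List.length_nil]
  · intro hs h hn
    exact hf hs h ((hxn hs).1 hn)

theorem wp_mergeBack {n : ℕ} {b : Block K} {Q : ℕ × Block K → St K T → Prop}
    (hb : Known σ b) (hQ : ∀ σ' r, Rely P t σ σ' → Known σ' r.2 → Q r σ') :
    wp P t (mergeBack t n b) Q σ := by
  induction n generalizing σ b Q with
  | zero => exact wp_pure fun σ₁ h₁ => hQ σ₁ _ h₁ (h₁.known hb)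
  | succ n ih =>
    refine wp_readSlot fun σ₁ h₁ => ?_
    split
    · exact wp_pure fun σ₂ h₂ => hQ σ₂ _ (h₁.trans h₂) ((h₁.trans h₂).known hb)
    · rename_i c hs
      split_ifs
      · refine wp_bind (wp_mergeBlocks h₁.inv (h₁.inv.good.slot_known t n c hs) (h₁.known hb)
          fun σ₂ d h₂ hd _ => wp_bind (wp_shrink hd fun σ₃ d' h₃ hd' _ _ => ?_))
        exact ih hd' fun σ₄ r h₄ hr => hQ σ₄ r (h₁.trans (h₂.trans (h₃.trans h₄))) hr
      · exact wp_pure fun σ₂ h₂ => hQ σ₂ _ (h₁.trans h₂) ((h₁.trans h₂).known hb)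

/-- Spying keeps an empty distributed LSM, or makes its first block contain an active item. -/
structure SpyRel (P : Mode) (t : Fin T) (σ σ' : St K T) : Prop where
  le : Le P σ σ'
  keep : Keep t σ σ'
  size : σ'.m.size t = 0 → σ.m.size t = 0
  act : (σ.m.size t = 0 ∨ FirstAct P.D t σ) → (σ'.m.size t = 0 ∨ FirstAct P.D t σ')

theorem Rely.spyRel {σ' : St K T} (h : Rely P t σ σ') : SpyRel P t σ σ' :=
  ⟨h.le, h.keep, by rw [h.dist.size]; exact id,
    by rw [FirstAct, FirstAct, h.dist.size, h.dist.slot]; exact id⟩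

theorem SpyRel.trans {σ' σ'' : St K T} (h : SpyRel P t σ σ') (h' : SpyRel P t σ' σ'') :
    SpyRel P t σ σ'' :=
  ⟨h.le.trans h'.le, h.keep.trans h'.keep, fun hs => h.size (h'.size hs),
    fun hs => h'.act (h.act hs)⟩

/-- A kept copy is nonempty and free of items of `P.D`. If the own array was empty, the copy becomes
its first block; otherwise slot `0` is untouched. -/
theorem wp_spySlot {v : Fin T} {i : ℕ} {Q : Unit → St K T → Prop}
    (hQ : ∀ σ', SpyRel P t σ σ' → Q () σ') : wp P t (spySlot t v i) Q σ := by
  refine wp_readSlot fun σ₁ h₁ => ?_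
  split
  · exact wp_pure fun σ₂ h₂ => hQ σ₂ (h₁.trans h₂).spyRel
  · rename_i b hb
    refine wp_readSize fun σ₂ h₂ => wp_readSlot fun σ₃ h₃ => ?_
    have h₂₃ := h₂.trans h₃
    have h₁₃ := h₁.trans h₂₃
    dsimp only
    split_ifs
    · refine wp_bind (wp_copy h₃.inv (h₂₃.known (h₁.inv.good.slot_known v i b hb))
        fun σ₄ c h₄ hc hca _ => ?_)
      have h₁₄ := h₁₃.trans h₄
      split_ifs with hne
      · exact wp_pure fun σ₅ h₅ => hQ σ₅ (h₁₄.trans h₅).spyRel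
      · refine wp_writeSlot hc fun σ₅ h₅ hk₅ hsz₅ hsl₅ => ?_
        rw [← bind_pure' (writeSize _)]
        refine wp_writeSize fun σ₆ h₆ hk₆ hsz₆ hsl₆ => wp_pure fun σ₇ h₇ => hQ σ₇ ?_
        refine ⟨h₁₄.le.trans (h₅.trans (h₆.trans h₇.le)),
          h₁₄.keep.trans (hk₅.trans (hk₆.trans h₇.keep)), ?_, ?_⟩
        · rw [h₇.dist.size, hsz₆]
          omega
        · intro h
          right
          rw [FirstAct, h₇.dist.size, hsz₆, h₇.dist.slot, hsl₆, hsl₅, h₁₄.dist.slot,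
            (h₁.trans h₂).dist.size]
          refine ⟨by omega, ?_⟩
          rcases h with h | ⟨h0, h⟩
          · rw [h]
            obtain ⟨x, hx⟩ := List.exists_mem_of_ne_nil _ hne
            exact ⟨c, by simp, x, hx, hca x hx⟩
          -- The write goes to slot `size`, which differs from slot `0` as the size is not zero.
          · rw [Function.update_of_ne (Ne.symm h0)]
            exact h
    · exact wp_pure fun σ₄ h₄ => hQ σ₄ (h₁₃.trans h₄).spyRel

theorem wp_spyLoop {v : Fin T} {n i : ℕ} {Q : Unit → St K T → Prop}
    (hQ : ∀ σ', SpyRel P t σ σ' → Q () σ') : wp P t (spyLoop t v n i) Q σ := by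
  induction n generalizing σ i Q with
  | zero => exact wp_pure fun σ₁ h₁ => hQ σ₁ h₁.spyRel
  | succ n ih =>
    refine wp_readSize fun σ₁ h₁ => ?_
    split_ifs
    · exact wp_bind (wp_spySlot fun σ₂ h₂ => ih fun σ₃ h₃ =>
        hQ σ₃ (h₁.spyRel.trans (h₂.trans h₃)))
    · exact wp_pure fun σ₂ h₂ => hQ σ₂ (h₁.trans h₂).spyRel

theorem wp_spy {k : ℕ} {v : Fin T} {Q : Bool → St K T → Prop}
    (hQ : ∀ σ', SpyRel P t σ σ' → Q (decide (σ'.m.size t ≠ 0)) σ') :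
    wp P t (spy k t v) Q σ := by
  refine wp_bind (wp_spyLoop fun σ₁ h₁ => wp_readSize fun σ₂ h₂ => wp_pure fun σ₃ h₃ => ?_)
  rw [← h₃.dist.size]
  exact hQ σ₃ (h₁.trans (h₂.trans h₃).spyRel)

end Logic

end KLSM

/-! ### The shared snapshot, ranks, and the code at each place -/

namespace KLSM

section Logic

variable {K : Type} [LinearOrder K] {T : ℕ}
variable {P : Mode} {t : Fin T} {α β : Type} {σ : St K T}

/-! ### The snapshot of the shared array -/

/-- Progress of the state that does not end the operation of `t`. -/
structure Rel (P : Mode) (t : Fin T) (σ σ' : St K T) : Prop where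
  le : Le P σ σ'
  done : σ'.g.done t = σ.g.done t
  saw : σ.g.saw t → σ'.g.saw t

/-- The thread-local part of the shared `k`-LSM is unchanged. -/
structure KeepSnap (t : Fin T) (σ σ' : St K T) : Prop where
  observed : σ'.m.observed t = σ.m.observed t
  snapshot : σ'.m.snapshot t = σ.m.snapshot t
  own : ∀ x, σ.g.own x = some t → σ'.g.own x = some t

theorem Rel.trans {σ' σ'' : St K T} (h : Rel P t σ σ') (h' : Rel P t σ' σ'') : Rel P t σ σ'' :=
  ⟨h.le.trans h'.le, h'.done.trans h.done, fun hs => h'.saw (h.saw hs)⟩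

theorem KeepSnap.trans {σ' σ'' : St K T} (h : KeepSnap t σ σ') (h' : KeepSnap t σ' σ'') :
    KeepSnap t σ σ'' :=
  ⟨h'.observed.trans h.observed, h'.snapshot.trans h.snapshot, fun x hx => h'.own x (h.own x hx)⟩

theorem Keep.keepSnap {σ' : St K T} (h : Keep t σ σ') : KeepSnap t σ σ' :=
  ⟨h.observed, h.snapshot, fun x => (h.own x).1⟩

theorem Keep.rel {σ' : St K T} (h : Keep t σ σ') (hL : Le P σ σ') : Rel P t σ σ' :=
  ⟨hL, h.done, fun hs => h.saw ▸ hs⟩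

theorem Rely.rel {σ' : St K T} (h : Rely P t σ σ') : Rel P t σ σ' := h.keep.rel h.le

theorem Rely.snap {σ' : St K T} (h : Rely P t σ σ') : KeepSnap t σ σ' := h.keep.keepSnap

/-- The relation between the observed array and the snapshot while no insertion is in progress. -/
structure Snap (t : Fin T) (σ : St K T) : Prop where
  length_le : ∀ s, σ.m.snapshot t = some s →
    ∃ o, σ.m.observed t = some o ∧ s.blocks.length ≤ o.blocks.length
  known : ∀ s, σ.m.snapshot t = some s → ∀ b ∈ s.blocks, Known σ b
  lt : ∀ o, σ.m.observed t = some o → o.addr < σ.m.next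
  own : ∀ o, σ.m.observed t = some o → σ.g.own o.addr = none
  fresh : ∀ o, σ.m.observed t = some o → σ.m.shared ≠ some o ∨
    ∃ s, σ.m.snapshot t = some s ∧ σ.g.own s.addr = some t

theorem Snap.keep {σ' : St K T} (h : Snap t σ) (hL : Le P σ σ') (hk : KeepSnap t σ σ') :
    Snap t σ' where
  length_le := by rw [hk.snapshot, hk.observed]; exact h.length_le
  known := by
    rw [hk.snapshot]
    exact fun s hs b hb => hL.mono.blk b (h.known s hs b hb)
  lt := by
    rw [hk.observed]
    exact fun o ho => (h.lt o ho).trans_le hL.mono.next_le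
  own := by
    rw [hk.observed]
    exact fun o ho => hL.mono.own _ (h.lt o ho) (h.own o ho)
  fresh := by
    rw [hk.observed, hk.snapshot]
    intro o ho
    rcases h.fresh o ho with hf | ⟨s, hs, hso⟩
    · exact Or.inl (hL.mono.shared o (h.lt o ho) (h.own o ho) hf)
    · exact Or.inr ⟨s, hs, hk.own _ hso⟩

theorem wp_readShared {f : Option (BlockArray K) → Prog K T β} {Q : β → St K T → Prop}
    (h : ∀ σ', Rel P t σ σ' → KeepSnap t σ σ' → KeepDist t σ σ' →
      (σ'.m.shared = none → σ'.m.size t = 0 → σ'.g.saw t) → wp P t (f σ'.m.shared) Q σ') :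
    wp P t (readShared >>= f) Q σ := by
  refine wp_run (o := .readShared) (fun _ _ => trivial) fun σ' r σ'' hR he hL => ?_
  obtain ⟨⟨rfl, hm⟩, hg⟩ := he
  rw [← hm]
  refine h _ (hR.rel.trans ⟨hL, ?_, ?_⟩) (hR.snap.trans ⟨?_, ?_, ?_⟩) (hR.dist.trans ⟨?_, ?_⟩) ?_
  all_goals simp [hm, hg, Op.ghost] <;> tauto

theorem wp_setObserved {a : Option (BlockArray K)} {f : Unit → Prog K T β}
    {Q : β → St K T → Prop}
    (h : ∀ σ', Rel P t σ σ' → σ'.m.observed t = a → σ'.m.snapshot t = σ.m.snapshot t →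
      KeepDist t σ σ' → wp P t (f ()) Q σ') :
    wp P t (setObserved a >>= f) Q σ := by
  refine wp_run (o := .setObserved a) (fun _ _ => trivial) fun σ' r σ'' hR he hL => ?_
  obtain ⟨hm, hg⟩ := he
  dsimp only [Op.Exec] at hm
  refine h _ (hR.rel.trans ⟨hL, ?_, ?_⟩) ?_ ?_ (hR.dist.trans ⟨?_, ?_⟩)
  all_goals simp [hm, hg, Op.ghost, hR.keep.snapshot]

theorem wp_setSnapshot {a : Option (BlockArray K)} {f : Unit → Prog K T β}
    {Q : β → St K T → Prop}
    (h : ∀ σ', Rel P t σ σ' → σ'.m.observed t = σ.m.observed t → σ'.m.snapshot t = a →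
      (∀ x, σ.g.own x = some t → σ'.g.own x = some t) → KeepDist t σ σ' → wp P t (f ()) Q σ') :
    wp P t (setSnapshot a >>= f) Q σ := by
  refine wp_run (o := .setSnapshot a) (fun _ _ => trivial) fun σ' r σ'' hR he hL => ?_
  obtain ⟨hm, hg⟩ := he
  dsimp only [Op.Exec] at hm
  refine h _ (hR.rel.trans ⟨hL, ?_, ?_⟩) ?_ ?_ (fun x hx => ?_) (hR.dist.trans ⟨?_, ?_⟩)
  case refine_5 =>
    rw [hg]
    exact hR.snap.own x hx
  all_goals simp [hm, hg, Op.ghost, hR.keep.observed]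

theorem wp_copyBlockArray {a : BlockArray K} {f : BlockArray K → Prog K T β}
    {Q : β → St K T → Prop}
    (h : ∀ σ' c, Rel P t σ σ' → σ'.m.observed t = σ.m.observed t → KeepDist t σ σ' →
      c.blocks = a.blocks → σ'.g.own c.addr = some t → wp P t (f c) Q σ') :
    wp P t (copyBlockArray a >>= f) Q σ := by
  refine wp_run (o := .copyBlockArray a) (fun _ _ => trivial) fun σ' r σ'' hR he hL => ?_
  obtain ⟨⟨rfl, hm⟩, hg⟩ := he
  refine h _ _ (hR.rel.trans ⟨hL, ?_, ?_⟩) ?_ (hR.dist.trans ⟨?_, ?_⟩) rfl ?_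
  all_goals simp [hm, hg, Op.ghost, hR.keep.observed]

theorem wp_newBlockArray {f : BlockArray K → Prog K T β} {Q : β → St K T → Prop}
    (h : ∀ σ' c, Rel P t σ σ' → σ'.m.observed t = σ.m.observed t →
      c.blocks = [] → σ'.g.own c.addr = some t → wp P t (f c) Q σ') :
    wp P t (newBlockArray >>= f) Q σ := by
  refine wp_run (o := .newBlockArray) (fun _ _ => trivial) fun σ' r σ'' hR he hL => ?_
  obtain ⟨⟨rfl, hm⟩, hg⟩ := he
  refine h _ _ (hR.rel.trans ⟨hL, ?_, ?_⟩) ?_ rfl ?_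
  all_goals simp [hm, hg, Op.ghost, hR.keep.observed]

/-- The observed array is taken from `shared`, hence has no owner, whereas the private copy has a
fresh address owned by `t`. A null snapshot means that the read returned null, the moment recorded
in `saw`. -/
theorem wp_refreshSnapshot {Q : Unit → St K T → Prop}
    (hQ : ∀ σ', Rel P t σ σ' → KeepDist t σ σ' → Snap t σ' →
      (σ'.m.snapshot t = none → σ'.m.size t = 0 → σ'.g.saw t) →
      (P.st → σ'.m.observed t = σ'.m.shared) →
      (∀ s, σ'.m.snapshot t = some s → σ'.g.own s.addr = some t) → Q () σ') :
    wp P t refreshSnapshot Q σ := by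
  refine wp_readShared fun σ₁ h₁ _ hd₁ hsaw => ?_
  refine wp_setObserved fun σ₂ h₂ ho₂ _ hd₂ => ?_
  have h₁₂ := h₁.trans h₂
  have hlt : ∀ o, σ₂.m.observed t = some o → o.addr < σ₂.m.next ∧ σ₂.g.own o.addr = none := by
    intro o ho
    rw [ho₂] at ho
    have := h₁.le.inv.good.shared_lt o ho
    exact ⟨this.trans_le h₂.le.mono.next_le,
      h₂.le.mono.own _ this (h₁.le.inv.good.shared_own o ho)⟩
  split
  · rename_i hs
    rw [← bind_pure' (setSnapshot none)]
    refine wp_setSnapshot fun σ₃ h₃ ho₃ hs₃ _ hd₃ => wp_pure fun σ₄ h₄ => ?_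
    have h₃₄ := h₃.trans h₄.rel
    have ho : σ₄.m.observed t = none := by rw [h₄.keep.observed, ho₃, ho₂, hs]
    have hn : σ₄.m.snapshot t = none := by rw [h₄.keep.snapshot, hs₃]
    have hd₂₄ := hd₂.trans (hd₃.trans h₄.dist)
    refine hQ σ₄ (h₁₂.trans h₃₄) (hd₁.trans hd₂₄)
      ⟨by simp [hn], by simp [hn], by simp [ho], by simp [ho], by simp [ho]⟩ ?_ ?_
      (by simp [hn])
    · intro _ hz
      rw [hd₂₄.size] at hz
      exact (h₂.trans h₃₄).saw (hsaw hs hz)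
    · intro hst
      rw [ho, (h₂.trans h₃₄).le.shared hst, hs]
  · rename_i a hs
    refine wp_copyBlockArray fun σ₃ c h₃ ho₃ hd₃ hc hown => ?_
    rw [← bind_pure' (setSnapshot _)]
    refine wp_setSnapshot fun σ₄ h₄ ho₄ hs₄ hown₄ hd₄ => wp_pure fun σ₅ h₅ => ?_
    have h₃₅ := h₄.trans h₅.rel
    have h₂₅ := h₃.trans h₃₅
    have ho : σ₅.m.observed t = some a := by rw [h₅.keep.observed, ho₄, ho₃, ho₂, hs]
    have hn : σ₅.m.snapshot t = some c := by rw [h₅.keep.snapshot, hs₄]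
    obtain ⟨ha, hao⟩ := hlt a (ho₂.trans hs)
    refine hQ σ₅ (h₁₂.trans h₂₅) (hd₁.trans (hd₂.trans (hd₃.trans (hd₄.trans h₅.dist))))
      ⟨?_, ?_, ?_, ?_, ?_⟩ (by simp [hn]) ?_ ?_
    · intro s h
      rw [hn] at h
      cases h
      exact ⟨a, ho, by rw [hc]⟩
    · intro s h b hb
      rw [hn] at h
      cases h
      rw [hc] at hb
      exact (h₂.trans h₂₅).le.mono.blk b (h₁.le.inv.good.shared_known a hs b hb)
    · rw [ho]
      rintro o ⟨⟩
      exact ha.trans_le h₂₅.le.mono.next_le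
    · rw [ho]
      rintro o ⟨⟩
      exact h₂₅.le.mono.own _ ha hao
    · exact fun o _ => Or.inr ⟨c, hn, h₅.snap.own _ (hown₄ _ hown)⟩
    · intro hst
      rw [ho, (h₂.trans h₂₅).le.shared hst, hs]
    · rw [hn]
      rintro s ⟨⟩
      exact h₅.snap.own _ (hown₄ _ hown)

/-- Whatever the outcome, a non-null observed array has left `shared` for good: either it was gone
already, or it has been replaced by null or by an array that `t` owned. The operation stays
undecided if the swap fails or shrinks the array. -/
theorem wp_pushSnapshot {Q : Bool → St K T → Prop} (hd : ¬ σ.g.done t)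
    (hlt : ∀ o, σ.m.observed t = some o → o.addr < σ.m.next)
    (hown : ∀ o, σ.m.observed t = some o → σ.g.own o.addr = none)
    (hp : ∀ σ', Rely P t σ σ' → σ'.m.shared = σ.m.observed t → ∀ s, σ.m.snapshot t = some s →
      σ'.g.own s.addr = some t ∧ ∀ b ∈ s.blocks, Known σ' b)
    (hQ : ∀ b σ', Le P σ σ' → σ'.m.observed t = σ.m.observed t →
      σ'.m.snapshot t = σ.m.snapshot t → KeepDist t σ σ' →
      (∀ o, σ.m.observed t = some o → σ'.m.shared ≠ some o) →
      ((b = true → arraySize (σ.m.snapshot t) < arraySize (σ.m.observed t)) → ¬ σ'.g.done t) →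
      Q b σ') : wp P t pushSnapshot Q σ := by
  refine wp_getObserved fun σ₁ h₁ => wp_getSnapshot fun σ₂ h₂ => ?_
  have h₁₂ := h₁.trans h₂
  rw [h₁.keep.snapshot, ← bind_pure' (casShared _ _)]
  refine wp_run (o := .casShared _ _) ?_ fun σ₃ r σ₄ h₃ he hL => ?_
  · intro σ' h'
    refine ⟨?_, fun hs => hp σ' (h₁₂.trans h') hs⟩
    rw [(h₁₂.trans h').keep.done]
    exact hd
  have h₁₃ := h₁₂.trans h₃
  obtain ⟨⟨rfl, hm⟩, hg⟩ := he
  have key : σ₄.m.observed t = σ.m.observed t ∧ σ₄.m.snapshot t = σ.m.snapshot t ∧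
      KeepDist t σ σ₄ := by
    refine ⟨?_, ?_, h₁₃.dist.trans ⟨?_, ?_⟩⟩ <;> rw [hm] <;> split_ifs <;>
      simp [h₁₃.keep.observed, h₁₃.keep.snapshot]
  refine wp_pure fun σ₅ h₅ => hQ _ σ₅ (h₁₃.le.trans (hL.trans h₅.le))
    (h₅.keep.observed.trans key.1) (h₅.keep.snapshot.trans key.2.1) (key.2.2.trans h₅.dist) ?_ ?_
  · intro o ho
    have h1 := (hlt o ho).trans_le h₁₃.le.mono.next_le
    have h2 := h₁₃.le.mono.own _ (hlt o ho) (hown o ho)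
    refine h₅.le.mono.shared o (h1.trans_le hL.mono.next_le) (hL.mono.own _ h1 h2) ?_
    rw [hm]
    split_ifs with hc
    -- If the swap had put back the observed array itself, this array would be both owned by `t` and
    -- without an owner.
    · intro hs
      have := (hp σ₃ h₁₃ hc o hs).1
      rw [h2] at this
      cases this
    · rw [← ho]
      exact hc
  · intro hlt'
    rw [h₅.keep.done, hg]
    simp only [Op.ghost]
    split_ifs with hc
    · simp only [Function.update_self, not_or, not_not]
      rw [h₁₃.keep.done]
      exact ⟨hd, hlt' (by simpa using hc)⟩
    · rw [h₁₃.keep.done]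
      exact hd

theorem wp_testAndSet {i : Item K} {f : Bool → Prog K T β} {Q : β → St K T → Prop}
    (hi : i.addr < σ.m.next) (hd : ¬ σ.g.done t)
    (h : ∀ b σ', Le P σ σ' → KeepSnap t σ σ' → σ'.m.flag i.addr = true →
      (b = true → σ'.g.won t = some i) → (b = false → ¬ σ'.g.done t) → wp P t (f b) Q σ') :
    wp P t (testAndSet i >>= f) Q σ := by
  refine wp_run (o := .testAndSet i)
    (fun σ' hR => ⟨hR.lt hi, by rw [hR.keep.done]; exact hd⟩) fun σ' r σ'' hR he hL => ?_
  obtain ⟨⟨rfl, hm⟩, hg⟩ := he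
  refine h _ _ (hR.le.trans hL) (hR.snap.trans ⟨?_, ?_, ?_⟩) ?_ ?_ ?_
  · simp [hm]
  · simp [hm]
  · intro x hx
    rw [hg]
    simp only [Op.ghost]
    split_ifs <;> exact hx
  · simp [hm]
  · intro hf
    have hf' : σ'.m.flag i.addr = false := by simpa using hf
    rw [hg]
    simp [Op.ghost, hf']
  · intro hf
    have hf' : σ'.m.flag i.addr = true := by simpa using hf
    rw [hg]
    simp [Op.ghost, hf', hR.keep.done, hd]

/-! ### Preconditions of the places in the code -/

/-- A pointer to an item is null, or the item has been allocated. -/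
def Valid (σ : St K T) (x : Option (Item K)) : Prop := ∀ i, x = some i → i.addr < σ.m.next

theorem Valid.of_le {σ' : St K T} {x : Option (Item K)} (h : Valid σ x) (hL : Le P σ σ') :
    Valid σ' x := fun i hi => (h i hi).trans_le hL.mono.next_le

/-- The precondition of a place in the code, in an execution of the operation `call`. -/
def Loc.Pre (t : Fin T) (call : Call K) : Loc K → St K T → Prop
  | .distFind, σ => call = .deleteMin ∧ Snap t σ ∧ ¬ σ.g.done t
  | .sharedFind item, σ => call = .deleteMin ∧ Snap t σ ∧ ¬ σ.g.done t ∧ Valid σ item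
  | .snapFind item a, σ => call = .deleteMin ∧ Snap t σ ∧ ¬ σ.g.done t ∧ Valid σ item ∧
      σ.m.snapshot t = some a
  | .snapCheck item a cand, σ => call = .deleteMin ∧ Snap t σ ∧ ¬ σ.g.done t ∧ Valid σ item ∧
      σ.m.snapshot t = some a ∧ Valid σ cand
  | .mark it, σ => call = .deleteMin ∧ Snap t σ ∧ ¬ σ.g.done t ∧ it.addr < σ.m.next
  -- The size is not tested before spying, so the evidence for an empty queue is conditional; it is
  -- used when the size is still zero after spying.
  | .spying, σ => call = .deleteMin ∧ Snap t σ ∧ ¬ σ.g.done t ∧ (σ.m.size t = 0 → σ.g.saw t)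
  | .insertItem _, σ => call ≠ .deleteMin ∧ Snap t σ ∧ ¬ σ.g.done t
  -- `Snap` is not required here: after a failed attempt the snapshot contains the inserted block
  -- and may be longer than the observed array. The loop starts with a refresh.
  | .publish b _, σ => call ≠ .deleteMin ∧ ¬ σ.g.done t ∧ Known σ b
  | .inserted, σ => call ≠ .deleteMin ∧ Snap t σ
  | .deleted (some i), σ => call = .deleteMin ∧ Snap t σ ∧ σ.g.won t = some i
  | .deleted none, σ => call = .deleteMin ∧ Snap t σ ∧ σ.g.saw t

/-- What is known about the result of `DistLSM::find_min`; the smaller `e`, the more. -/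
structure ItemOk (D : Set ℕ) (t : Fin T) (σ : St K T) (e : ℕ) (item : Option (Item K)) : Prop where
  act : e ≤ 1 → ∀ i, item = some i → i.addr ∉ D
  size : e ≤ 1 → item = none → σ.m.size t = 0
  ne : e = 0 → item ≠ none

theorem ItemOk.keep {D : Set ℕ} {σ' : St K T} {e : ℕ} {item : Option (Item K)}
    (h : ItemOk D t σ e item) (hd : KeepDist t σ σ') : ItemOk D t σ' e item :=
  ⟨h.act, by rw [hd.size]; exact h.size, h.ne⟩

theorem ItemOk.unknown {D : Set ℕ} {item : Option (Item K)} : ItemOk D t σ 2 item :=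
  ⟨by omega, by omega, by omega⟩

/-- In the stable regime, a place in the code of `delete_min` has a rank, which decreases from one
place to the next one. -/
inductive Rank (k : ℕ) (D : Set ℕ) (t : Fin T) (σ : St K T) : ℕ → Loc K → Prop where
  -- The number `e` counts the rounds that may follow. For `e = 2` the local values predate the
  -- stable regime; for `e = 1` the result of the own search is reliable; for `e = 0` it is not
  -- null, because spying has delivered an active item. One round descends from offset 11 to offset
  -- 1, with two visits to the search of the snapshot, before and after its cleanup. The `First`
  -- places have offsets 10 and 9 of `e = 2`, as their snapshot may be outdated.
  | distFind (e : ℕ) (he : e ≤ 1) (h : e = 0 → FirstAct D t σ) : Rank k D t σ (12 * e + 11) .distFind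
  | sharedFind (e : ℕ) (item : Option (Item K)) (h : ItemOk D t σ e item) :
      Rank k D t σ (12 * e + 8) (.sharedFind item)
  | sharedFindClean (e : ℕ) (item : Option (Item K)) (h : ItemOk D t σ e item)
      (ho : σ.m.observed t = σ.m.shared) (hc : ∀ a, σ.m.snapshot t = some a → Clean k D σ a) :
      Rank k D t σ (12 * e + 5) (.sharedFind item)
  | snapFindFirst (item : Option (Item K)) (a : BlockArray K) : Rank k D t σ 34 (.snapFind item a)
  | snapFind (e : ℕ) (item : Option (Item K)) (a : BlockArray K) (h : ItemOk D t σ e item)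
      (ho : σ.m.observed t = σ.m.shared) : Rank k D t σ (12 * e + 7) (.snapFind item a)
  | snapFindClean (e : ℕ) (item : Option (Item K)) (a : BlockArray K) (h : ItemOk D t σ e item)
      (hc : Clean k D σ a) : Rank k D t σ (12 * e + 4) (.snapFind item a)
  | snapCheckFirst (item : Option (Item K)) (a : BlockArray K) (c : Option (Item K)) :
      Rank k D t σ 33 (.snapCheck item a c)
  | snapCheck (e : ℕ) (item : Option (Item K)) (a : BlockArray K) (c : Option (Item K))
      (h : ItemOk D t σ e item) (ho : σ.m.observed t = σ.m.shared) :
      Rank k D t σ (12 * e + 6) (.snapCheck item a c)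
  | snapCheckClean (e : ℕ) (item : Option (Item K)) (a : BlockArray K) (i : Item K)
      (h : ItemOk D t σ e item) (hi : i.addr ∉ D) :
      Rank k D t σ (12 * e + 3) (.snapCheck item a (some i))
  | mark (e : ℕ) (i : Item K) (h : e ≤ 1 → i.addr ∉ D) : Rank k D t σ (12 * e + 2) (.mark i)
  | spying (e : ℕ) (he : e ≠ 0) (h : e ≤ 1 → σ.m.size t = 0) :
      Rank k D t σ (12 * e + 1) .spying
  | deleted (x : Option (Item K)) : Rank k D t σ 0 (.deleted x)

/-- The postcondition of the code at a place of rank `r`. -/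
def Post (k : ℕ) (P : Mode) (t : Fin T) (call : Call K) (r : ℕ) (l : Loc K) (σ : St K T) : Prop :=
  l.Pre t call σ ∧ (P.st → ∃ r' < r, Rank k P.D t σ r' l)

/-- Spying needs both results to be null, which is impossible for `e = 0`. For `e ≤ 1` neither
result is dead, so the chosen item is active. -/
theorem post_afterFind {k r e : ℕ} {item tmp : Option (Item K)} {call : Call K}
    (hc : call = .deleteMin) (hsn : Snap t σ) (hd : ¬ σ.g.done t) (hv : Valid σ item)
    (hv' : Valid σ tmp)
    (hsaw : item = none → tmp = none → σ.m.size t = 0 → σ.g.saw t)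
    (he : P.st → 12 * e + 2 < r)
    (hi : P.st → ItemOk P.D t σ e item)
    (ht : P.st → e ≤ 1 → ∀ i, tmp = some i → i.addr ∉ P.D) :
    Post k P t call r (afterFind item tmp) σ := by
  unfold afterFind
  split
  · rename_i hm
    have hn : item = none ∧ tmp = none := by
      cases item <;> cases tmp <;> simp [minItem] at hm ⊢
      split_ifs at hm
    refine ⟨⟨hc, hsn, hd, hsaw hn.1 hn.2⟩, fun hs => ⟨12 * e + 1, by have := he hs; omega,
      .spying e (fun h0 => (hi hs).ne h0 hn.1) (fun h1 => (hi hs).size h1 hn.1)⟩⟩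
  · rename_i it hm
    refine ⟨⟨hc, hsn, hd, ?_⟩, fun hs => ⟨12 * e + 2, he hs, .mark e it fun h1 => ?_⟩⟩
    · rcases minItem_cases item tmp with h | h
      · exact hv it (h ▸ hm)
      · exact hv' it (h ▸ hm)
    · rcases minItem_cases item tmp with h | h
      · exact (hi hs).act h1 it (h ▸ hm)
      · exact ht hs h1 it (h ▸ hm)

/-! ### The code at the places -/

theorem wp_code_distFind {k r : ℕ} {call : Call K} (hp : Loc.Pre t call .distFind σ)
    (hr : P.st → Rank k P.D t σ r .distFind) :
    wp P t (code k t .distFind) (Post k P t call r) σ := by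
  obtain ⟨hc, hsn, hd⟩ := hp
  refine wp_bind (wp_distFindMin fun σ₁ x h₁ hk₁ hx hxa hxn hxf => wp_pure fun σ₂ h₂ => ?_)
  have h₁₂ := h₁.trans h₂.le
  have hk₁₂ := hk₁.trans h₂.keep
  refine ⟨⟨hc, hsn.keep h₁₂ hk₁₂.keepSnap, by rw [hk₁₂.done]; exact hd,
    Valid.of_le hx h₂.le⟩, fun hs => ?_⟩
  cases hr hs with
  | distFind e he hf =>
    refine ⟨12 * e + 8, by omega, .sharedFind e x ⟨fun _ => hxa hs, fun _ hn => ?_, fun h0 => ?_⟩⟩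
    · rw [h₂.dist.size]
      exact hxn hs hn
    · exact hxf hs (hf h0)

/-- Two points matter: a null snapshot comes with a read of `shared` that gave null, and a snapshot
cleaned in the stable regime is not thrown away when `observed` agrees with `shared`. -/
theorem wp_code_sharedFind {k r : ℕ} {call : Call K} {item : Option (Item K)}
    (hp : Loc.Pre t call (.sharedFind item) σ) (hr : P.st → Rank k P.D t σ r (.sharedFind item)) :
    wp P t (code k t (.sharedFind item)) (Post k P t call r) σ := by
  obtain ⟨hc, hsn, hd, hv⟩ := hp
  have main : ∀ σ₁, Rel P t σ σ₁ → KeepDist t σ σ₁ → Snap t σ₁ →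
      (σ₁.m.snapshot t = none → σ₁.m.size t = 0 → σ₁.g.saw t) →
      (P.st → σ₁.m.observed t = σ₁.m.shared) →
      (P.st → σ.m.observed t = σ.m.shared → σ₁.m.snapshot t = σ.m.snapshot t) →
      wp P t (do
        let snap ← getSnapshot
        match snap with
        | none => pure (afterFind item none)
        | some a => pure (.snapFind item a)) (Post k P t call r) σ₁ := by
    intro σ₁ h₁ hd₁ hsn₁ hsaw hobs hsame
    refine wp_getSnapshot fun σ₂ h₂ => ?_
    split
    · rename_i hn
      refine wp_pure fun σ₃ h₃ => ?_
      have h₁₃ := h₂.trans h₃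
      have h03 := h₁.trans h₁₃.rel
      have hsaw' : σ₃.m.size t = 0 → σ₃.g.saw t := by
        rw [h₁₃.dist.size, h₁₃.keep.saw]
        exact hsaw hn
      have hd' : ¬ σ₃.g.done t := by rw [h03.done]; exact hd
      by_cases hs : P.st
      · cases hr hs with
        | sharedFind e _ h =>
          exact post_afterFind (e := e) hc (hsn₁.keep h₁₃.le h₁₃.snap) hd' (hv.of_le h03.le)
            (by simp [Valid]) (fun _ _ => hsaw') (fun _ => by omega)
            (fun _ => h.keep (hd₁.trans h₁₃.dist)) (by simp)
        | sharedFindClean e _ h =>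
          exact post_afterFind (e := e) hc (hsn₁.keep h₁₃.le h₁₃.snap) hd' (hv.of_le h03.le)
            (by simp [Valid]) (fun _ _ => hsaw') (fun _ => by omega)
            (fun _ => h.keep (hd₁.trans h₁₃.dist)) (by simp)
      · exact post_afterFind (e := 0) hc (hsn₁.keep h₁₃.le h₁₃.snap) hd' (hv.of_le h03.le)
          (by simp [Valid]) (fun _ _ => hsaw') (by simp [hs]) (by simp [hs]) (by simp)
    · rename_i a ha
      refine wp_pure fun σ₃ h₃ => ?_
      have h₁₃ := h₂.trans h₃
      have h03 := h₁.trans h₁₃.rel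
      refine ⟨⟨hc, hsn₁.keep h₁₃.le h₁₃.snap, by rw [h03.done]; exact hd, hv.of_le h03.le,
        by rw [h₁₃.keep.snapshot]; exact ha⟩, fun hs => ?_⟩
      cases hr hs with
      | sharedFind e _ h =>
        refine ⟨12 * e + 7, by omega, .snapFind e _ _ (h.keep (hd₁.trans h₁₃.dist)) ?_⟩
        rw [h₁₃.keep.observed, h₁₃.le.shared hs]
        exact hobs hs
      | sharedFindClean e _ h ho hcl =>
        refine ⟨12 * e + 4, by omega, .snapFindClean e _ _ (h.keep (hd₁.trans h₁₃.dist)) ?_⟩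
        exact (hcl a ((hsame hs ho).symm.trans ha)).of_le h03.le hs
  refine wp_readShared fun σ₁ h₁ hk₁ hd₁ hsaw => wp_getObserved fun σ₂ h₂ => ?_
  have h₁₂ := h₁.trans h₂.rel
  have hd₁₂ := hd₁.trans h₂.dist
  dsimp only
  split_ifs with hso
  · refine wp_bind (wp_refreshSnapshot fun σ₃ h₃ hd₃ hsn₃ hsaw₃ ho₃ _ => ?_)
    refine main σ₃ (h₁₂.trans h₃) (hd₁₂.trans hd₃) hsn₃ hsaw₃ ho₃ fun hs ho => ?_
    -- In the stable regime, agreement of `observed` and `shared` at the start rules out this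
    -- refresh.
    exact absurd (by rw [h₁.le.shared hs, hk₁.observed]; exact ho.symm) hso
  · have hso' : σ₁.m.shared = σ₁.m.observed t := not_not.1 hso
    have hsn₁ := hsn.keep h₁.le hk₁
    refine main σ₂ h₁₂ hd₁₂ (hsn₁.keep h₂.le h₂.snap) ?_ ?_ ?_
    · rw [h₂.keep.snapshot, h₂.dist.size, h₂.keep.saw]
      intro hn
      refine hsaw ?_
      cases ho : σ₁.m.observed t with
      | none => rw [hso', ho]
      -- A null snapshot of a non-null observed array arises only from emptying it, after which that
      -- array is no longer in `shared`; this contradicts the comparison just made.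
      | some o =>
        rcases hsn₁.fresh o ho with h | ⟨s, h, -⟩
        · exact absurd (hso'.trans ho) h
        · rw [hn] at h
          cases h
    · intro hs
      rw [h₂.keep.observed, h₂.le.shared hs, hso']
    · intro _ _
      rw [h₂.keep.snapshot, hk₁.snapshot]

theorem wp_code_snapFind {k r : ℕ} {call : Call K} {item : Option (Item K)} {a : BlockArray K}
    (hp : Loc.Pre t call (.snapFind item a) σ) (hr : P.st → Rank k P.D t σ r (.snapFind item a)) :
    wp P t (code k t (.snapFind item a)) (Post k P t call r) σ := by
  obtain ⟨hc, hsn, hd, hv, ha⟩ := hp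
  refine wp_bind (wp_findMin (k := k) (hsn.known a ha) fun σ₁ x h₁ hx hact => wp_pure fun σ₂ h₂ => ?_)
  have h₁₂ := h₁.trans h₂
  refine ⟨⟨hc, hsn.keep h₁₂.le h₁₂.snap, by rw [h₁₂.keep.done]; exact hd, hv.of_le h₁₂.le,
    by rw [h₁₂.keep.snapshot]; exact ha, Valid.of_le hx h₂.le⟩, fun hs => ?_⟩
  cases hr hs with
  | snapFindFirst => exact ⟨33, by omega, .snapCheckFirst _ _ _⟩
  | snapFind e _ _ h ho =>
    refine ⟨12 * e + 6, by omega, .snapCheck e _ _ _ (h.keep h₁₂.dist) ?_⟩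
    rw [h₁₂.keep.observed, h₁₂.le.shared hs, ho]
  | snapFindClean e _ _ h hcl =>
    obtain ⟨i, rfl, hi⟩ := hact hs hcl
    exact ⟨12 * e + 3, by omega, .snapCheckClean e _ _ _ (h.keep h₁₂.dist) hi⟩

/-- The part of `SharedKLSM::find_min` that is executed when no active item has been found. -/
theorem wp_cleanup {k r : ℕ} {call : Call K} {item : Option (Item K)} {a : BlockArray K}
    (hc : call = .deleteMin) (hsn : Snap t σ) (hd : ¬ σ.g.done t) (hv : Valid σ item)
    (ha : σ.m.snapshot t = some a)
    (hr : P.st → r = 33 ∨ ∃ e, r = 12 * e + 6 ∧ ItemOk P.D t σ e item ∧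
      σ.m.observed t = σ.m.shared) :
    wp P t (do
      let r ← a.consolidate k
      if r.1.blocks = [] then do
        setSnapshot none
        let _ ← pushSnapshot
        pure (.sharedFind item)
      else do
        setSnapshot (some r.1)
        if r.2 then do
          let _ ← pushSnapshot
          pure (.sharedFind item)
        else pure (.sharedFind item)) (Post k P t call r) σ := by
  have fin : ∀ σ₁, Le P σ σ₁ → KeepDist t σ σ₁ → Snap t σ₁ → ¬ σ₁.g.done t →
      σ₁.m.observed t = σ.m.observed t →
      (P.st → ∀ s, σ₁.m.snapshot t = some s → Clean k P.D σ₁ s) →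
      Post k P t call r (.sharedFind item) σ₁ := by
    intro σ₁ h₁ hd₁ hsn₁ hdn ho₁ hcl
    refine ⟨⟨hc, hsn₁, hdn, hv.of_le h₁⟩, fun hs => ?_⟩
    rcases hr hs with rfl | ⟨e, rfl, hi, ho⟩
    -- Here the snapshot may be older than the current `shared`, so the shared search restarts with
    -- nothing known: `32 = 12 * 2 + 8`.
    · exact ⟨32, by omega, .sharedFind 2 _ .unknown⟩
    · refine ⟨12 * e + 5, by omega, .sharedFindClean e _ (hi.keep hd₁) ?_ (hcl hs)⟩
      rw [ho₁, h₁.shared hs, ho]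
  obtain ⟨o, ho, hle⟩ := hsn.length_le a ha
  have hlt := hsn.lt o ho
  have hown := hsn.own o ho
  refine wp_bind (wp_consolidate (hsn.known a ha) fun σ₁ q h₁ hq hk hlen hmer hcl => ?_)
  split_ifs with hemp hm
  · refine wp_setSnapshot fun σ₂ h₂ ho₂ hs₂ _ hd₂ => ?_
    have h02 := h₁.rel.trans h₂
    have ho₂' : σ₂.m.observed t = some o := by rw [ho₂, h₁.keep.observed, ho]
    refine wp_bind (wp_pushSnapshot (by rw [h02.done]; exact hd) ?_ ?_ (by simp [hs₂])
      fun b σ₃ h₃ ho₃ hs₃ hd₃ hne hdn => wp_pure fun σ₄ h₄ => ?_)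
    · rw [ho₂']
      rintro _ ⟨⟩
      exact hlt.trans_le h02.le.mono.next_le
    · rw [ho₂']
      rintro _ ⟨⟩
      exact h02.le.mono.own _ hlt hown
    have h03 := h02.le.trans h₃
    have ho₃' : σ₃.m.observed t = some o := by rw [ho₃, ho₂']
    have hs₃' : σ₃.m.snapshot t = none := by rw [hs₃, hs₂]
    have hsn₃ : Snap t σ₃ := by
      refine ⟨by simp [hs₃'], by simp [hs₃'], ?_, ?_, ?_⟩ <;> rw [ho₃'] <;> rintro _ ⟨⟩
      · exact hlt.trans_le h03.mono.next_le
      · exact h03.mono.own _ hlt hown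
      · exact Or.inl (hne o ho₂')
    refine fin σ₄ (h03.trans h₄.le) (h₁.dist.trans (hd₂.trans (hd₃.trans h₄.dist)))
      (hsn₃.keep h₄.le h₄.snap) ?_ (by rw [h₄.keep.observed, ho₃', ho]) ?_
    · rw [h₄.keep.done]
      -- The null array has size `0` and any other array at least `1`, so publishing null always
      -- shrinks.
      exact hdn fun _ => by simp [hs₂, ho₂', arraySize]
    · intro _ s hs
      rw [h₄.keep.snapshot, hs₃'] at hs
      cases hs
  all_goals
    refine wp_setSnapshot fun σ₂ h₂ ho₂ hs₂ hown₂ hd₂ => ?_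
    have h02 := h₁.rel.trans h₂
    have ho₂' : σ₂.m.observed t = some o := by rw [ho₂, h₁.keep.observed, ho]
    have hk₂ : ∀ b ∈ q.1.blocks, Known σ₂ b := fun b hb => h₂.le.mono.blk b (hk b hb)
    have hlt₂ := hlt.trans_le h02.le.mono.next_le
    have hown₂' := h02.le.mono.own _ hlt hown
    -- Either the coming swap is bound to fail, or the consolidated array still has the address of
    -- the private copy and may be published.
    have hfr : σ₂.m.shared ≠ some o ∨ σ₂.g.own q.1.addr = some t := by
      rcases hsn.fresh o ho with h | ⟨s, h, hso⟩
      · exact Or.inl (h02.le.mono.shared o hlt hown h)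
      · rw [ha] at h
        cases h
        rw [hq]
        exact Or.inr (hown₂ _ (h₁.snap.own _ hso))
    have hsn₂ : Snap t σ₂ := by
      refine ⟨?_, ?_, ?_, ?_, ?_⟩
      · rw [hs₂]
        rintro _ ⟨⟩
        exact ⟨o, ho₂', hlen.trans hle⟩
      · rw [hs₂]
        rintro _ ⟨⟩
        exact hk₂
      all_goals rw [ho₂']; rintro _ ⟨⟩
      · exact hlt₂
      · exact hown₂'
      · exact hfr.imp_right fun h => ⟨_, hs₂, h⟩
    have hcl₂ : P.st → Clean k P.D σ₂ q.1 := fun hs => (hcl hs hemp).of_le h₂.le hs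
  · refine wp_bind (wp_pushSnapshot (by rw [h02.done]; exact hd) hsn₂.lt hsn₂.own ?_
      fun b σ₃ h₃ ho₃ hs₃ hd₃ hne hdn => wp_pure fun σ₄ h₄ => ?_)
    · rw [hs₂, ho₂']
      rintro σ' h' hsh _ ⟨⟩
      refine ⟨?_, h'.known_all hk₂⟩
      rcases hfr with h | h
      · exact absurd hsh (h'.le.mono.shared o hlt₂ hown₂' h)
      · exact h'.snap.own _ h
    have h03 := h02.le.trans h₃
    have ho₃' : σ₃.m.observed t = some o := by rw [ho₃, ho₂']
    have hs₃' : σ₃.m.snapshot t = some q.1 := by rw [hs₃, hs₂]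
    have hsn₃ : Snap t σ₃ := by
      refine ⟨?_, ?_, ?_, ?_, ?_⟩
      · rw [hs₃']
        rintro _ ⟨⟩
        exact ⟨o, ho₃', hlen.trans hle⟩
      · rw [hs₃']
        rintro _ ⟨⟩
        exact fun b hb => h₃.mono.blk b (hk₂ b hb)
      all_goals rw [ho₃']; rintro _ ⟨⟩
      · exact hlt.trans_le h03.mono.next_le
      · exact h03.mono.own _ hlt hown
      · exact Or.inl (hne o ho₂')
    refine fin σ₄ (h03.trans h₄.le) (h₁.dist.trans (hd₂.trans (hd₃.trans h₄.dist)))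
      (hsn₃.keep h₄.le h₄.snap) ?_ (by rw [h₄.keep.observed, ho₃', ho]) ?_
    · rw [h₄.keep.done]
      refine hdn fun _ => ?_
      have := hmer hm
      simp only [hs₂, ho₂', arraySize]
      omega
    · intro hs s h
      rw [h₄.keep.snapshot, hs₃'] at h
      cases h
      exact (hcl₂ hs).of_le (h₃.trans h₄.le) hs
  · refine wp_pure fun σ₃ h₃ => ?_
    refine fin σ₃ (h02.le.trans h₃.le) (h₁.dist.trans (hd₂.trans h₃.dist))
      (hsn₂.keep h₃.le h₃.snap) ?_ (by rw [h₃.keep.observed, ho₂', ho]) ?_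
    · rw [h₃.keep.done, h02.done]
      exact hd
    · intro hs s h
      rw [h₃.keep.snapshot, hs₂] at h
      cases h
      exact (hcl₂ hs).of_le h₃.le hs

theorem wp_code_snapCheck {k r : ℕ} {call : Call K} {item c : Option (Item K)}
    {a : BlockArray K} (hp : Loc.Pre t call (.snapCheck item a c) σ)
    (hr : P.st → Rank k P.D t σ r (.snapCheck item a c)) :
    wp P t (code k t (.snapCheck item a c)) (Post k P t call r) σ := by
  obtain ⟨hc, hsn, hd, hv, ha, hvc⟩ := hp
  cases c with
  | none =>
    refine wp_cleanup hc hsn hd hv ha fun hs => ?_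
    cases hr hs with
    | snapCheckFirst => exact Or.inl rfl
    | snapCheck e _ _ _ h ho => exact Or.inr ⟨e, rfl, h, ho⟩
  | some i =>
    refine wp_readFlag fun σ₁ h₁ => ?_
    have hsn₁ := hsn.keep h₁.le h₁.snap
    have hd₁ : ¬ σ₁.g.done t := by rw [h₁.keep.done]; exact hd
    have hv₁ := hv.of_le h₁.le
    have ha₁ : σ₁.m.snapshot t = some a := by rw [h₁.keep.snapshot, ha]
    dsimp only
    split_ifs with hdead
    · refine wp_cleanup hc hsn₁ hd₁ hv₁ ha₁ fun hs => ?_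
      cases hr hs with
      | snapCheckFirst => exact Or.inl rfl
      | snapCheck e _ _ _ h ho =>
        refine Or.inr ⟨e, rfl, h.keep h₁.dist, ?_⟩
        rw [h₁.keep.observed, h₁.le.shared hs, ho]
      | snapCheckClean e _ _ _ h hi => exact absurd (h₁.inv.mem hs hdead) hi
    · refine wp_pure fun σ₂ h₂ => ?_
      have h₁₂ := h₁.trans h₂
      have hd₂ : ¬ σ₂.g.done t := by rw [h₂.keep.done]; exact hd₁
      have hsn₂ := hsn₁.keep h₂.le h₂.snap
      have hi : i.addr ∉ P.D := h₁.inv.not_mem hdead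
      by_cases hs : P.st
      · have : ∃ e, 12 * e + 2 < r ∧ ItemOk P.D t σ₂ e item := by
          cases hr hs with
          | snapCheckFirst => exact ⟨2, by omega, .unknown⟩
          | snapCheck e _ _ _ h ho => exact ⟨e, by omega, h.keep h₁₂.dist⟩
          | snapCheckClean e _ _ _ h hi => exact ⟨e, by omega, h.keep h₁₂.dist⟩
        obtain ⟨e, he, h⟩ := this
        exact post_afterFind (e := e) hc hsn₂ hd₂ (hv.of_le h₁₂.le) (hvc.of_le h₁₂.le) (by simp)
          (fun _ => he) (fun _ => h) (by simpa using fun _ _ => hi)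
      · exact post_afterFind (e := 0) hc hsn₂ hd₂ (hv.of_le h₁₂.le) (hvc.of_le h₁₂.le) (by simp)
          (by simp [hs]) (by simp [hs]) (by simp [hs])

/-- A retry happens only if the item is dead. In the stable regime an item chosen with `e ≤ 1` is
outside `P.D`, so only the outdated choice with `e = 2` can fail. -/
theorem wp_code_mark {k r : ℕ} {call : Call K} {i : Item K}
    (hp : Loc.Pre t call (.mark i) σ) (hr : P.st → Rank k P.D t σ r (.mark i)) :
    wp P t (code k t (.mark i)) (Post k P t call r) σ := by
  obtain ⟨hc, hsn, hd, hi⟩ := hp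
  have retry : ∀ σ₁, Le P σ σ₁ → Snap t σ₁ → ¬ σ₁.g.done t → σ₁.m.flag i.addr = true →
      Post k P t call r .distFind σ₁ := by
    intro σ₁ h₁ hsn₁ hd₁ hf
    refine ⟨⟨hc, hsn₁, hd₁⟩, fun hs => ?_⟩
    cases hr hs with
    | mark e _ h =>
      -- `23 = 12 * 1 + 11` is below `12 * 2 + 2`, the rank of marking an outdated choice.
      refine ⟨23, ?_, .distFind 1 le_rfl (by simp)⟩
      by_contra hlt
      exact h (by omega) (h₁.inv.mem hs hf)
  refine wp_readFlag fun σ₁ h₁ => ?_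
  split_ifs with hdead
  · exact wp_pure fun σ₂ h₂ => retry σ₂ (h₁.trans h₂).le
      (hsn.keep (h₁.trans h₂).le (h₁.trans h₂).snap)
      (by rw [(h₁.trans h₂).keep.done]; exact hd) (h₂.flag hdead)
  · refine wp_testAndSet (h₁.lt hi) (by rw [h₁.keep.done]; exact hd)
      fun b σ₂ h₂ hk₂ hf hwon hdn => ?_
    have hsn₂ := (hsn.keep h₁.le h₁.snap).keep h₂ hk₂
    cases b with
    | true =>
      refine wp_pure fun σ₃ h₃ => ⟨⟨hc, hsn₂.keep h₃.le h₃.snap, ?_⟩, fun hs => ⟨0, ?_, .deleted _⟩⟩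
      · rw [h₃.keep.won]
        exact hwon rfl
      · cases hr hs
        omega
    | false =>
      exact wp_pure fun σ₃ h₃ => retry σ₃ (h₁.le.trans (h₂.trans h₃.le))
        (hsn₂.keep h₃.le h₃.snap) (by rw [h₃.keep.done]; exact hdn rfl) (h₃.flag hf)

/-- For `e = 1` the own array was empty before spying, so success means that its first block has an
active item, which is `e = 0`. Failure means size zero afterwards, hence before, and `saw` holds. -/
theorem wp_code_spying {k r : ℕ} {call : Call K} (hp : Loc.Pre t call .spying σ)
    (hr : P.st → Rank k P.D t σ r .spying) :
    wp P t (code k t .spying) (Post k P t call r) σ := by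
  obtain ⟨hc, hsn, hd, hsaw⟩ := hp
  refine wp_randThread fun σ₁ v h₁ => wp_bind (wp_spy fun σ₂ h₂ => ?_)
  replace h₂ := h₁.spyRel.trans h₂
  split_ifs with hne
  · refine wp_pure fun σ₃ h₃ => ?_
    have h₂₃ := h₂.trans h₃.spyRel
    refine ⟨⟨hc, hsn.keep h₂₃.le h₂₃.keep.keepSnap, by rw [h₂₃.keep.done]; exact hd⟩,
      fun hs => ?_⟩
    cases hr hs with
    | spying e he h =>
      rcases Nat.lt_or_ge 1 e with he1 | he1
      · exact ⟨23, by omega, .distFind 1 le_rfl (by simp)⟩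
      · refine ⟨11, by omega, .distFind 0 (by omega) fun _ => ?_⟩
        refine (h₂₃.act (Or.inl (h he1))).resolve_left ?_
        rw [h₃.dist.size]
        simpa using hne
  · refine wp_pure fun σ₃ h₃ => ?_
    have h₂₃ := h₂.trans h₃.spyRel
    refine ⟨⟨hc, hsn.keep h₂₃.le h₂₃.keep.keepSnap, ?_⟩, fun hs => ⟨0, ?_, .deleted _⟩⟩
    · rw [h₂₃.keep.saw]
      exact hsaw (h₂.size (by simpa using hne))
    · cases hr hs
      omega

theorem wp_code_insertItem {k r : ℕ} {call : Call K} {key : K}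
    (hp : Loc.Pre t call (.insertItem key) σ)
    (hr : P.st → Rank k P.D t σ r (.insertItem key)) :
    wp P t (code k t (.insertItem key)) (Post k P t call r) σ := by
  obtain ⟨hc, hsn, hd⟩ := hp
  -- Places of `insert` have no rank, so only the regime without the stability assumption is
  -- relevant here.
  have hst : ¬ P.st := fun hs => nomatch hr hs
  refine wp_newItem fun σ₁ i h₁ hi => ?_
  refine wp_newBlock (by simpa using hi) fun σ₂ b h₂ hb _ => ?_
  refine wp_readSize fun σ₃ h₃ => ?_
  refine wp_bind (wp_mergeBack (h₃.known hb) fun σ₄ q h₄ hq => ?_)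
  have h04 := h₁.trans (h₂.trans (h₃.trans h₄))
  split_ifs
  · refine wp_writeSlot hq fun σ₅ h₅ hk₅ _ _ => wp_writeSize fun σ₆ h₆ hk₆ _ _ =>
      wp_pure fun σ₇ h₇ => ?_
    exact ⟨⟨hc, hsn.keep (h04.le.trans (h₅.trans (h₆.trans h₇.le)))
      (h04.keep.trans (hk₅.trans (hk₆.trans h₇.keep))).keepSnap⟩, fun hs => absurd hs hst⟩
  · refine wp_pure fun σ₅ h₅ => ⟨⟨hc, ?_, h₅.known hq⟩, fun hs => absurd hs hst⟩
    rw [(h04.trans h₅).keep.done]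
    exact hd

theorem mem_insertByLevel {b c : Block K} {l : List (Block K)} (h : c ∈ insertByLevel b l) :
    c = b ∨ c ∈ l := by
  induction l with
  | nil => simpa [insertByLevel] using h
  | cons d rest ih =>
    rw [insertByLevel] at h
    split_ifs at h
    · rcases List.mem_cons.1 h with rfl | h
      · simp
      · rcases ih h with h | h <;> simp [h]
    · simpa using h

/-- The inserted block may make the array longer, so a successful swap may set `done`; but then the
loop ends. A failed swap leaves `done` as it was, and the loop may go on. -/
theorem wp_code_publish {k r : ℕ} {call : Call K} {b : Block K} {i : ℕ}
    (hp : Loc.Pre t call (.publish b i) σ) (hr : P.st → Rank k P.D t σ r (.publish b i)) :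
    wp P t (code k t (.publish b i)) (Post k P t call r) σ := by
  obtain ⟨hc, hd, hb⟩ := hp
  have hst : ¬ P.st := fun hs => nomatch hr hs
  have main : ∀ σ₁ (a : BlockArray K), Rel P t σ σ₁ → (∀ o, σ₁.m.observed t = some o → o.addr < σ₁.m.next) →
      (∀ o, σ₁.m.observed t = some o → σ₁.g.own o.addr = none) →
      σ₁.g.own a.addr = some t → (∀ c ∈ a.blocks, Known σ₁ c) →
      wp P t (do
        let a' ← a.insert k b
        setSnapshot (some a')
        let success ← pushSnapshot
        if success then do
          refreshSnapshot
          writeSize i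
          pure .inserted
        else pure (.publish b i)) (Post k P t call r) σ₁ := by
    intro σ₁ a h₁ hlt hown ha hk
    refine wp_bind (wp_bind (wp_consolidate (k := k) ?_ fun σ₂ q h₂ hq hk₂ _ _ _ =>
      wp_pure fun σ₃ h₃ => ?_))
    · intro c hcm
      rcases mem_insertByLevel hcm with rfl | h
      · exact h₁.le.mono.blk c hb
      · exact hk c h
    have h₁₃ := h₂.trans h₃
    refine wp_setSnapshot fun σ₄ h₄ ho₄ hs₄ hown₄ _ => ?_
    have h₁₄ := h₁₃.rel.trans h₄
    have hd₄ : ¬ σ₄.g.done t := by rw [h₁₄.done, h₁.done]; exact hd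
    have ho : σ₄.m.observed t = σ₁.m.observed t := by rw [ho₄, h₁₃.keep.observed]
    refine wp_bind (wp_pushSnapshot hd₄ ?_ ?_ ?_ fun s σ₅ h₅ _ _ _ _ hdn => ?_)
    · rw [ho]
      exact fun o ho => (hlt o ho).trans_le h₁₄.le.mono.next_le
    · rw [ho]
      exact fun o ho => h₁₄.le.mono.own _ (hlt o ho) (hown o ho)
    · rw [hs₄]
      rintro σ' h' _ _ ⟨⟩
      refine ⟨?_, fun c hcm => h'.known (h₄.le.mono.blk c (h₃.known (hk₂ c hcm)))⟩
      rw [hq]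
      exact h'.snap.own _ (hown₄ _ (h₁₃.snap.own _ ha))
    · cases s with
      | true =>
        refine wp_bind (wp_refreshSnapshot fun σ₆ h₆ _ hsn₆ _ _ _ => ?_)
        refine wp_writeSize fun σ₇ h₇ hk₇ _ _ => wp_pure fun σ₈ h₈ => ?_
        exact ⟨⟨hc, hsn₆.keep (h₇.trans h₈.le) (hk₇.trans h₈.keep).keepSnap⟩,
          fun hs => absurd hs hst⟩
      | false =>
        refine wp_pure fun σ₆ h₆ => ⟨⟨hc, ?_, ?_⟩, fun hs => absurd hs hst⟩
        · rw [h₆.keep.done]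
          exact hdn (by simp)
        · exact h₆.known (h₅.mono.blk b (h₁₄.le.mono.blk b (h₁.le.mono.blk b hb)))
  refine wp_bind (wp_refreshSnapshot fun σ₁ h₁ _ hsn₁ _ _ ho₁ => wp_getSnapshot fun σ₂ h₂ => ?_)
  have hsn₂ := hsn₁.keep h₂.le h₂.snap
  have h02 := h₁.trans h₂.rel
  dsimp only
  rw [← h₂.keep.snapshot]
  split
  · rename_i hn
    refine wp_newBlockArray fun σ₃ c h₃ ho₃ hc₃ hown₃ => ?_
    refine main σ₃ c (h02.trans h₃) ?_ ?_ hown₃ (by simp [hc₃])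
    · rw [ho₃]
      exact fun o ho => (hsn₂.lt o ho).trans_le h₃.le.mono.next_le
    · rw [ho₃]
      exact fun o ho => h₃.le.mono.own _ (hsn₂.lt o ho) (hsn₂.own o ho)
  · rename_i a ha
    refine main σ₂ a h02 hsn₂.lt hsn₂.own ?_ (hsn₂.known a ha)
    exact h₂.snap.own _ (ho₁ a (h₂.keep.snapshot.symm.trans ha))

end Logic

end KLSM

/-! ### Runs: invariants, results of `delete_min`, and the stable regime -/

namespace KLSM

section Runs

variable {K : Type} [LinearOrder K] {k T : ℕ}

/-- Forget the ghost state of an operation that has returned. -/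
def Ghost.reset (g : Ghost K T) (t : Fin T) : Ghost K T :=
  { g with
    done := Function.update g.done t False
    saw := Function.update g.saw t False
    won := Function.update g.won t none }

/-- A step with its effect on the ghost state. -/
inductive XStep (k : ℕ) :
    Config K T → Ghost K T → Fin T → Event K → Config K T → Ghost K T → Prop where
  | invoke (c : Config K T) (g : Ghost K T) (t : Fin T) (call : Call K) (h : c.status t = .idle) :
      XStep k c g t (.invoke call)
        ⟨c.mem, Function.update c.status t (.busy call call.start (code k t call.start))⟩ g
  | atomic (c : Config K T) (g : Ghost K T) (t : Fin T) (call : Call K) (l : Loc K) (o : Op K T)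
      (next : o.Resp → Prog K T (Loc K)) (h : c.status t = .busy call l (.op o next))
      (r : o.Resp) (m : Mem K T) (g' : Ghost K T) (hr : o.XExec t ⟨c.mem, g⟩ r ⟨m, g'⟩) :
      XStep k c g t .internal ⟨m, Function.update c.status t (.busy call l (next r))⟩ g'
  | jump (c : Config K T) (g : Ghost K T) (t : Fin T) (call : Call K) (l l' : Loc K)
      (h : c.status t = .busy call l (.ret l')) (h₁ : l' ≠ .inserted)
      (h₂ : ∀ r, l' ≠ .deleted r) :
      XStep k c g t .internal ⟨c.mem, Function.update c.status t (.busy call l' (code k t l'))⟩ g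
  | inserted (c : Config K T) (g : Ghost K T) (t : Fin T) (call : Call K) (l : Loc K)
      (h : c.status t = .busy call l (.ret .inserted)) :
      XStep k c g t (.respond call none) ⟨c.mem, Function.update c.status t .idle⟩ (g.reset t)
  | deleted (c : Config K T) (g : Ghost K T) (t : Fin T) (call : Call K) (l : Loc K)
      (r : Option (Item K)) (h : c.status t = .busy call l (.ret (.deleted r))) :
      XStep k c g t (.respond call r) ⟨c.mem, Function.update c.status t .idle⟩ (g.reset t)

theorem Step.exists_xstep {c c' : Config K T} {t : Fin T} {ev : Event K} (h : Step k c t ev c')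
    (g : Ghost K T) : ∃ g', XStep k c g t ev c' g' := by
  cases h with
  | invoke call h => exact ⟨_, .invoke c g t call h⟩
  | atomic call l o next h r m hr =>
    exact ⟨_, .atomic c g t call l o next h r m (o.ghost t c.mem r g) ⟨hr, rfl⟩⟩
  | jump call l l' h h₁ h₂ => exact ⟨_, .jump c g t call l l' h h₁ h₂⟩
  | inserted call l h => exact ⟨_, .inserted c g t call l h⟩
  | deleted call l r h => exact ⟨_, .deleted c g t call l r h⟩

/-- A run from the empty queue with its ghost states. -/
structure XRun (e : Run K k T) where
  g : ℕ → Ghost K T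
  conf_zero : e.conf 0 = Config.init K T
  g_zero : g 0 = Ghost.init K T
  step : ∀ n, XStep k (e.conf n) (g n) (e.thread n) (e.event n) (e.conf (n + 1)) (g (n + 1))

theorem Run.FromInit.exists_xrun {e : Run K k T} (h : e.FromInit) : Nonempty (XRun e) := by
  choose f hf using fun n => (e.step n).exists_xstep
  exact ⟨⟨fun n => Nat.rec (Ghost.init K T) (fun n g => f n g) n, h, rfl, fun n => hf n _⟩⟩

/-- The state after `n` steps. -/
def XRun.σ {e : Run K k T} (x : XRun e) (n : ℕ) : St K T := ⟨(e.conf n).mem, x.g n⟩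

/-- The invariant of a thread, where the items with address in `D` have been logically deleted when
the thread has reached the present place in the code. -/
def ThreadInv (k : ℕ) (D : Set ℕ) (t : Fin T) (s : Status K T) (σ : St K T) : Prop :=
  match s with
  | .idle => Snap t σ ∧ ¬ σ.g.done t
  | .busy call _ p => wp ⟨D, False⟩ t p (Post k ⟨D, False⟩ t call 0) σ

theorem wp_code {P : Mode} {t : Fin T} {σ : St K T} {l : Loc K} {call : Call K} {r : ℕ}
    (hp : l.Pre t call σ) (hr : P.st → Rank k P.D t σ r l) (h₁ : l ≠ .inserted)
    (h₂ : ∀ x, l ≠ .deleted x) : wp P t (code k t l) (Post k P t call r) σ := by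
  cases l with
  | distFind => exact wp_code_distFind hp hr
  | sharedFind => exact wp_code_sharedFind hp hr
  | snapFind => exact wp_code_snapFind hp hr
  | snapCheck => exact wp_code_snapCheck hp hr
  | mark => exact wp_code_mark hp hr
  | spying => exact wp_code_spying hp hr
  | insertItem => exact wp_code_insertItem hp hr
  | publish => exact wp_code_publish hp hr
  | inserted => exact absurd rfl h₁
  | deleted x => exact absurd rfl (h₂ x)

theorem Loc.Pre.snap {t : Fin T} {σ : St K T} {call : Call K} {l : Loc K} (h : l.Pre t call σ)
    (h' : l = .inserted ∨ ∃ r, l = .deleted r) : Snap t σ := by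
  rcases h' with rfl | ⟨_ | i, rfl⟩
  · exact h.2
  · exact h.2.1
  · exact h.2.1

/-- Starts the descent at an arbitrary place, with no assumption on how old the local values are. -/
theorem exists_rank {D : Set ℕ} {t : Fin T} {σ : St K T} {l : Loc K}
    (h : l.Pre t .deleteMin σ) : ∃ r, Rank k D t σ r l := by
  cases l with
  | distFind => exact ⟨_, .distFind 1 le_rfl (by simp)⟩
  | sharedFind item => exact ⟨_, .sharedFind 2 item .unknown⟩
  | snapFind item a => exact ⟨_, .snapFindFirst item a⟩
  | snapCheck item a c => exact ⟨_, .snapCheckFirst item a c⟩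
  | mark i => exact ⟨_, .mark 2 i (by omega)⟩
  | spying => exact ⟨_, .spying 2 (by omega) (by omega)⟩
  | insertItem => exact absurd rfl h.1
  | publish => exact absurd rfl h.1
  | inserted => exact absurd rfl h.1
  | deleted x => exact ⟨_, .deleted x⟩

section Steps

variable {c c' : Config K T} {g g' : Ghost K T} {u : Fin T} {ev : Event K} {D : Set ℕ}

theorem XStep.status_ne (h : XStep k c g u ev c' g') {t : Fin T} (ht : t ≠ u) :
    c'.status t = c.status t := by
  cases h <;> simp [ht]

theorem XStep.of_op (h : XStep k c g u ev c' g') {call : Call K} {l : Loc K} {o : Op K T}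
    {next : o.Resp → Prog K T (Loc K)} (hs : c.status u = .busy call l (.op o next)) :
    ev = .internal ∧ ∃ r, o.XExec u ⟨c.mem, g⟩ r ⟨c'.mem, g'⟩ ∧
      c'.status u = .busy call l (next r) := by
  cases h with
  | invoke call h => simp [hs] at h
  | atomic call l o next h r m g' hr =>
    rw [hs] at h
    cases h
    exact ⟨rfl, r, hr, by simp⟩
  | jump call l l' h => simp [hs] at h
  | inserted call l h => simp [hs] at h
  | deleted call l r h => simp [hs] at h

theorem XStep.call_eq (h : XStep k c g u ev c' g') {call call' : Call K} {l : Loc K}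
    {p : Prog K T (Loc K)} {r : Option (Item K)} (hs : c.status u = .busy call l p)
    (hev : ev = .respond call' r) : call' = call := by
  cases h with
  | invoke | atomic | jump => cases hev
  | inserted call l h =>
    cases hev
    rw [hs] at h
    cases h
    rfl
  | deleted call l r h =>
    cases hev
    rw [hs] at h
    cases h
    rfl

/-- A step either executes an atomic operation, or it leaves the memory unchanged. -/
theorem XStep.cases_op (h : XStep k c g u ev c' g') :
    (∃ call l o next, c.status u = .busy call l (.op o next)) ∨
    ((∀ call l o next, c.status u ≠ .busy call l (.op o next)) ∧ c'.mem = c.mem ∧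
      (g' = g ∨ ((∃ call r, ev = .respond call r) ∧ g' = g.reset u))) := by
  cases h with
  | invoke call h => exact Or.inr ⟨by simp [h], rfl, Or.inl rfl⟩
  | atomic call l o next h r m g' hr => exact Or.inl ⟨_, _, _, _, h⟩
  | jump call l l' h => exact Or.inr ⟨by simp [h], rfl, Or.inl rfl⟩
  | inserted call l h => exact Or.inr ⟨by simp [h], rfl, Or.inr ⟨⟨_, _, rfl⟩, rfl⟩⟩
  | deleted call l r h => exact Or.inr ⟨by simp [h], rfl, Or.inr ⟨⟨_, _, rfl⟩, rfl⟩⟩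

theorem XStep.pre {call : Call K} {l : Loc K} {o : Op K T} {next : o.Resp → Prog K T (Loc K)}
    (hs : c.status u = .busy call l (.op o next)) (hg : Good ⟨c.mem, g⟩)
    (hD : ∀ a ∈ D, c.mem.flag a = true) (ht : ThreadInv k D u (c.status u) ⟨c.mem, g⟩) :
    o.Pre D u ⟨c.mem, g⟩ := by
  rw [hs] at ht
  exact (ht _ (Rely.refl u ⟨hg, hD, fun h => h.elim⟩)).1

theorem XStep.guar (h : XStep k c g u ev c' g') (hg : Good ⟨c.mem, g⟩)
    (hD : ∀ a ∈ D, c.mem.flag a = true) (ht : ThreadInv k D u (c.status u) ⟨c.mem, g⟩) :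
    Good ⟨c'.mem, g'⟩ ∧ Guar D u ⟨c.mem, g⟩ ⟨c'.mem, g'⟩ := by
  rcases h.cases_op with ⟨call, l, o, next, hs⟩ | ⟨-, hm, rfl | ⟨-, rfl⟩⟩
  · obtain ⟨-, r, he, -⟩ := h.of_op hs
    exact exec_guar hg (XStep.pre hs hg hD ht) he
  · rw [hm]
    exact ⟨hg, ⟨Mono.refl _, fun _ _ => Or.inl rfl, fun t _ => Keep.refl t _,
      fun t _ => KeepDist.refl t _⟩⟩
  · rw [hm]
    refine ⟨good_of_eq hg rfl rfl rfl rfl hg.slot_known rfl rfl,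
      guar_of_eq rfl rfl rfl rfl rfl rfl ?_ ?_ ?_ ?_ ?_ ?_ ?_⟩
    all_goals intro t ht; simp [Ghost.reset, ht]

/-- Tightness survives because the acting thread uses the same set `P.D`: it leaves `filled` alone
or writes a tight value. -/
theorem Guar.rely {P : Mode} {σ σ' : St K T} (h : Guar P.D u σ σ') {t : Fin T} (ht : t ≠ u)
    (hI : Inv P σ') (hs : P.st → σ'.m.shared = σ.m.shared) : Rely P t σ σ' := by
  refine ⟨⟨hI, h.mono, hs, fun _ b hb ht => ?_⟩, h.keep t ht, h.dist t ht⟩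
  rcases h.filled b hb with h | h
  · simpa [Tight, h] using ht
  · exact h

/-- A step that is not an atomic operation establishes the invariant of its thread anew. -/
theorem XStep.threadInv_of_not_op {D₀ : Set ℕ} (h : XStep k c g u ev c' g')
    (hg : Good ⟨c.mem, g⟩) (hD₀ : ∀ a ∈ D₀, c.mem.flag a = true)
    (ht : ThreadInv k D₀ u (c.status u) ⟨c.mem, g⟩)
    (hn : ∀ call l o next, c.status u ≠ .busy call l (.op o next)) :
    ThreadInv k D u (c'.status u) ⟨c'.mem, g'⟩ := by
  have hret : ∀ call l l', c.status u = .busy call l (.ret l') → l'.Pre u call ⟨c.mem, g⟩ := by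
    intro call l l' hs
    rw [hs] at ht
    exact (ht _ (Rely.refl u ⟨hg, hD₀, fun h => h.elim⟩)).1
  have hreset : Snap u ⟨c.mem, g⟩ → Snap u ⟨c.mem, g.reset u⟩ := fun h =>
    ⟨h.length_le, h.known, h.lt, h.own, h.fresh⟩
  cases h with
  | invoke call h =>
    rw [h] at ht
    obtain ⟨hsn, hd⟩ := ht
    simp only [Function.update_self]
    refine wp_code ?_ (fun h => h.elim) (by cases call <;> simp [Call.start])
      (by cases call <;> simp [Call.start])
    cases call
    · exact ⟨by simp, hsn, hd⟩
    · exact ⟨rfl, hsn, hd⟩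
  | atomic call l o next h => exact absurd h (hn _ _ _ _)
  | jump call l l' h h₁ h₂ =>
    simp only [Function.update_self]
    exact wp_code (hret _ _ _ h) (fun h => h.elim) h₁ h₂
  | inserted call l h =>
    simp only [Function.update_self]
    exact ⟨hreset ((hret _ _ _ h).snap (Or.inl rfl)), by simp [Ghost.reset]⟩
  | deleted call l r h =>
    simp only [Function.update_self]
    exact ⟨hreset ((hret _ _ _ h).snap (Or.inr ⟨r, rfl⟩)), by simp [Ghost.reset]⟩

theorem XStep.threadInv_self (h : XStep k c g u ev c' g')
    (hg : Good ⟨c.mem, g⟩) (hD : ∀ a ∈ D, c.mem.flag a = true)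
    (ht : ThreadInv k D u (c.status u) ⟨c.mem, g⟩) :
    ThreadInv k D u (c'.status u) ⟨c'.mem, g'⟩ := by
  rcases h.cases_op with ⟨call, l, o, next, hs⟩ | ⟨hn, -⟩
  · obtain ⟨hg', hG⟩ := h.guar hg hD ht
    obtain ⟨-, r, he, hs'⟩ := h.of_op hs
    rw [hs] at ht
    rw [hs']
    exact (ht _ (Rely.refl u ⟨hg, hD, fun h => h.elim⟩)).2 r _ he
      ⟨hg', fun a ha => hG.mono.flag a (hD a ha), fun h => h.elim⟩ (fun h => h.elim)
  · exact h.threadInv_of_not_op hg hD ht hn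

theorem ThreadInv.rely {t : Fin T} {s : Status K T} {σ σ' : St K T} (h : ThreadInv k D t s σ)
    (hR : Rely ⟨D, False⟩ t σ σ') : ThreadInv k D t s σ' := by
  cases s with
  | idle => exact ⟨h.1.keep hR.le hR.snap, by rw [hR.keep.done]; exact h.2⟩
  | busy call l p => exact wp_of_rely h hR

/-- The acting thread may know fewer dead items than `t`. This is harmless in the unstable mode,
which promises nothing on tightness. -/
theorem XStep.threadInv_ne {D₀ : Set ℕ} (h : XStep k c g u ev c' g')
    (hg : Good ⟨c.mem, g⟩) (hD₀ : ∀ a ∈ D₀, c.mem.flag a = true)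
    (hD : ∀ a ∈ D, c.mem.flag a = true) (hu : ThreadInv k D₀ u (c.status u) ⟨c.mem, g⟩)
    {t : Fin T} (htu : t ≠ u) (ht : ThreadInv k D t (c.status t) ⟨c.mem, g⟩) :
    ThreadInv k D t (c'.status t) ⟨c'.mem, g'⟩ := by
  obtain ⟨hg', hG⟩ := h.guar hg hD₀ hu
  rw [h.status_ne htu]
  exact ht.rely ⟨⟨⟨hg', fun a ha => hG.mono.flag a (hD a ha), fun h => h.elim⟩, hG.mono,
    fun h => h.elim, fun h => h.elim⟩, hG.keep t htu, hG.dist t htu⟩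

end Steps

section Invariant

variable {e : Run K k T}

theorem good_init : Good (⟨Mem.init K T, Ghost.init K T⟩ : St K T) := by
  constructor <;> simp [Mem.init, Ghost.init, Known]

/-- With `D = ∅` the bound by `liveLen` is just the length of the block, so no thread has to know of
any deletion. -/
theorem XRun.inv (x : XRun e) (n : ℕ) : Good (x.σ n) ∧
    ∀ t, ThreadInv k ∅ t ((e.conf n).status t) (x.σ n) := by
  induction n with
  | zero =>
    simp only [XRun.σ, x.conf_zero, x.g_zero, Config.init]
    refine ⟨good_init, fun t => ⟨?_, by simp [Ghost.init]⟩⟩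
    constructor <;> simp [Mem.init]
  | succ n ih =>
    obtain ⟨hg, ht⟩ := ih
    have hs := x.step n
    refine ⟨(hs.guar (D := ∅) hg (by simp) (ht _)).1, fun t => ?_⟩
    by_cases h : t = e.thread n
    · subst h
      exact hs.threadInv_self hg (by simp) (ht _)
    · exact hs.threadInv_ne (D₀ := ∅) hg (by simp) (by simp) (ht _) h (ht t)

theorem XRun.guar (x : XRun e) (n : ℕ) : Guar ∅ (e.thread n) (x.σ n) (x.σ (n + 1)) :=
  ((x.step n).guar (D := ∅) (x.inv n).1 (by simp) ((x.inv n).2 _)).2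

theorem XRun.flag_mono (x : XRun e) {m n : ℕ} (h : m ≤ n) {a : ℕ} (ha : (e.conf m).mem.flag a = true) :
    (e.conf n).mem.flag a = true := by
  induction n, h using Nat.le_induction with
  | base => exact ha
  | succ n _ ih => exact (x.guar n).mono.flag a ih

/-- The precondition of the atomic operation executed in a step. -/
theorem XRun.pre (x : XRun e) {n : ℕ} {call : Call K} {l : Loc K} {o : Op K T}
    {next : o.Resp → Prog K T (Loc K)}
    (hs : (e.conf n).status (e.thread n) = .busy call l (.op o next)) :
    o.Pre ∅ (e.thread n) (x.σ n) :=
  XStep.pre hs (x.inv n).1 (by simp) ((x.inv n).2 _)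

theorem XRun.pre_of_ret (x : XRun e) {n : ℕ} {t : Fin T} {call : Call K} {l l' : Loc K}
    (hs : (e.conf n).status t = .busy call l (.ret l')) : l'.Pre t call (x.σ n) := by
  have := (x.inv n).2 t
  rw [hs] at this
  exact (this _ (Rely.refl t ⟨(x.inv n).1, by simp, fun h => h.elim⟩)).1

/-! ### Results of `delete_min` -/

theorem Op.XExec.won {t : Fin T} {o : Op K T} {σ σ' : St K T} {r : o.Resp}
    (h : o.XExec t σ r σ') {i : Item K} (hw : σ'.g.won t = some i) :
    σ.g.won t = some i ∨ (σ.m.flag i.addr = false ∧ σ'.m.flag i.addr = true) := by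
  obtain ⟨he, hg⟩ := h
  rw [hg] at hw
  cases o <;> try exact Or.inl hw
  case testAndSet j =>
    simp only [Op.ghost] at hw
    split_ifs at hw with hf
    · right
      obtain rfl : j = i := by simpa using hw
      exact ⟨hf, by simp [he.2]⟩
    · exact Or.inl hw
  case casShared =>
    simp only [Op.ghost] at hw
    split_ifs at hw <;> exact Or.inl hw

theorem Op.XExec.saw {t : Fin T} {o : Op K T} {σ σ' : St K T} {r : o.Resp}
    (h : o.XExec t σ r σ') (hw : σ'.g.saw t) :
    σ.g.saw t ∨ (σ.m.size t = 0 ∧ σ.m.shared = none) := by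
  obtain ⟨he, hg⟩ := h
  rw [hg] at hw
  cases o <;> try exact Or.inl hw
  case testAndSet j =>
    simp only [Op.ghost] at hw
    split_ifs at hw <;> exact Or.inl hw
  case casShared =>
    simp only [Op.ghost] at hw
    split_ifs at hw <;> exact Or.inl hw
  case readShared =>
    simp only [Op.ghost, Function.update_self] at hw
    tauto

/-- The ghost variables `won` and `saw` are reset at every return, so a set value stems from an
earlier step of the present call. -/
theorem XRun.witness (x : XRun e) (n : ℕ) (t : Fin T) :
    ((e.conf n).status t = .idle → (x.g n).won t = none) ∧
    ((e.conf n).status t = .idle → ¬ (x.g n).saw t) ∧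
    ∀ call l p, (e.conf n).status t = .busy call l p →
      (∀ i, (x.g n).won t = some i → ∃ m, m < n ∧
        (∀ j, m ≤ j → j ≤ n → (e.conf j).Executing t call) ∧ e.thread m = t ∧ e.MarksAt m i) ∧
      ((x.g n).saw t → ∃ m, m < n ∧
        (∀ j, m ≤ j → j ≤ n → (e.conf j).Executing t call) ∧
        (e.conf m).mem.size t = 0 ∧ (e.conf m).mem.shared = none) := by
  induction n with
  | zero => simp [x.conf_zero, x.g_zero, Config.init, Ghost.init]
  | succ n ih =>
    obtain ⟨hw, hs, hb⟩ := ih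
    have ext : ∀ {call : Call K} {m : ℕ}, (e.conf (n + 1)).Executing t call →
        (∀ j, m ≤ j → j ≤ n → (e.conf j).Executing t call) →
        ∀ j, m ≤ j → j ≤ n + 1 → (e.conf j).Executing t call := by
      intro call m h1 h j hj hj'
      rcases hj'.eq_or_lt with rfl | hlt
      · exact h1
      · exact h j hj (by omega)
    by_cases ht : t = e.thread n
    · have step := x.step n
      rw [← ht] at step
      rcases step.cases_op with ⟨call, l, o, next, hst⟩ | ⟨hn, -⟩
      · obtain ⟨-, r, he, hst'⟩ := step.of_op hst
        refine ⟨by simp [hst'], by simp [hst'], fun call' l' p' h' => ?_⟩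
        rw [hst'] at h'
        cases h'
        have hex : (e.conf (n + 1)).Executing t call := ⟨l, _, hst'⟩
        have hex' : ∀ j, n ≤ j → j ≤ n → (e.conf j).Executing t call := by
          intro j h1 h2
          obtain rfl : j = n := by omega
          exact ⟨l, _, hst⟩
        refine ⟨fun i hi => ?_, fun hsaw => ?_⟩
        · rcases he.won hi with h | h
          · obtain ⟨m, hm, hj, h⟩ := (hb call l _ hst).1 i h
            exact ⟨m, by omega, ext hex hj, h⟩
          · exact ⟨n, by omega, ext hex hex', ht.symm, h⟩
        · rcases he.saw hsaw with h | h
          · obtain ⟨m, hm, hj, h⟩ := (hb call l _ hst).2 h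
            exact ⟨m, by omega, ext hex hj, h⟩
          · exact ⟨n, by omega, ext hex hex', h⟩
      · generalize hc : e.conf (n + 1) = c' at step ext ⊢
        generalize hg : x.g (n + 1) = g' at step ⊢
        generalize hev : e.event n = ev at step
        cases step with
        | invoke call h => simp [hw h, hs h]
        | atomic call l o next h => exact absurd h (hn _ _ _ _)
        | jump call l l' h h₁ h₂ =>
          refine ⟨by simp, by simp, fun call' l'' p h' => ?_⟩
          simp only [Function.update_self] at h'
          cases h'
          refine ⟨fun i hi => ?_, fun hsaw => ?_⟩
          · obtain ⟨m, hm, hj, h⟩ := (hb call l _ h).1 i hi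
            exact ⟨m, by omega, ext ⟨_, _, Function.update_self ..⟩ hj, h⟩
          · obtain ⟨m, hm, hj, h⟩ := (hb call l _ h).2 hsaw
            exact ⟨m, by omega, ext ⟨_, _, Function.update_self ..⟩ hj, h⟩
        | inserted call l h => simp [Ghost.reset]
        | deleted call l r h => simp [Ghost.reset]
    · have h1 := (x.step n).status_ne ht
      have hk : Keep t (x.σ n) (x.σ (n + 1)) := (x.guar n).keep t ht
      rw [h1, show (x.g (n + 1)).won t = (x.g n).won t from hk.won,
        show (x.g (n + 1)).saw t = (x.g n).saw t from hk.saw]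
      refine ⟨hw, hs, fun call l p h => ?_⟩
      have hex : (e.conf (n + 1)).Executing t call := ⟨l, p, h1.trans h⟩
      refine ⟨fun i hi => ?_, fun hsaw => ?_⟩
      · obtain ⟨m, hm, hj, h⟩ := (hb call l p h).1 i hi
        exact ⟨m, by omega, ext hex hj, h⟩
      · obtain ⟨m, hm, hj, h⟩ := (hb call l p h).2 hsaw
        exact ⟨m, by omega, ext hex hj, h⟩

theorem findsActiveOrEmpty : FindsActiveOrEmpty K k T := by
  intro e h0 t n r ht hev
  obtain ⟨x⟩ := h0.exists_xrun
  obtain ⟨-, -, hw⟩ := x.witness n t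
  have step := x.step n
  have hpre := fun call l l' => x.pre_of_ret (n := n) (t := t) (call := call) (l := l) (l' := l')
  rw [ht] at step
  generalize e.conf (n + 1) = c' at step
  generalize x.g (n + 1) = g' at step
  rw [hev] at step
  cases step with
  | inserted call l h => exact absurd rfl (hpre _ _ _ h).1
  | deleted call l r h =>
    have hp := hpre _ _ _ h
    cases r with
    | none =>
      obtain ⟨m, hm, hj, h⟩ := (hw _ _ _ h).2 hp.2.2
      exact ⟨m, hm, hj, h⟩
    | some i =>
      obtain ⟨m, hm, hj, h⟩ := (hw _ _ _ h).1 i hp.2.2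
      exact ⟨m, hm, hj, h⟩

/-! ### Finitely many decisive steps -/

theorem Op.XExec.flag {t : Fin T} {o : Op K T} {σ σ' : St K T} {r : o.Resp}
    (h : o.XExec t σ r σ') {a : ℕ} (hf : σ.m.flag a = false) (hf' : σ'.m.flag a = true) :
    ∃ i : Item K, i.addr = a ∧ o = .testAndSet i := by
  obtain ⟨he, -⟩ := h
  cases o
  case testAndSet i =>
    refine ⟨i, ?_, rfl⟩
    rw [he.2] at hf'
    by_contra hne
    simp [Ne.symm hne, hf] at hf'
  case newItem =>
    rw [he.2] at hf'
    by_cases h : a = σ.m.next <;> simp [h, hf] at hf'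
  case casShared =>
    rw [he.2] at hf'
    split_ifs at hf' <;> simp [hf] at hf'
  all_goals
    first
    | (rw [he.2] at hf'; simp [hf] at hf')
    | (rw [show σ'.m = _ from he] at hf'; simp [hf] at hf')

theorem Op.XExec.shared {t : Fin T} {o : Op K T} {σ σ' : St K T} {r : o.Resp}
    (h : o.XExec t σ r σ') (hs : σ'.m.shared ≠ σ.m.shared) :
    ∃ e n, o = .casShared e n ∧ σ.m.shared = e ∧ σ'.m.shared = n := by
  obtain ⟨he, -⟩ := h
  cases o
  case casShared e n =>
    rw [he.2] at hs ⊢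
    split_ifs at hs ⊢ with h
    · exact ⟨e, n, rfl, h, rfl⟩
    · exact absurd rfl hs
  all_goals
    first
    | (rw [he.2] at hs; simp at hs)
    | (rw [show σ'.m = _ from he] at hs; simp at hs)

theorem Op.XExec.done_mono {t : Fin T} {o : Op K T} {σ σ' : St K T} {r : o.Resp}
    (h : o.XExec t σ r σ') (hd : σ.g.done t) : σ'.g.done t := by
  obtain ⟨-, hg⟩ := h
  rw [hg]
  cases o <;> try exact hd
  case testAndSet i =>
    simp only [Op.ghost]
    split_ifs
    · simp
    · exact hd
  case casShared =>
    simp only [Op.ghost]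
    split_ifs
    · simp [hd]
    · exact hd

/-- Item `i` is logically deleted or the shared array is replaced in step `n`. -/
def Run.DecisiveAt (e : Run K k T) (n : ℕ) : Prop := (∃ i, e.MarksAt n i) ∨ e.ReplacesAt n

/-- Both kinds of decisive operations have `¬ done` as precondition, so each uses up this credit,
except for a swap that shrinks the array. -/
theorem XRun.decisive (x : XRun e) {n : ℕ} (h : e.DecisiveAt n) :
    (¬ (x.g n).done (e.thread n) ∧ (x.g (n + 1)).done (e.thread n)) ∨
    ((x.g (n + 1)).done (e.thread n) = (x.g n).done (e.thread n) ∧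
      arraySize (e.conf (n + 1)).mem.shared < arraySize (e.conf n).mem.shared) := by
  rcases (x.step n).cases_op with ⟨call, l, o, next, hs⟩ | ⟨-, hm, -⟩
  · obtain ⟨-, r, he, -⟩ := (x.step n).of_op hs
    have hp := x.pre hs
    rcases h with ⟨i, hi⟩ | hr
    · obtain ⟨j, hj, rfl⟩ := he.flag hi.1 hi.2
      refine Or.inl ⟨hp.2, ?_⟩
      have := he.2
      simp only at this
      rw [this]
      simp [Op.ghost, hj, hi.1]
    · obtain ⟨a, b, rfl, ha, hb⟩ := he.shared hr
      have hd := hp.1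
      have hg := he.2
      simp only at hg ha hb
      simp only [Op.ghost, ha, if_true] at hg
      have hd' : ¬ (x.g n).done (e.thread n) := hd
      rw [ha, hb, hg]
      simp only [Function.update_self]
      by_cases hlt : arraySize b < arraySize a
      · exact Or.inr ⟨by simp [hlt], hlt⟩
      · exact Or.inl ⟨hd', Or.inr hlt⟩
  · exfalso
    rcases h with ⟨i, h1, h2⟩ | hr
    · rw [hm, h1] at h2
      cases h2
    · exact hr (by rw [hm])

theorem XRun.done_mono (x : XRun e) {n : ℕ} (h : ∀ call r, e.event n ≠ .respond call r)
    (hd : (x.g n).done (e.thread n)) : (x.g (n + 1)).done (e.thread n) := by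
  rcases (x.step n).cases_op with ⟨call, l, o, next, hs⟩ | ⟨-, -, hg | ⟨⟨call, r, hev⟩, -⟩⟩
  · obtain ⟨-, r, he, -⟩ := (x.step n).of_op hs
    exact he.done_mono hd
  · rw [hg]
    exact hd
  · exact absurd hev (h call r)

open Classical in
/-- A bound for the number of decisive steps that the threads in `S` can still perform before one of
their operations returns. -/
noncomputable def XRun.potential (x : XRun e) (S : Finset (Fin T)) (n : ℕ) : ℕ ×ₗ ℕ :=
  toLex (∑ u ∈ S, if (x.g n).done u then 0 else 1, arraySize (e.conf n).mem.shared)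

theorem XRun.potential_step (x : XRun e) {S : Finset (Fin T)} {n : ℕ}
    (h₁ : e.thread n ∈ S → ∀ call r, e.event n ≠ .respond call r)
    (h₂ : e.thread n ∉ S → ¬ e.DecisiveAt n) :
    x.potential S (n + 1) ≤ x.potential S n ∧
      (e.DecisiveAt n → x.potential S (n + 1) < x.potential S n) := by
  classical
  have hsh : ¬ e.DecisiveAt n → (e.conf (n + 1)).mem.shared = (e.conf n).mem.shared := by
    intro h
    by_contra hne
    exact h (Or.inr hne)
  have hne : ∀ u, u ≠ e.thread n → (x.g (n + 1)).done u = (x.g n).done u := fun u hu =>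
    ((x.guar n).keep u hu).done
  by_cases hS : e.thread n ∈ S
  · have hle : ∀ u ∈ S, (if (x.g (n + 1)).done u then 0 else 1) ≤
        (if (x.g n).done u then 0 else 1) := by
      intro u _
      by_cases hu : u = e.thread n
      · subst hu
        by_cases hd : (x.g n).done (e.thread n)
        · simp [hd, x.done_mono (h₁ hS) hd]
        · simp only [hd, if_false]
          split_ifs <;> simp
      · simp [hne u hu]
    have hlt : e.DecisiveAt n → x.potential S (n + 1) < x.potential S n := by
      intro h
      rw [Prod.Lex.lt_iff]
      rcases x.decisive h with ⟨hd, hd'⟩ | ⟨hd, hlt⟩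
      · left
        exact Finset.sum_lt_sum hle ⟨_, hS, by simp [hd, hd']⟩
      · right
        refine ⟨Finset.sum_congr rfl fun u _ => ?_, hlt⟩
        by_cases hu : u = e.thread n
        · subst hu
          simp [hd]
        · simp [hne u hu]
    refine ⟨?_, hlt⟩
    by_cases h : e.DecisiveAt n
    · exact (hlt h).le
    · rw [Prod.Lex.le_iff]
      rcases (Finset.sum_le_sum hle).lt_or_eq with h' | h'
      · exact Or.inl h'
      · exact Or.inr ⟨h', by simp [potential, hsh h]⟩
  · refine ⟨le_of_eq ?_, fun h => absurd h (h₂ hS)⟩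
    simp only [potential, hsh (h₂ hS)]
    congr 2
    refine Finset.sum_congr rfl fun u hu => ?_
    have : u ≠ e.thread n := fun h => hS (h ▸ hu)
    simp [hne u this]

/-- The potential is well-founded, so it reaches a minimum, after which no decisive step is
possible. The set `S` allows two uses: all threads for lock-freedom, the calling thread alone when
the others are passive. -/
theorem XRun.eventually_not_decisive (x : XRun e) {S : Finset (Fin T)} {N : ℕ}
    (h₁ : ∀ n, N ≤ n → e.thread n ∈ S → ∀ call r, e.event n ≠ .respond call r)
    (h₂ : ∀ n, N ≤ n → e.thread n ∉ S → ¬ e.DecisiveAt n) :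
    ∃ n₁, N ≤ n₁ ∧ ∀ n, n₁ ≤ n → ¬ e.DecisiveAt n := by
  obtain ⟨p, ⟨n₁, hn₁, rfl⟩, hmin⟩ := WellFounded.has_min
    (wellFounded_lt : WellFounded fun a b : ℕ ×ₗ ℕ => a < b)
    {p | ∃ n, N ≤ n ∧ x.potential S n = p} ⟨_, N, le_rfl, rfl⟩
  refine ⟨n₁, hn₁, fun n hn h => ?_⟩
  have hle : x.potential S n ≤ x.potential S n₁ := by
    clear h
    induction n, hn using Nat.le_induction with
    | base => exact le_rfl
    | succ n hn ih =>
      exact (x.potential_step (h₁ n (hn₁.trans hn)) (h₂ n (hn₁.trans hn))).1.trans ih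
  have hnn := hn₁.trans hn
  exact hmin _ ⟨n + 1, by omega, rfl⟩
    (((x.potential_step (h₁ n hnn) (h₂ n hnn)).2 h).trans_le hle)

/-! ### The stable regime -/

/-- A thread that takes infinitely many steps completes the code of its present place. -/
theorem XRun.finish (x : XRun e) {t : Fin T} (ht : e.InfinitelyOften t) {N : ℕ}
    (I : Prog K T (Loc K) → ℕ → Prop)
    (hne : ∀ m, N ≤ m → e.thread m ≠ t → ∀ p, I p m → I p (m + 1))
    (hself : ∀ m, N ≤ m → e.thread m = t → ∀ (o : Op K T) (next : o.Resp → Prog K T (Loc K)) r,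
      I (.op o next) m → o.XExec t (x.σ m) r (x.σ (m + 1)) → I (next r) (m + 1))
    {call : Call K} {l : Loc K} (p : Prog K T (Loc K)) (n : ℕ) (hn : N ≤ n)
    (hs : (e.conf n).status t = .busy call l p) (hI : I p n) :
    ∃ m, n ≤ m ∧ e.thread m = t ∧ ∃ l', (e.conf m).status t = .busy call l (.ret l') ∧
      I (.ret l') m := by
  have wait : ∀ p n, N ≤ n → (e.conf n).status t = .busy call l p → I p n →
      ∃ m, n ≤ m ∧ e.thread m = t ∧ (e.conf m).status t = .busy call l p ∧ I p m := by
    intro p n hn hs hI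
    obtain ⟨m, hm, hmt⟩ := ht n
    obtain ⟨d, rfl⟩ := Nat.exists_eq_add_of_le hm
    clear hm
    induction d generalizing n with
    | zero => exact ⟨n, le_rfl, hmt, hs, hI⟩
    | succ d ih =>
      by_cases h : e.thread n = t
      · exact ⟨n, le_rfl, h, hs, hI⟩
      · obtain ⟨m, hm, h'⟩ := ih (n + 1) (by omega)
          ((x.step n).status_ne (Ne.symm h) ▸ hs) (hne n hn h p hI) (by convert hmt using 2; omega)
        exact ⟨m, by omega, h'⟩
  induction p generalizing n with
  | ret l' =>
    obtain ⟨m, hm, hmt, h⟩ := wait _ n hn hs hI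
    exact ⟨m, hm, hmt, l', h⟩
  | op o next ih =>
    obtain ⟨m, hm, hmt, hs, hI⟩ := wait _ n hn hs hI
    have hst := x.step m
    rw [hmt] at hst
    obtain ⟨-, r, he, hs'⟩ := hst.of_op hs
    obtain ⟨m', hm', h'⟩ := ih r (m + 1) (by omega) hs' (hself m (hn.trans hm) hmt o next r hI he)
    exact ⟨m', by omega, h'⟩

theorem XRun.executing (x : XRun e) {t : Fin T} {n m : ℕ} {call : Call K}
    (hex : (e.conf n).Executing t call) (hnm : n ≤ m)
    (h : ∀ j, n ≤ j → j < m → ¬ (e.thread j = t ∧ ∃ r, e.event j = .respond call r)) :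
    (e.conf m).Executing t call := by
  induction m, hnm using Nat.le_induction with
  | base => exact hex
  | succ m hm ih =>
    obtain ⟨l, p, hs⟩ := ih fun j hj hj' => h j hj (by omega)
    by_cases ht : e.thread m = t
    · have hno := h m hm (by omega)
      have step := x.step m
      rw [ht] at step
      generalize e.conf (m + 1) = c' at step ⊢
      generalize x.g (m + 1) = g' at step
      generalize hev : e.event m = ev at step hno
      cases step with
      | invoke call h => simp [hs] at h
      | atomic call l o next h =>
        rw [hs] at h
        cases h
        exact ⟨_, _, Function.update_self ..⟩
      | jump call l l' h =>
        rw [hs] at h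
        cases h
        exact ⟨_, _, Function.update_self ..⟩
      | inserted call l h =>
        rw [hs] at h
        cases h
        exact absurd ⟨ht, _, rfl⟩ hno
      | deleted call l r h =>
        rw [hs] at h
        cases h
        exact absurd ⟨ht, _, rfl⟩ hno
    · exact ⟨l, p, by rw [(x.step m).status_ne (Ne.symm ht), hs]⟩

theorem XRun.flag_iff (x : XRun e) {N : ℕ} (hq : ∀ n, N ≤ n → ¬ e.DecisiveAt n) {n : ℕ} (hn : N ≤ n) (a : ℕ) :
    (e.conf n).mem.flag a = true ↔ (e.conf N).mem.flag a = true := by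
  refine ⟨fun h => ?_, x.flag_mono hn⟩
  induction n, hn using Nat.le_induction with
  | base => exact h
  | succ n hn ih =>
    refine ih ?_
    by_contra hf
    have hf' : (e.conf n).mem.flag a = false := by simpa using hf
    rcases (x.step n).cases_op with ⟨call, l, o, next, hs⟩ | ⟨-, hm, -⟩
    · obtain ⟨-, r, he, -⟩ := (x.step n).of_op hs
      obtain ⟨i, rfl, -⟩ := he.flag hf' h
      exact hq n hn (Or.inl ⟨i, hf', h⟩)
    · rw [hm, hf'] at h
      cases h

/-- After the last decisive step, all threads eventually know which items are logically deleted. -/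
theorem XRun.eventually_threadInv (x : XRun e) {N : ℕ} (hq : ∀ n, N ≤ n → ¬ e.DecisiveAt n) :
    ∃ n₂, N ≤ n₂ ∧ ∀ m, n₂ ≤ m → ThreadInv k {a | (e.conf N).mem.flag a = true} (e.thread m)
      ((e.conf m).status (e.thread m)) (x.σ m) := by
  set D := {a | (e.conf N).mem.flag a = true} with hD
  have hDm : ∀ m, N ≤ m → ∀ a ∈ D, (e.conf m).mem.flag a = true := fun m hm a ha =>
    (x.flag_iff hq hm a).2 ha
  have keep : ∀ t n, N ≤ n → ThreadInv k D t ((e.conf n).status t) (x.σ n) → ∀ m, n ≤ m →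
      ThreadInv k D t ((e.conf m).status t) (x.σ m) := by
    intro t n hn h m hm
    induction m, hm using Nat.le_induction with
    | base => exact h
    | succ m hm ih =>
      have hNm := hn.trans hm
      by_cases ht : t = e.thread m
      · subst ht
        exact (x.step m).threadInv_self (x.inv m).1 (hDm m hNm) ih
      · exact (x.step m).threadInv_ne (D₀ := ∅) (x.inv m).1 (by simp) (hDm m hNm)
          ((x.inv m).2 _) ht ih
  have each : ∀ t, ∃ n, N ≤ n ∧ ∀ m, n ≤ m → e.thread m = t →
      ThreadInv k D t ((e.conf m).status t) (x.σ m) := by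
    intro t
    by_cases ht : e.InfinitelyOften t
    -- The thread reaches the end of its present code, or is idle. There, its invariant can be
    -- restarted with the final set `D`; earlier, pending writes may rest on scans made before `N`.
    · have : ∃ m, N ≤ m ∧ e.thread m = t ∧
          ∀ call l o next, (e.conf m).status t ≠ .busy call l (.op o next) := by
        obtain ⟨m, hm, hmt⟩ := ht N
        by_cases h : ∀ call l o next, (e.conf m).status t ≠ .busy call l (.op o next)
        · exact ⟨m, hm, hmt, h⟩
        · push Not at h
          obtain ⟨call, l, o, next, h⟩ := h
          obtain ⟨m', hm', hmt', l', h', -⟩ := x.finish ht (N := 0) (fun _ _ => True)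
            (by simp) (by simp) _ m (by omega) h trivial
          exact ⟨m', hm.trans hm', hmt', by simp [h']⟩
      obtain ⟨m, hm, rfl, h⟩ := this
      refine ⟨m + 1, by omega, fun m' hm' _ => keep _ (m + 1) (by omega) ?_ m' hm'⟩
      exact (x.step m).threadInv_of_not_op (D₀ := ∅) (x.inv m).1 (by simp) ((x.inv m).2 _) h
    · simp only [Run.InfinitelyOften, not_forall, not_exists, not_and] at ht
      obtain ⟨n, hn⟩ := ht
      exact ⟨max N n, le_max_left _ _, fun m hm h =>
        absurd h (hn m ((le_max_right _ _).trans hm))⟩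
  choose f hf hf' using each
  refine ⟨max N (Finset.univ.sup f), le_max_left _ _, fun m hm => hf' _ m ?_ rfl⟩
  exact (Finset.le_sup (Finset.mem_univ _)).trans ((le_max_right _ _).trans hm)

/-- If the call did not return, each completed piece of code would lead to a jump to a place of
smaller rank, an infinite descent. -/
theorem XRun.responds (x : XRun e) {N : ℕ} (hq : ∀ n, N ≤ n → ¬ e.DecisiveAt n) {t : Fin T}
    (ht : e.InfinitelyOften t) (hex : (e.conf N).Executing t .deleteMin) :
    ∃ m, N ≤ m ∧ e.thread m = t ∧ ∃ r, e.event m = .respond .deleteMin r := by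
  obtain ⟨n₂, hn₂, hinv⟩ := x.eventually_threadInv hq
  set D := {a | (e.conf N).mem.flag a = true} with hD
  by_contra hno
  push Not at hno
  have hex₂ : (e.conf n₂).Executing t .deleteMin := x.executing hex hn₂ fun j hj _ h =>
    h.2.elim fun r hr => hno j hj h.1 r hr
  have hshared : ∀ m, N ≤ m → (e.conf (m + 1)).mem.shared = (e.conf m).mem.shared := by
    intro m hm
    by_contra h
    exact hq m hm (Or.inr h)
  have hI : ∀ m, N ≤ m → Inv ⟨D, True⟩ (x.σ m) := fun m hm =>
    ⟨(x.inv m).1, fun a ha => (x.flag_iff hq hm a).2 ha, fun _ a ha => (x.flag_iff hq hm a).1 ha⟩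
  have hrely : ∀ m, n₂ ≤ m → e.thread m ≠ t → Rely ⟨D, True⟩ t (x.σ m) (x.σ (m + 1)) := by
    intro m hm h
    have hm' := hn₂.trans hm
    exact ((x.step m).guar (D := D) (x.inv m).1 (hI m hm').dead (hinv m hm)).2.rely
      (P := ⟨D, True⟩) (Ne.symm h) (hI _ (by omega)) fun _ => hshared m hm'
  have jump : ∀ m call l l', N ≤ m → e.thread m = t →
      (e.conf m).status t = .busy call l (.ret l') → call = .deleteMin →
      (l' ≠ .inserted ∧ ∀ r, l' ≠ .deleted r) ∧
        (e.conf (m + 1)).status t = .busy call l' (code k t l') ∧ x.σ (m + 1) = x.σ m := by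
    intro m call l l' hm hmt hs hc
    have hp := x.pre_of_ret hs
    have step := x.step m
    rw [hmt] at step
    have hno' := hno m hm hmt
    simp only [XRun.σ]
    generalize e.conf (m + 1) = c' at step ⊢
    generalize x.g (m + 1) = g' at step ⊢
    generalize e.event m = ev at step hno'
    cases step with
    | invoke call h => simp [hs] at h
    | atomic call l o next h => simp [hs] at h
    | jump call l l' h h₁ h₂ =>
      rw [hs] at h
      cases h
      exact ⟨⟨h₁, h₂⟩, Function.update_self .., rfl⟩
    | inserted call l h =>
      rw [hs] at h
      cases h
      exact absurd hc hp.1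
    | deleted call l r h =>
      rw [hs] at h
      cases h
      exact absurd (by rw [hc]) (hno' r)
  have main : ∀ r n l p, n₂ ≤ n → (e.conf n).status t = .busy .deleteMin l p →
      wp ⟨D, True⟩ t p (Post k ⟨D, True⟩ t .deleteMin r) (x.σ n) → False := by
    intro r
    induction r using Nat.strong_induction_on with
    | _ r ih =>
      intro n l p hn hs hw
      obtain ⟨m, hm, hmt, l', hs', hw'⟩ := x.finish ht (N := n₂)
        (fun p m => wp ⟨D, True⟩ t p (Post k ⟨D, True⟩ t .deleteMin r) (x.σ m))
        (fun m hm hne p hp => wp_of_rely hp (hrely m hm hne))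
        (fun m hm _ o next r hp he => (hp _ (Rely.refl t (hI m (hn₂.trans hm)))).2 r _ he
          (hI _ (by omega)) fun _ => hshared m (hn₂.trans hm)) p n hn hs hw
      have hNm : N ≤ m := hn₂.trans (hn.trans hm)
      obtain ⟨hp, hr⟩ := hw' _ (Rely.refl t (hI m hNm))
      obtain ⟨r', hlt, hr⟩ := hr trivial
      obtain ⟨⟨h₁, h₂⟩, hs'', hσ⟩ := jump m _ l l' hNm hmt hs' rfl
      refine ih r' hlt (m + 1) l' _ (by omega) hs'' ?_
      rw [hσ]
      exact wp_code hp (fun _ => hr) h₁ h₂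
  -- The code in progress was begun at an unknown time, so it is first run to its end; the descent
  -- starts with the code entered by the next jump.
  obtain ⟨l, p, hs⟩ := hex₂
  obtain ⟨m, hm, hmt, l', hs', -⟩ := x.finish ht (N := 0) (fun _ _ => True) (by simp) (by simp) p
    n₂ (by omega) hs trivial
  obtain ⟨⟨h₁, h₂⟩, hs'', hσ⟩ := jump m _ l l' (hn₂.trans hm) hmt hs' rfl
  have hp := x.pre_of_ret hs'
  obtain ⟨r, hr⟩ := exists_rank (k := k) (D := D) hp
  refine main r (m + 1) l' _ (by omega) hs'' ?_
  rw [hσ]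
  exact wp_code hp (fun _ => hr) h₁ h₂

theorem lockFree : LockFree K k T .deleteMin := by
  intro e h0 t n hex ht
  obtain ⟨x⟩ := h0.exists_xrun
  by_contra hno
  push Not at hno
  have hno' : ∀ m, n ≤ m → ∀ call r, e.event m ≠ .respond call r := fun m hm call r h =>
    hno m hm ⟨call, r, h⟩
  obtain ⟨n₁, hn₁, hq⟩ := x.eventually_not_decisive (S := Finset.univ)
    (fun m hm _ => hno' m hm) (fun m _ h => absurd (Finset.mem_univ _) h)
  have hex₁ := x.executing hex hn₁ fun j hj _ h => h.2.elim fun r hr => hno' j hj _ r hr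
  obtain ⟨m, hm, -, r, hr⟩ := x.responds hq ht hex₁
  exact hno' m (hn₁.trans hm) _ r hr

theorem failuresOnlyByOthers : FailuresOnlyByOthers K k T := by
  intro e h0 t n hex ht hoth
  obtain ⟨x⟩ := h0.exists_xrun
  by_contra hno
  push Not at hno
  have hex' : ∀ m, n ≤ m → (e.conf m).Executing t .deleteMin := fun m hm =>
    x.executing hex hm fun j hj _ h => h.2.elim fun r hr => hno j r hj h.1 hr
  obtain ⟨n₁, hn₁, hq⟩ := x.eventually_not_decisive (S := {t}) (N := n)
    (fun m hm h call r hr => by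
      rw [Finset.mem_singleton] at h
      obtain ⟨l, p, hs⟩ := hex' m hm
      rw [← h] at hs
      obtain rfl := (x.step m).call_eq hs hr
      exact hno m r hm h hr)
    (fun m hm h => by
      rw [Finset.mem_singleton] at h
      rintro (⟨i, hi⟩ | hr)
      · exact (hoth m hm h).1 i hi
      · exact (hoth m hm h).2 hr)
  obtain ⟨m, hm, hmt, r, hr⟩ := x.responds hq ht (hex' n₁ hn₁)
  exact hno m r (hn₁.trans hm) hmt hr

end Invariant

end Runs

end KLSM

/-! ### Bounds for the number of steps of the search methods -/

namespace KLSM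

section Bounds

variable {K : Type} [LinearOrder K] {T : ℕ}

/-! ### Bounded programs -/

/-- Thread `t` executes at most `N` atomic operations of `p`, whatever the other threads do as long
as they do not write to its own distributed LSM, and the result of `p` satisfies `Q`. -/
def Bounded (t : Fin T) {α : Type} (Q : α → Prop) : ℕ → Prog K T α → Mem K T → Prop
  | _, .ret a, _ => Q a
  | 0, .op _ _, _ => False
  | N + 1, .op o next, m => ∀ m' r m'', m'.size t = m.size t → m'.slot t = m.slot t →
      o.Exec t m' r m'' → Bounded t Q N (next r) m''

variable {t : Fin T} {α β : Type} {m : Mem K T} {N M L : ℕ}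

theorem Bounded.mono {Q Q' : α → Prop} {p : Prog K T α} (h : Bounded t Q N p m) (hN : N ≤ M)
    (hQ : ∀ a, Q a → Q' a) : Bounded t Q' M p m := by
  induction N generalizing p m M with
  | zero =>
    cases p with
    | ret a => cases M <;> exact hQ _ h
    | op o next => exact h.elim
  | succ N ih =>
    cases p with
    | ret a => cases M <;> exact hQ _ h
    | op o next =>
      obtain ⟨M, rfl⟩ : ∃ M', M = M' + 1 := ⟨M - 1, by omega⟩
      exact fun m' r m'' h1 h2 he => ih (h m' r m'' h1 h2 he) (by omega)

theorem Bounded.of_own {Q : α → Prop} {p : Prog K T α} {m' : Mem K T} (h : Bounded t Q N p m)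
    (h1 : m'.size t = m.size t) (h2 : m'.slot t = m.slot t) : Bounded t Q N p m' := by
  cases p with
  | ret a => cases N <;> exact h
  | op o next =>
    cases N with
    | zero => exact h
    | succ N => exact fun m₁ r m₂ h3 h4 he => h m₁ r m₂ (h3.trans h1) (h4.trans h2) he

theorem bounded_pure {Q : α → Prop} {a : α} (h : Q a) : Bounded t Q N (pure a) m := by
  cases N <;> exact h

/-- The continuation must be bounded from every memory, so nothing about shared data is carried from
one part to the next; the result of the first part is all that is used. -/
theorem Bounded.bind {Q : β → Prop} {p : Prog K T α} {f : α → Prog K T β} {R : ℕ}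
    (h : Bounded t (fun a => ∀ m, Bounded t Q M (f a) m) N p m) (hR : N + M ≤ R) :
    Bounded t Q R (p >>= f) m := by
  change Bounded t Q R (p.bind f) m
  induction N generalizing p m R with
  | zero =>
    cases p with
    | ret a => exact Bounded.mono (h m) (by omega) fun _ => id
    | op o next => exact h.elim
  | succ N ih =>
    cases p with
    | ret a => exact Bounded.mono (h m) (by omega) fun _ => id
    | op o next =>
      obtain ⟨R, rfl⟩ : ∃ R', R = R' + 1 := ⟨R - 1, by omega⟩
      exact fun m' r m'' h1 h2 he => ih (h m' r m'' h1 h2 he) (by omega)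

theorem bounded_run {Q : β → Prop} (o : Op K T) {f : o.Resp → Prog K T β}
    (h : ∀ r m, Bounded t Q N (f r) m) : Bounded t Q (N + 1) (o.run >>= f) m :=
  fun _ r m'' _ _ _ => h r m''

theorem bounded_newBlock {Q : Block K → Prop} {l : ℕ} {its : List (Item K)}
    (h : ∀ a, Q ⟨a, l, its⟩) : Bounded t Q 1 (newBlock l its) m := by
  rintro m' r m'' - - ⟨rfl, -⟩
  exact h _

/-! ### Blocks -/

/-- The level and the number of items of the block are at most `L`. -/
def Block.SizeLE (L : ℕ) (b : Block K) : Prop := b.level ≤ L ∧ b.items.length ≤ L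

theorem Block.SizeLE.mono {b : Block K} (h : b.SizeLE L) (hM : L ≤ M) : b.SizeLE M :=
  ⟨h.1.trans hM, h.2.trans hM⟩

theorem bounded_copyLoop (b : Block K) (its : List (Item K)) (i : ℕ) (m : Mem K T) :
    Bounded t (fun r => r.length ≤ its.length) (2 * its.length) (copyLoop b i its) m := by
  induction its generalizing i m with
  | nil => exact bounded_pure (by simp)
  | cons it rest ih =>
    refine bounded_run (.readFilled b) (N := 2 * rest.length + 1) fun f m => ?_
    split
    · refine bounded_run (.readFlag it) fun d m => ?_
      refine (((ih _ m).mono le_rfl fun r hr m => ?_).bind (M := 0) le_rfl)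
      refine bounded_pure ?_
      split <;> simp <;> omega
    · exact bounded_pure (by simp)

theorem bounded_copy {b : Block K} {l : ℕ} (hb : b.SizeLE L) (hl : l ≤ L) (m : Mem K T) :
    Bounded t (Block.SizeLE L) (2 * L + 1) (b.copy l) m := by
  have := hb.2
  exact ((bounded_copyLoop b b.items 0 m).mono (M := 2 * L) (by omega) fun r hr m =>
    bounded_newBlock fun a => ⟨hl, hr.trans this⟩).bind le_rfl

theorem bounded_appendLoop (its : List (Item K)) (m : Mem K T) :
    Bounded t (fun r => r.length ≤ its.length) its.length (appendLoop its) m := by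
  induction its generalizing m with
  | nil => exact bounded_pure (by simp)
  | cons it rest ih =>
    refine bounded_run (.readFlag it) fun d m => ?_
    refine (((ih m).mono le_rfl fun r hr m => ?_).bind (M := 0) le_rfl)
    refine bounded_pure ?_
    split <;> simp <;> omega

theorem bounded_mergeBlocks {b c : Block K} {l : ℕ} (hb : b.SizeLE L) (hc : c.SizeLE L)
    (hl : l ≤ 2 * L + 1) (m : Mem K T) :
    Bounded t (Block.SizeLE (2 * L + 1)) (2 * L + 3) (mergeBlocks l b c) m := by
  refine bounded_run (.readFilled b) (N := 2 * L + 2) fun f m => ?_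
  refine bounded_run (.readFilled c) (N := 2 * L + 1) fun g m => ?_
  have h : (List.merge (b.items.take f) (c.items.take g)
      (fun x y => decide (y.key ≤ x.key))).length ≤ 2 * L := by
    rw [List.length_merge]
    have := List.length_take_le' f b.items
    have := List.length_take_le' g c.items
    have := hb.2
    have := hc.2
    omega
  exact ((bounded_appendLoop _ m).mono h fun r hr m =>
    bounded_newBlock fun a => ⟨hl, by simp only; omega⟩).bind le_rfl

theorem bounded_tailScan (its : List (Item K)) (m : Mem K T) :
    Bounded t (fun _ => True) its.length (tailScan its) m := by
  induction its generalizing m with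
  | nil => exact bounded_pure trivial
  | cons it rest ih =>
    refine bounded_run (.readFlag it) fun d m => ?_
    split
    · exact ih m
    · exact bounded_pure trivial

theorem bounded_shrinkAux {n : ℕ} {b : Block K} (hb : b.SizeLE L) (m : Mem K T) :
    Bounded t (Block.SizeLE L) ((n + 1) * (3 * L + 2)) (shrinkAux n b) m := by
  have htake : ∀ f, (b.items.take f).reverse.length ≤ L := fun f => by
    have := List.length_take_le' f b.items
    have := hb.2
    simp only [List.length_reverse]
    omega
  induction n generalizing b m with
  | zero =>
    refine Bounded.mono (N := L + 1 + 1) ?_ (by omega) fun _ => id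
    refine bounded_run (.readFilled b) fun f m => ?_
    refine ((bounded_tailScan _ m).mono (htake f) fun f' _ m => ?_).bind le_rfl
    exact bounded_run (.writeFilled b f') (N := 0) fun _ m => bounded_pure hb
  | succ n ih =>
    -- One level of the recursion reads `filled` once, scans at most `L` flags and copies in at most
    -- `2 * L + 1` operations: `3 * L + 2` in all.
    refine Bounded.mono (N := L + (2 * L + 1 + (n + 1) * (3 * L + 2)) + 1) ?_
      (by rw [Nat.succ_mul (n + 1)]; omega) fun _ => id
    refine bounded_run (.readFilled b) fun f m => ?_
    refine ((bounded_tailScan _ m).mono (htake f) fun f' _ m => ?_).bind le_rfl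
    split
    · rename_i hlt
      refine ((bounded_copy hb (hlt.le.trans hb.1) m).mono le_rfl fun c hc m => ?_).bind le_rfl
      refine ih hc m fun f => ?_
      have := List.length_take_le' f c.items
      have := hc.2
      simp only [List.length_reverse]
      omega
    · refine Bounded.mono (N := 1) ?_ (by omega) fun _ => id
      exact bounded_run (.writeFilled b f') (N := 0) fun _ m => bounded_pure hb

theorem bounded_shrink {b : Block K} (hb : b.SizeLE L) (m : Mem K T) :
    Bounded t (Block.SizeLE L) ((L + 1) * (3 * L + 2)) b.shrink m :=
  (bounded_shrinkAux hb m).mono (Nat.mul_le_mul_right _ (by have := hb.1; omega)) fun _ => id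

theorem bounded_last (b : Block K) (m : Mem K T) :
    Bounded t (fun _ => True) 1 b.last m := by
  refine bounded_run (.readFilled b) (N := 0) fun f m => ?_
  cases f <;> exact bounded_pure trivial

/-! ### Consolidation and search -/

/-- A merged block has level at most `L + 1` and at most `2 * L` items, hence size at most `2 * L +
1`, and one block fewer remains. Levels have to be bounded as well, since they limit the recursion
of `shrink`. -/
theorem bounded_mergeFront (t : Fin T) (n L : ℕ) :
    ∃ N L', ∀ (b : Block K) (rest : List (Block K)) (mg : Bool), rest.length ≤ n →
      b.SizeLE L → (∀ c ∈ rest, c.SizeLE L) → ∀ m : Mem K T,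
        Bounded t (fun r => r.1.length ≤ n + 1 ∧ ∀ c ∈ r.1, c.SizeLE L') N
          (mergeFront b rest mg) m := by
  induction n generalizing L with
  | zero =>
    refine ⟨0, L, fun b rest mg hr hb _ m => ?_⟩
    obtain rfl : rest = [] := List.length_eq_zero_iff.1 (by omega)
    exact bounded_pure (by simpa using hb)
  | succ n ih =>
    obtain ⟨N, L', h⟩ := ih (2 * L + 1)
    set S := (2 * L + 1 + 1) * (3 * (2 * L + 1) + 2)
    refine ⟨2 * L + 3 + (S + N), max L L', fun b rest mg hr hb hc m => ?_⟩
    cases rest with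
    | nil => exact bounded_pure (by simpa using hb.mono (le_max_left _ _))
    | cons c rest =>
      simp only [List.length_cons, List.mem_cons, forall_eq_or_imp] at hr hc
      have hcl := hc.1.1
      simp only [mergeFront]
      split
      · refine ((bounded_mergeBlocks hb hc.1 (by omega) m).mono le_rfl fun d hd m => ?_).bind
          le_rfl
        refine ((bounded_shrink hd m).mono le_rfl fun d' hd' m => ?_).bind le_rfl
        exact (h d' rest true (by omega) hd' (fun c hm => (hc.2 c hm).mono (by omega)) m).mono
          le_rfl fun r hr => ⟨by omega, fun c hm => (hr.2 c hm).mono (le_max_right _ _)⟩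
      · refine bounded_pure ⟨by simp only [List.length_cons]; omega, ?_⟩
        simp only [List.mem_cons, forall_eq_or_imp]
        exact ⟨hb.mono (le_max_left _ _), hc.1.mono (le_max_left _ _),
          fun c hm => (hc.2 c hm).mono (le_max_left _ _)⟩

theorem bounded_consolidatePass (t : Fin T) (n L : ℕ) :
    ∃ N, ∀ bs : List (Block K), bs.length ≤ n → (∀ c ∈ bs, c.SizeLE L) → ∀ m : Mem K T,
      Bounded t (fun r => r.1.length ≤ n) N (consolidatePass bs) m := by
  suffices h : ∃ N L', ∀ bs : List (Block K), bs.length ≤ n → (∀ c ∈ bs, c.SizeLE L) →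
      ∀ m : Mem K T, Bounded t (fun r => r.1.length ≤ n ∧ ∀ c ∈ r.1, c.SizeLE L') N
        (consolidatePass bs) m by
    obtain ⟨N, L', h⟩ := h
    exact ⟨N, fun bs hn hL m => (h bs hn hL m).mono le_rfl fun r => And.left⟩
  induction n with
  | zero =>
    refine ⟨0, L, fun bs hn _ m => ?_⟩
    obtain rfl : bs = [] := List.length_eq_zero_iff.1 (by omega)
    exact bounded_pure (by simp)
  | succ n ih =>
    obtain ⟨N, L₁, h⟩ := ih
    obtain ⟨N', L', h'⟩ := bounded_mergeFront (K := K) t n (max L L₁)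
    refine ⟨N + ((L + 1) * (3 * L + 2) + N'), L', fun bs hn hL m => ?_⟩
    cases bs with
    | nil => exact bounded_pure (by simp)
    | cons b bs =>
      simp only [List.length_cons, List.mem_cons, forall_eq_or_imp] at hn hL
      refine ((h bs (by omega) hL.2 m).mono le_rfl fun r hr m => ?_).bind le_rfl
      refine ((bounded_shrink hL.1 m).mono le_rfl fun b' hb' m => ?_).bind le_rfl
      exact h' b' r.1 r.2 hr.1 (hb'.mono (le_max_left _ _))
        (fun c hm => (hr.2 c hm).mono (le_max_right _ _)) m

theorem bounded_dropEmpty (bs : List (Block K)) (m : Mem K T) :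
    Bounded t (fun r => r.length ≤ bs.length) bs.length (dropEmpty bs) m := by
  induction bs generalizing m with
  | nil => exact bounded_pure (by simp)
  | cons b rest ih =>
    refine bounded_run (.readFilled b) fun f m => ?_
    refine (((ih m).mono le_rfl fun r hr m => ?_).bind (M := 0) le_rfl)
    refine bounded_pure ?_
    split <;> simp <;> omega

theorem bounded_writeSlots (bs : List (Block K)) (i : ℕ) (m : Mem K T) :
    Bounded t (fun _ => True) bs.length (writeSlots bs i) m := by
  induction bs generalizing i m with
  | nil => exact bounded_pure trivial
  | cons b rest ih => exact bounded_run (.writeSlot i b) fun _ m => ih (i + 1) m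

theorem bounded_minLoop (bs : List (Block K)) (m : Mem K T) :
    Bounded t (fun _ => True) bs.length (minLoop bs) m := by
  induction bs generalizing m with
  | nil => exact bounded_pure trivial
  | cons b rest ih =>
    refine ((bounded_last b m).mono le_rfl fun x _ m => ?_).bind (M := rest.length) (by simp; omega)
    exact ((ih m).mono le_rfl fun r hr m => bounded_pure trivial).bind (M := 0) le_rfl

theorem bounded_readSlots {n i : ℕ}
    (h : ∀ j b, j < i + n → m.slot t j = some b → b.SizeLE L) :
    Bounded t (fun r => r.length ≤ n ∧ ∀ b ∈ r, b.SizeLE L) n (readSlots t n i) m := by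
  induction n generalizing i m with
  | zero => exact bounded_pure (by simp)
  | succ n ih =>
    rintro m' r m'' - h2 ⟨rfl, rfl⟩
    refine Bounded.bind (p := readSlots t n (i + 1)) (M := 0)
      ((ih (i := i + 1) ?_).mono le_rfl fun r hr m => ?_) le_rfl
    · intro j b hj hb
      exact h j b (by omega) (by rw [← h2]; exact hb)
    · cases hs : m''.slot t i with
      | none => exact bounded_pure ⟨by omega, hr.2⟩
      | some b =>
        refine bounded_pure ⟨by simpa using hr.1, ?_⟩
        simp only [List.mem_cons, forall_eq_or_imp]
        exact ⟨h i b (by omega) (by rw [← h2]; exact hs), hr.2⟩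

theorem exists_slot_sizeLE (s : ℕ → Option (Block K)) (n : ℕ) :
    ∃ L, ∀ j b, j < n → s j = some b → b.SizeLE L := by
  induction n with
  | zero => exact ⟨0, fun j b hj => by omega⟩
  | succ n ih =>
    obtain ⟨L, h⟩ := ih
    cases hs : s n with
    | none =>
      refine ⟨L, fun j b hj hb => h j b ?_ hb⟩
      rcases Nat.lt_succ_iff_lt_or_eq.1 hj with hj | rfl
      · exact hj
      · simp [hs] at hb
    | some c =>
      refine ⟨L + c.level + c.items.length, fun j b hj hb => ?_⟩
      rcases Nat.lt_succ_iff_lt_or_eq.1 hj with hj | rfl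
      · exact (h j b hj hb).mono (by omega)
      · obtain rfl : c = b := by simpa [hs] using hb
        exact ⟨by omega, by omega⟩

/-- The bound is fixed by the size and slots of `t` at the start, which nobody else can change. From
the reading of the slots on, only the immutable levels and item arrays matter. -/
theorem bounded_distFindMin (t : Fin T) (m : Mem K T) :
    ∃ N, Bounded t (fun _ => True) N (distFindMin t) m := by
  obtain ⟨L, hL⟩ := exists_slot_sizeLE (m.slot t) (m.size t)
  set n := m.size t with hn
  obtain ⟨N, hN⟩ := bounded_consolidatePass (K := K) t n L
  refine ⟨(n + (N + (n + (n + 1))) + 1) + n, Bounded.bind (Bounded.mono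
    (Q := fun bs => bs.length ≤ n) (N := n + (N + (n + (n + 1))) + 1) ?_ le_rfl
    fun bs hbs m => (bounded_minLoop bs m).mono hbs fun _ => id) le_rfl⟩
  rintro m' r m'' h1 h2 ⟨rfl, rfl⟩
  refine Bounded.bind (p := readSlots t (m''.size t) 0) (N := n) (M := N + (n + (n + 1))) ?_ le_rfl
  rw [h1, ← hn]
  refine (bounded_readSlots (L := L) (fun j b hj hb => hL j b (by omega) (h2 ▸ hb))).mono le_rfl
    fun old hold m => ?_
  refine ((hN old hold.1 hold.2 m).mono le_rfl fun r hr m => ?_).bind le_rfl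
  refine ((bounded_dropEmpty r.1 m).mono hr fun bs hbs m => ?_).bind le_rfl
  refine ((bounded_writeSlots bs 0 m).mono (hbs.trans hr) fun _ _ m => ?_).bind le_rfl
  exact bounded_run (.writeSize bs.length) (N := 0) fun _ m => bounded_pure (hbs.trans hr)

theorem bounded_countLoop (bs : List (Block K × ℕ)) (m : Mem K T) :
    Bounded t (fun _ => True) bs.length (countLoop bs) m := by
  induction bs generalizing m with
  | nil => exact bounded_pure trivial
  | cons b rest ih =>
    refine bounded_run (.readFilled b.1) fun f m => ?_
    exact ((ih m).mono le_rfl fun r hr m => bounded_pure trivial).bind (M := 0) le_rfl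

theorem bounded_selectLoop (bs : List (Block K × ℕ)) (r : ℤ) (m : Mem K T) :
    Bounded t (fun _ => True) (bs.length + 2) (selectLoop bs r) m := by
  induction bs generalizing r m with
  | nil => exact bounded_pure trivial
  | cons b rest ih =>
    obtain ⟨b, p⟩ := b
    have hlast : ∀ m : Mem K T, Bounded t (fun _ => True) (rest.length + 1) b.last m := fun m =>
      (bounded_last b m).mono (by omega) fun _ => id
    refine bounded_run (.readFilled b) (N := rest.length + 2) fun f m => ?_
    split
    · exact ih _ m
    · split
      · split
        · exact (hlast m).mono (by omega) fun _ => id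
        · rename_i it _
          refine bounded_run (.readFlag it) fun d m => ?_
          split
          · exact hlast m
          · exact bounded_pure trivial
      · exact (hlast m).mono (by omega) fun _ => id

theorem bounded_findMin (a : BlockArray K) (m : Mem K T) :
    ∃ N, Bounded t (fun _ => True) N a.findMin m := by
  set bs := a.blocks.zip a.pivots with hbs
  refine ⟨bs.length + (bs.length + 2 + 1), ((bounded_countLoop bs m).mono le_rfl
    fun total _ m => ?_).bind le_rfl⟩
  split
  · exact bounded_run (.randInt (total - 1).toNat) fun r m => bounded_selectLoop bs _ m
  · exact bounded_pure trivial

end Bounds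

/-! ### From bounded code to wait-freedom along runs -/

section Runs

variable {K : Type} [LinearOrder K] {k T : ℕ} {t : Fin T}

/-! ### Wait-freedom -/

theorem Op.Exec.own {u : Fin T} {o : Op K T} {m m' : Mem K T} {r : o.Resp}
    (h : o.Exec u m r m') (hu : u ≠ t) : m'.size t = m.size t ∧ m'.slot t = m.slot t := by
  cases o <;> simp only [Op.Exec] at h
  case casShared =>
    obtain ⟨-, rfl⟩ := h
    split <;> simp
  case writeSize => subst h; simp [Function.update_of_ne hu.symm]
  case writeSlot => subst h; simp [Function.update_of_ne hu.symm]
  all_goals obtain ⟨-, rfl⟩ := h; simp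

theorem Step.other {c c' : Config K T} {u : Fin T} {ev : Event K} (h : Step k c u ev c')
    (hu : u ≠ t) : c'.status t = c.status t ∧ c'.mem.size t = c.mem.size t ∧
      c'.mem.slot t = c.mem.slot t := by
  cases h with
  | atomic call l o next h r m hr => exact ⟨Function.update_of_ne hu.symm .., hr.own hu⟩
  | _ => exact ⟨Function.update_of_ne hu.symm .., rfl, rfl⟩

/-- Within the code at the places satisfying `P`, thread `t` executes at most `N` further atomic
operations before it jumps to another place. -/
def Config.Leaves (c : Config K T) (t : Fin T) (P : Loc K → Prop) (N : ℕ) : Prop :=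
  ∀ call l p, c.status t = .busy call l p → P l → Bounded t (fun l' => ¬ P l') N p c.mem

theorem Step.leaves_other {P : Loc K → Prop} {c c' : Config K T} {u : Fin T} {ev : Event K}
    {N : ℕ} (h : Step k c u ev c') (hu : u ≠ t) (hc : c.Leaves t P N) : c'.Leaves t P N := by
  obtain ⟨h1, h2, h3⟩ := h.other hu
  exact fun call l p hs hl => (hc call l p (h1 ▸ hs) hl).of_own h2 h3

/-- An own step that stays inside cannot be a jump, because jumps lead out of `P`; so it is an
atomic operation and uses up one unit of the bound. -/
theorem Step.leaves_own {P : Loc K → Prop} {c c' : Config K T} {ev : Event K} {N : ℕ}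
    (h : Step k c t ev c') (hc : c.Leaves t P N) (hi : c.Inside t P) (hi' : c'.Inside t P) :
    ∃ M, N = M + 1 ∧ c'.Leaves t P M := by
  obtain ⟨call, l, p, hs, hl⟩ := hi
  obtain ⟨call', l', p', hs', hl'⟩ := hi'
  have hb := hc call l p hs hl
  cases h with
  | invoke call h => simp [h] at hs
  | atomic call₁ l₁ o next h r m hr =>
    rw [h] at hs
    cases hs
    cases N with
    | zero => exact hb.elim
    | succ N =>
      refine ⟨N, rfl, fun call₂ l₂ p₂ h₂ _ => ?_⟩
      simp only [Function.update_self, Status.busy.injEq] at h₂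
      obtain ⟨-, -, rfl⟩ := h₂
      exact hb _ r m rfl rfl hr
  | jump call₁ l₁ l₂ h h₁ h₂ =>
    rw [h] at hs
    cases hs
    simp only [Function.update_self, Status.busy.injEq] at hs'
    obtain ⟨-, rfl, -⟩ := hs'
    exact absurd hl' (by cases N <;> exact hb)
  | inserted call₁ l₁ h => simp at hs'
  | deleted call₁ l₁ r h => simp at hs'

/-- The bound is chosen on entry, from the memory at that moment. It is carried along the run
because the method may already be half executed when wait-freedom is claimed. -/
theorem Step.exists_leaves {P : Loc K → Prop} {c c' : Config K T} {u : Fin T} {ev : Event K}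
    (hP : ∀ l, P l → ∀ m, ∃ N, Bounded t (fun l' => ¬ P l') N (code k t l) m)
    (h : Step k c u ev c') (hc : ∃ N, c.Leaves t P N) : ∃ N, c'.Leaves t P N := by
  obtain ⟨N, hc⟩ := hc
  rcases eq_or_ne u t with rfl | hu
  swap
  · exact ⟨N, h.leaves_other hu hc⟩
  have enter : ∀ (m : Mem K T) (st : Fin T → Status K T) (call : Call K) (l : Loc K), ∃ N,
      Config.Leaves ⟨m, Function.update st u (.busy call l (code k u l))⟩ u P N := by
    intro m st call l
    by_cases hl : P l
    · obtain ⟨N, hN⟩ := hP l hl m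
      refine ⟨N, fun call₂ l₂ p₂ h₂ _ => ?_⟩
      simp only [Function.update_self, Status.busy.injEq] at h₂
      obtain ⟨-, -, rfl⟩ := h₂
      exact hN
    · refine ⟨0, fun call₂ l₂ p₂ h₂ hl₂ => ?_⟩
      simp only [Function.update_self, Status.busy.injEq] at h₂
      exact absurd (h₂.2.1 ▸ hl₂) hl
  cases h with
  | invoke call h => exact enter ..
  | jump call₁ l₁ l₂ h h₁ h₂ => exact enter ..
  | atomic call₁ l₁ o next h r m hr =>
    by_cases hl : P l₁
    · obtain ⟨M, -, hM⟩ := (Step.atomic c u call₁ l₁ o next h r m hr : Step k ..).leaves_own hc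
        ⟨_, _, _, h, hl⟩ ⟨call₁, l₁, next r, Function.update_self .., hl⟩
      exact ⟨M, hM⟩
    · refine ⟨0, fun call₂ l₂ p₂ h₂ hl₂ => ?_⟩
      simp only [Function.update_self, Status.busy.injEq] at h₂
      exact absurd (h₂.2.1 ▸ hl₂) hl
  | inserted call₁ l₁ h => exact ⟨0, fun call₂ l₂ p₂ h₂ => by simp at h₂⟩
  | deleted call₁ l₁ r h => exact ⟨0, fun call₂ l₂ p₂ h₂ => by simp at h₂⟩

theorem Run.ownSteps_succ (e : Run K k T) (t : Fin T) (n : ℕ) :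
    e.ownSteps t (n + 1) = e.ownSteps t n + if e.thread n = t then 1 else 0 := by
  unfold Run.ownSteps
  rw [Finset.range_add_one, Finset.filter_insert]
  split
  · rw [Finset.card_insert_of_notMem (by simp)]
  · simp

theorem waitFree_of_bounded {P : Loc K → Prop}
    (hP : ∀ (t : Fin T) l, P l → ∀ m, ∃ N, Bounded t (fun l' => ¬ P l') N (code k t l) m) :
    WaitFree K k T P := by
  intro e h0 t n _
  have hlv : ∀ n, ∃ N, (e.conf n).Leaves t P N := by
    intro n
    induction n with
    | zero =>
      refine ⟨0, fun call l p h => ?_⟩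
      rw [show e.conf 0 = _ from h0] at h
      simp [Config.init] at h
    | succ n ih => exact (e.step n).exists_leaves (hP t) ih
  obtain ⟨N, hN⟩ := hlv n
  -- After at most `N` atomic operations, one more own step is needed for the jump that leaves the
  -- method.
  refine ⟨N + 1, fun e' he' m hm => ?_⟩
  by_contra hno
  push Not at hno
  have key : ∀ j, j ≤ m → ∃ M, M + e'.ownSteps t j = N ∧ (e'.conf j).Leaves t P M := by
    intro j
    induction j with
    | zero => exact fun _ => ⟨N, by simp [Run.ownSteps], he' ▸ hN⟩
    | succ j ih =>
      intro hj
      obtain ⟨M, hM, hl⟩ := ih (by omega)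
      rw [e'.ownSteps_succ]
      have hstep := e'.step j
      split
      · rename_i htj
        rw [htj] at hstep
        obtain ⟨M', rfl, hl'⟩ := hstep.leaves_own hl (hno j (by omega)) (hno (j + 1) hj)
        exact ⟨M', by omega, hl'⟩
      · rename_i htj
        exact ⟨M, by omega, hstep.leaves_other htj hl⟩
  obtain ⟨M, hM, -⟩ := key m le_rfl
  omega

theorem waitFree_distFind : WaitFree K k T (fun l => l = .distFind) := by
  refine waitFree_of_bounded fun t l hl m => ?_
  subst hl
  obtain ⟨N, hN⟩ := bounded_distFindMin t m
  exact ⟨N, (hN.mono le_rfl fun item _ m => bounded_pure (by simp)).bind (M := 0) le_rfl⟩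

theorem waitFree_snapFind :
    WaitFree K k T (fun l => ∃ item snap, l = .snapFind item snap) := by
  refine waitFree_of_bounded fun t l hl m => ?_
  obtain ⟨item, a, rfl⟩ := hl
  obtain ⟨N, hN⟩ := bounded_findMin (t := t) a m
  exact ⟨N, (hN.mono le_rfl fun cand _ m => bounded_pure (by simp)).bind (M := 0) le_rfl⟩

end Runs

end KLSM
theorem mainTheorem3 (K : Type) [LinearOrder K] (k T : ℕ) :
    KLSM.LockFree K k T .deleteMin ∧
    KLSM.WaitFree K k T (fun l => l = .distFind) ∧
    KLSM.WaitFree K k T (fun l => ∃ item snap, l = .snapFind item snap) ∧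
    KLSM.FailuresOnlyByOthers K k T ∧
    KLSM.FindsActiveOrEmpty K k T :=
  ⟨KLSM.lockFree, KLSM.waitFree_distFind, KLSM.waitFree_snapFind, KLSM.failuresOnlyByOthers,
    KLSM.findsActiveOrEmpty⟩
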